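/- **Conventions.** $\mathbb C'=\{x+i'y\}$, $(i')^2=1$, is the ring of para-complex numbers, $\overline{x+i'y}=x-i'y$, $\mathbb S^{1'}=\{e^{i't}:t\in\mathbb R\}$, $\partial_z=\frac12(\partial_x+i'\partial_y)$, $\partial_{\bar z}=\frac12(\partial_x-i'\partial_y)$. $\mathrm{Nil}_t^3$ is $\mathbb R^3$ with $x\cdot\tilde x=(x_1+\tilde x_1,\,x_2+\tilde x_2,\,x_3+\tilde x_3+\frac12(x_1\tilde x_2-\tilde x_1x_2))$ and the left-invariant metric $-dx_1^2+dx_2^2+(dx_3+\frac12(x_2dx_1-x_1dx_2))^2$; $\varepsilon_1,\varepsilon_2,\varepsilon_3$ is the left-invariant orthonormal frame equal to $\partial_1,\partial_2,\partial_3$ at $0$. Let $$\mathcal E_1=\tfrac12\begin{pmatrix}0&-i'\\ i'&0\end{pmatrix},\quad \mathcal E_2=\tfrac12\begin{pmatrix}0&-1\\-1&0\end{pmatrix},\quad \mathcal E_3=\tfrac12\begin{pmatrix}i'&0\\0&-i'\end{pmatrix}$$ be the basis of $\mathfrak{su}'_{1,1}$, $\Xi_{\mathrm{nil}_t}(\sum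 x_k\mathcal E_k)=(x_1,x_2,x_3)$, and $\sigma_3=\mathrm{diag}(1,-1)$. A *timelike minimal surface* is a smooth timelike immersion with zero mean curvature. Put $\Phi(\psi_1,\psi_2)=\bigl(i'(\overline{\psi_2}^2+\psi_1^2),\ \overline{\psi_2}^2-\psi_1^2,\ 2\psi_1\overline{\psi_2}\bigr)$. Smooth functions $\psi_1,\psi_2$ are *generating spinors* of a map $f$ into $\mathrm{Nil}_t^3$ with unit $\delta\in\{\pm1,\pm i'\}$ if $f^{-1}f_z=\delta\,\Phi(\psi_1,\psi_2)$ in the frame $(\varepsilon_k)$. (For $\delta=1$ this is the usual representation with $\epsilon=i'$; for $\delta=-1$ it is the one with $\epsilon=-i'$ for $(-\psi_1,\psi_2)$; $\delta=\pm i'$ are these two with respect to the conformal coordinate $i'z$.) For such spinors let $$h=2(\psi_2\overline{\psi_2}-\psi_1\overline{\psi_1}),\qquad B=-\tfrac{i'}2\,\delta\,\bigl(\psi_1(\overline{\psi_2})_z-\overline{\psi_2}(\psi_1)_z\bigr)$$ be the support function and the coefficient of the Abresch--Rosenberg differential $4B\,dz^2$. If $h$ has no zeros, $\epsilon\in\{\pm1,\pm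 i'\}$ and $s$ is a smooth square root of $\epsilon B$ on an open set $\Omega$, the *dual spinors* are $\psi_1^*=\frac{4s}{h}\psi_2$, $\psi_2^*=\frac{4\bar s}{h}\psi_1$; a map $f^*$ on $\Omega$ is a *dual* of $f$ if, for some such $\delta,\psi_1,\psi_2,\epsilon,s$, it has generating spinors $\psi_1^*,\psi_2^*$ with unit $\epsilon\delta$. **Data.** Let $\mathbb D\subset\mathbb C'$ be a connected open set, $f:\mathbb D\to\mathrm{Nil}_t^3$ a timelike minimal surface with generating spinors $\psi_1,\psi_2$ with unit $1$ (that is, $\epsilon=i'$), with $h>0$ and $B\not\equiv0$, and define $w$ by $e^{w/2}=h/4$. Let $F(\mu)$, $\mu\in\mathbb S^{1'}$, be an extended frame: a family of maps $\mathbb D\to\mathrm{SU}'_{1,1}$, smooth in $(\mu,z)$, with $F^{-1}dF=U^\mu dz+V^\mu d\bar z$, $$U^\mu=\begin{pmatrix}\frac14w_z&-\mu^{-1}i'e^{w/2}\\ \mu^{-1}Bi'e^{-w/2}&-\frac14w_z\end{pmatrix},\quad V^\mu=\begin{pmatrix}-\frac14w_{\bar z}&-\mu\bar Bi'e^{-w/2}\\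 \mu i'e^{w/2}&\frac14w_{\bar z}\end{pmatrix},\quad F(1)=\frac1{\sqrt{\psi_2\overline{\psi_2}-\psi_1\overline{\psi_1}}}\begin{pmatrix}\overline{\psi_2}&\overline{\psi_1}\\ \psi_1&\psi_2\end{pmatrix}.$$ With $\mu\partial_\mu G(\mu)=i'\frac{d}{ds}\big|_{s=0}G(\mu e^{i's})$ put $$N_m=\tfrac{i'}2F\sigma_3F^{-1},\quad m_\pm=-i'\mu(\partial_\mu F)F^{-1}\pm N_m,\quad \widehat f^\mu_\pm=m_\pm^{\mathrm o}-\tfrac{i'}2\bigl(\mu\partial_\mu m_\pm\bigr)^{\mathrm d},\quad f^\mu_\pm=\Xi_{\mathrm{nil}_t}\circ\widehat f^\mu_\pm,$$ where $\mathrm o,\mathrm d$ denote off-diagonal and diagonal parts. Write $N_m=n_1\mathcal E_1+n_2\mathcal E_2+n_3\mathcal E_3$. **Theorem.** 1. For every $\mu\in\mathbb S^{1'}$, $N_m$ and $\widehat f^\mu_\pm$ take values in $\mathfrak{su}'_{1,1}$ and $f^\mu_\pm$ are smooth on $\mathbb D$. The map $f^\mu_-$ is immersive at a point exactly when $n_3\ne0$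 there, and $f^\mu_+$ exactly when $n_3\neq0$ and $B\bar B\ne0$ there. At the points where they are immersive, $f^\mu_\pm$ are timelike minimal surfaces. 2. At these points $N_m$ is the normal Gauss map of $f^\mu_-$, and of $f^\mu_+$ after the rigid motion $(x_1,x_2,x_3)\mapsto(-x_1,-x_2,x_3)$. Here $N_m$ is the normal Gauss map of a surface if $-n_1^2+n_2^2+n_3^2=1$ and some left-translated unit normal $\nu=\nu_1\varepsilon_1+\nu_2\varepsilon_2+\nu_3\varepsilon_3$ satisfies $\frac{\nu_1+i'\nu_2}{1-\nu_3}=\frac{n_2+i'n_1}{1+n_3}$ (stereographic projections of the two de Sitter spheres); where $\nu_3=1$ this is understood as $(n_1,n_2,n_3)=(-\nu_2,-\nu_1,-1)$. 3. At $\mu=1$, $f^\mu_-$ is $f$ up to a left translation. Whenever $\epsilon\in\{\pm1,\pm i'\}$ and $s$ is a smooth square root of $\epsilon B$ on an open $\Omega\subset\mathbb D$, $f^\mu_+|_{\mu=1}$ has on $\Omega$ the dual spinors of $\psi_1,\psi_2$ as generating spinors, with unit $\epsilon$. Such $\epsilon,s$ exist, and so $f^\mu_+|_{\mu=1}$ is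 a dual of $f$, on every connected open $\Omega\subset\mathbb D$ on which $B\bar B$ has no zeros. 4. For every $\mu\in\mathbb S^{1'}$ and every connected open $\Omega\subset\mathbb D$ on which $B\bar B$ has no zeros, $f^\mu_+$ is a dual of $f^\mu_-$ and $f^\mu_-$ is a dual of $f^\mu_+$ on $\Omega$. -/

import Mathlib

open scoped ContDiff

noncomputable section

/-! ## Para-complex numbers -/

/-- The ring of para-complex numbers `x + i' y` with `(i')² = 1`.
Para-conjugation `x + i' y ↦ x - i' y` is `star`, and `QuadraticAlgebra.norm z` is the real number
`z z̄ = x² - y²` (which may be zero or negative). -/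
abbrev ParaC : Type := QuadraticAlgebra ℝ 1 0

namespace ParaC

/-- The para-complex unit `i'`. -/
def I : ParaC := ⟨0, 1⟩

theorem I_mul_I : I * I = 1 := by
  ext <;> simp [I, QuadraticAlgebra.re_one, QuadraticAlgebra.im_one]

/-- A real number as a para-complex number. -/
def ofReal (r : ℝ) : ParaC := ⟨r, 0⟩

/-- `e^{i' t} = cosh t + i' sinh t`. -/
def expI (t : ℝ) : ParaC := ⟨Real.cosh t, Real.sinh t⟩

/-- The para-complex circle `{e^{i' t} | t ∈ ℝ}`. -/
def circle : Set ParaC := Set.range expI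

/-- `z z̄` is the real number `norm z`. -/
theorem mul_star_eq_norm (z : ParaC) : z * star z = ofReal (QuadraticAlgebra.norm z) := by
  rw [← QuadraticAlgebra.algebraMap_norm_eq_mul_star]
  rfl

/-- On the para-complex circle the inverse is the para-conjugate. -/
theorem mul_star_of_mem_circle {μ : ParaC} (h : μ ∈ circle) : μ * star μ = 1 := by
  obtain ⟨t, rfl⟩ := h
  have := Real.cosh_sq t
  ext
  · simp [expI, QuadraticAlgebra.re_one]; nlinarith
  · simp [expI, QuadraticAlgebra.im_one]; ring

/-- Smoothness of a para-complex valued function: both components are smooth. -/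
def SmoothOn {E : Type*} [NormedAddCommGroup E] [NormedSpace ℝ E] (u : E → ParaC) (s : Set E) :
    Prop :=
  ContDiffOn ℝ ∞ (fun p => (u p).re) s ∧ ContDiffOn ℝ ∞ (fun p => (u p).im) s

/-- The derivative of a para-complex valued function of `(x, y)` in the direction `a`. -/
def dirDeriv (u : ℝ × ℝ → ParaC) (a : ℝ × ℝ) (p : ℝ × ℝ) : ParaC :=
  ⟨fderiv ℝ (fun q => (u q).re) p a, fderiv ℝ (fun q => (u q).im) p a⟩

/-- `∂_z = (∂_x + i' ∂_y) / 2`, for `z = x + i' y`. -/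
def dz (u : ℝ × ℝ → ParaC) (p : ℝ × ℝ) : ParaC :=
  (1 / 2 : ℝ) • (dirDeriv u (1, 0) p + I * dirDeriv u (0, 1) p)

/-- `∂_z̄ = (∂_x - i' ∂_y) / 2`. -/
def dzbar (u : ℝ × ℝ → ParaC) (p : ℝ × ℝ) : ParaC :=
  (1 / 2 : ℝ) • (dirDeriv u (1, 0) p - I * dirDeriv u (0, 1) p)

/-- `μ ∂_μ` for functions on the para-complex circle.  As `d/ds G(μ e^{i' s}) = i' μ ∂_μ G`
at `s = 0` and `(i')² = 1`, this is `μ ∂_μ G = i' d/ds G(μ e^{i' s})` at `s = 0`. -/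
def muDeriv (G : ParaC → ParaC) (μ : ParaC) : ParaC :=
  I * ⟨deriv (fun s : ℝ => (G (μ * expI s)).re) 0, deriv (fun s : ℝ => (G (μ * expI s)).im) 0⟩

end ParaC

open ParaC

/-! ## The Lorentzian Heisenberg group `Nil_t³` -/

namespace NilT

/-- The group multiplication of the Heisenberg group on `ℝ³`. -/
def mul (x y : Fin 3 → ℝ) : Fin 3 → ℝ :=
  ![x 0 + y 0, x 1 + y 1, x 2 + y 2 + (1 / 2) * (x 0 * y 1 - y 0 * x 1)]

/-- The contact form `dx₃ + (x₂ dx₁ - x₁ dx₂) / 2` at `x`. -/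
def contact (x v : Fin 3 → ℝ) : ℝ := v 2 + (1 / 2) * (x 1 * v 0 - x 0 * v 1)

/-- The left-invariant Lorentzian metric `-dx₁² + dx₂² + (dx₃ + (x₂ dx₁ - x₁ dx₂) / 2)²`. -/
def metric (x u v : Fin 3 → ℝ) : ℝ :=
  -(u 0 * v 0) + u 1 * v 1 + contact x u * contact x v

/-- The Levi-Civita connection in the coordinates of `ℝ³`: Christoffel symbols of the first kind,
`⟨∇_u v, w⟩ = (u⟨v, w⟩ + v⟨u, w⟩ - w⟨u, v⟩) / 2` for constant vector fields `u, v, w`. -/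
def christoffel (x u v w : Fin 3 → ℝ) : ℝ :=
  (1 / 2) * (fderiv ℝ (fun y => metric y v w) x u + fderiv ℝ (fun y => metric y u w) x v
    - fderiv ℝ (fun y => metric y u v) x w)

/-- The left translation `x⁻¹ v` to the Lie algebra of a tangent vector `v` at `x`, in the
left-invariant orthonormal basis `ε₁, ε₂, ε₃`, which is `∂₁, ∂₂, ∂₃` at the identity. -/
def leftTranslate (x v : Fin 3 → ℝ) : Fin 3 → ℝ := ![v 0, v 1, contact x v]

/-- The inverse of `x` is `-x`, and `leftTranslate x` is the differential of left translation by
it. -/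
theorem leftTranslate_eq (x v : Fin 3 → ℝ) :
    mul (-x) x = 0 ∧
      HasDerivAt (fun s : ℝ => mul (-x) (x + s • v)) (leftTranslate x v) 0 := by
  constructor
  · ext i; fin_cases i <;> simp [mul, mul_comm]
  · have h : (fun s : ℝ => mul (-x) (x + s • v)) = fun s : ℝ => s • leftTranslate x v := by
      funext s; ext i; fin_cases i <;> simp [mul, leftTranslate, contact]; ring
    rw [h]
    simpa using (hasDerivAt_id (0 : ℝ)).smul_const (leftTranslate x v)

/-- The inner product of the Lie algebra, `diag(-1, 1, 1)` in the basis `ε₁, ε₂, ε₃`. -/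
def lieInner (a b : Fin 3 → ℝ) : ℝ := -(a 0 * b 0) + a 1 * b 1 + a 2 * b 2

/-- The half-turn `(x₁, x₂, x₃) ↦ (-x₁, -x₂, x₃)` about the `x₃`-axis, an isometric automorphism. -/
def halfTurn (x : Fin 3 → ℝ) : Fin 3 → ℝ := ![-x 0, -x 1, x 2]

theorem halfTurn_mul (x y : Fin 3 → ℝ) :
    halfTurn (mul x y) = mul (halfTurn x) (halfTurn y) := by
  ext i; fin_cases i <;> simp [halfTurn, mul] <;> ring

theorem metric_halfTurn (x u v : Fin 3 → ℝ) :
    metric (halfTurn x) (halfTurn u) (halfTurn v) = metric x u v := by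
  simp [halfTurn, metric, contact]

end NilT

/-! ## Surfaces in `Nil_t³` -/

section Surfaces

open NilT

/-- First fundamental form of `f` at `p`. -/
def firstForm (f : ℝ × ℝ → Fin 3 → ℝ) (p a b : ℝ × ℝ) : ℝ :=
  metric (f p) (fderiv ℝ f p a) (fderiv ℝ f p b)

/-- Second fundamental form `⟨∇_a (df b), n⟩` of `f` at `p`, with respect to a normal vector `n`
at `f p`. -/
def secondForm (f : ℝ × ℝ → Fin 3 → ℝ) (n : Fin 3 → ℝ) (p a b : ℝ × ℝ) : ℝ :=
  metric (f p) (fderiv ℝ (fun q => fderiv ℝ f q b) p a) n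
    + christoffel (f p) (fderiv ℝ f p a) (fderiv ℝ f p b) n

/-- Determinant of the first fundamental form. -/
def detFirst (f : ℝ × ℝ → Fin 3 → ℝ) (p : ℝ × ℝ) : ℝ :=
  firstForm f p (1, 0) (1, 0) * firstForm f p (0, 1) (0, 1) - firstForm f p (1, 0) (0, 1) ^ 2

/-- Mean curvature, half of the trace of the second fundamental form with respect to the first. -/
def meanCurvature (f : ℝ × ℝ → Fin 3 → ℝ) (n : Fin 3 → ℝ) (p : ℝ × ℝ) : ℝ :=
  (firstForm f p (1, 0) (1, 0) * secondForm f n p (0, 1) (0, 1)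
    - 2 * firstForm f p (1, 0) (0, 1) * secondForm f n p (1, 0) (0, 1)
    + firstForm f p (0, 1) (0, 1) * secondForm f n p (1, 0) (1, 0)) / (2 * detFirst f p)

/-- `n` is a unit normal of `f` at `p`. -/
def IsUnitNormalAt (f : ℝ × ℝ → Fin 3 → ℝ) (n : Fin 3 → ℝ) (p : ℝ × ℝ) : Prop :=
  (∀ a : ℝ × ℝ, metric (f p) n (fderiv ℝ f p a) = 0) ∧ metric (f p) n n = 1

/-- `f` is immersive at `p`. -/
def IsImmersedAt (f : ℝ × ℝ → Fin 3 → ℝ) (p : ℝ × ℝ) : Prop :=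
  Function.Injective (fderiv ℝ f p)

/-- At `p` the map `f` is a smooth timelike immersion (the induced metric is Lorentzian) with
vanishing mean curvature. -/
def IsTimelikeMinimalAt (f : ℝ × ℝ → Fin 3 → ℝ) (p : ℝ × ℝ) : Prop :=
  ContDiffAt ℝ ∞ f p ∧ IsImmersedAt f p ∧ detFirst f p < 0 ∧
    ∀ n, IsUnitNormalAt f n p → meanCurvature f n p = 0

/-- The three components of `f⁻¹ f_z = (f⁻¹ f_x + i' f⁻¹ f_y) / 2` in the basis `ε₁, ε₂, ε₃`. -/
def leftDz (f : ℝ × ℝ → Fin 3 → ℝ) (p : ℝ × ℝ) (k : Fin 3) : ParaC :=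
  ⟨leftTranslate (f p) (fderiv ℝ f p (1, 0)) k / 2,
    leftTranslate (f p) (fderiv ℝ f p (0, 1)) k / 2⟩

/-- Stereographic projection of the de Sitter sphere `-ν₁² + ν₂² + ν₃² = 1` of the Lie algebra of
`Nil_t³` from `(0, 0, 1)`, namely `(ν₁ + i' ν₂) / (1 - ν₃)`. -/
def stereoNil (ν : Fin 3 → ℝ) : ParaC := ⟨ν 0 / (1 - ν 2), ν 1 / (1 - ν 2)⟩

/-- Stereographic projection from `(0, 0, -1)` of the de Sitter sphere of `su'(1,1)`, in the basis
`E₁, E₂, E₃` and with `E₂, E₁` as real and imaginary axis, namely `(n₂ + i' n₁) / (1 + n₃)`. -/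
def stereoSu (n : Fin 3 → ℝ) : ParaC := ⟨n 1 / (1 + n 2), n 0 / (1 + n 2)⟩

/-- The point `n` of the de Sitter sphere of `su'(1,1)` is the normal Gauss map of `f` at `p`:
both stereographic projections agree for `n` and for a left-translated unit normal `ν` of `f`.
At the poles, where the projections are undefined, this means the continuous extension. -/
def IsNormalGaussMapAt (f : ℝ × ℝ → Fin 3 → ℝ) (n : Fin 3 → ℝ) (p : ℝ × ℝ) : Prop :=
  lieInner n n = 1 ∧
  ∃ N, IsUnitNormalAt f N p ∧
    (leftTranslate (f p) N 2 ≠ 1 →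
      n 2 ≠ -1 ∧ stereoNil (leftTranslate (f p) N) = stereoSu n) ∧
    (leftTranslate (f p) N 2 = 1 →
      n 2 = -1 ∧ leftTranslate (f p) N 0 = -n 1 ∧ leftTranslate (f p) N 1 = -n 0)

end Surfaces

/-! ## Generating spinors and duality -/

section Spinors

/-- `(i'(ψ̄₂² + ψ₁²), ψ̄₂² - ψ₁², 2 ψ₁ ψ̄₂)`, that is
`(ε(ψ̄₂² + ψ₁²), ε i'(ψ̄₂² - ψ₁²), 2 ψ₁ ψ̄₂)` with `ε = i'`. -/
def spinorVec (a b : ParaC) : Fin 3 → ParaC :=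
  ![I * (star b ^ 2 + a ^ 2), star b ^ 2 - a ^ 2, 2 * a * star b]

/-- The possible units `±1, ±i'`. -/
def fourUnits : Set ParaC := {1, -1, I, -I}

/-- `(ψ₁, ψ₂)` are generating spinors of `f` on `Ω` with unit `δ`.
For `δ = 1` this is the usual spinor representation `f⁻¹ f_z = (φ₁, φ₂, φ₃)` with `ε = i'`; for
`δ = -1` it is the one with `ε = -i'` for the pair `(-ψ₁, ψ₂)`; and `δ = ± i'` are these two in the
conformal coordinate `i' z` instead of `z` (the metric is then a negative multiple of `dz dz̄`). -/
def IsGeneratingSpinors (δ : ParaC) (ψ₁ ψ₂ : ℝ × ℝ → ParaC) (f : ℝ × ℝ → Fin 3 → ℝ)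
    (Ω : Set (ℝ × ℝ)) : Prop :=
  δ ∈ fourUnits ∧ SmoothOn ψ₁ Ω ∧ SmoothOn ψ₂ Ω ∧
    ∀ p ∈ Ω, ∀ k, leftDz f p k = δ * spinorVec (ψ₁ p) (ψ₂ p) k

/-- The support function `h = 2 (ψ₂ ψ̄₂ - ψ₁ ψ̄₁)`. -/
def supportFn (ψ₁ ψ₂ : ℝ × ℝ → ParaC) (p : ℝ × ℝ) : ℝ :=
  2 * (QuadraticAlgebra.norm (ψ₂ p) - QuadraticAlgebra.norm (ψ₁ p))

/-- The coefficient `B` of the Abresch-Rosenberg differential `4 B dz²` of a surface with zero mean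
curvature, `B = -(i'/2) (ψ₁ (ψ̄₂)_z - ψ̄₂ (ψ₁)_z)`, for spinors with unit `δ`. -/
def abreschRosenberg (δ : ParaC) (ψ₁ ψ₂ : ℝ × ℝ → ParaC) (p : ℝ × ℝ) : ParaC :=
  δ * (-((1 / 2 : ℝ) • I) *
    (ψ₁ p * dz (fun q => star (ψ₂ q)) p - star (ψ₂ p) * dz ψ₁ p))

/-- First dual spinor `ψ₁* = (4 s / h) ψ₂`, where `s` is a square root of `ε B`. -/
def dualSpinor₁ (s ψ₁ ψ₂ : ℝ × ℝ → ParaC) (p : ℝ × ℝ) : ParaC :=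
  (4 / supportFn ψ₁ ψ₂ p) • (s p * ψ₂ p)

/-- Second dual spinor `ψ₂* = (4 s̄ / h) ψ₁`, where `s` is a square root of `ε B`. -/
def dualSpinor₂ (s ψ₁ ψ₂ : ℝ × ℝ → ParaC) (p : ℝ × ℝ) : ParaC :=
  (4 / supportFn ψ₁ ψ₂ p) • (star (s p) * ψ₁ p)

/-- `s` is a smooth square root of `ε B` on `Ω`, with `ε ∈ {±1, ±i'}`. -/
def IsRootOn (ε δ : ParaC) (s ψ₁ ψ₂ : ℝ × ℝ → ParaC) (Ω : Set (ℝ × ℝ)) : Prop :=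
  ε ∈ fourUnits ∧ SmoothOn s Ω ∧ ∀ p ∈ Ω, s p ^ 2 = ε * abreschRosenberg δ ψ₁ ψ₂ p

/-- `fd` is a dual surface of `f` on `Ω`: the surface `f` has generating spinors `(ψ₁, ψ₂)` with
nonvanishing support function, and `fd` has the dual generating spinors `(ψ₁*, ψ₂*)`. -/
def IsDualSurface (f fd : ℝ × ℝ → Fin 3 → ℝ) (Ω : Set (ℝ × ℝ)) : Prop :=
  ∃ (ε δ : ParaC) (s ψ₁ ψ₂ : ℝ × ℝ → ParaC),
    IsGeneratingSpinors δ ψ₁ ψ₂ f Ω ∧ (∀ p ∈ Ω, supportFn ψ₁ ψ₂ p ≠ 0) ∧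
    IsRootOn ε δ s ψ₁ ψ₂ Ω ∧
    IsGeneratingSpinors (ε * δ) (dualSpinor₁ s ψ₁ ψ₂) (dualSpinor₂ s ψ₁ ψ₂) fd Ω

end Spinors

/-! ## Extended frames and the Sym formula -/

section Frames

/-- `2 × 2` para-complex matrices. -/
abbrev Mat2 : Type := Matrix (Fin 2) (Fin 2) ParaC

/-- The group `SU'(1,1)`. -/
def SU11 : Set Mat2 :=
  {A | ∃ α β : ParaC, A = !![α, β; star β, star α] ∧ α * star α - β * star β = 1}

/-- Basis vector `E₁` of the Lie algebra `su'(1,1)`. -/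
def E₁ : Mat2 := (1 / 2 : ℝ) • !![0, -I; I, 0]

/-- Basis vector `E₂` of the Lie algebra `su'(1,1)`. -/
def E₂ : Mat2 := (1 / 2 : ℝ) • !![0, -1; -1, 0]

/-- Basis vector `E₃` of the Lie algebra `su'(1,1)`. -/
def E₃ : Mat2 := (1 / 2 : ℝ) • !![I, 0; 0, -I]

/-- `x₁ E₁ + x₂ E₂ + x₃ E₃`. -/
def suVec (x : Fin 3 → ℝ) : Mat2 := x 0 • E₁ + x 1 • E₂ + x 2 • E₃

/-- Coordinates of an element of `su'(1,1)` in the basis `E₁, E₂, E₃`; they are also the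
coordinates in `Nil_t³` of its image under `x₁ E₁ + x₂ E₂ + x₃ E₃ ↦ (x₁, x₂, x₃)`. -/
def suCoord (X : Mat2) : Fin 3 → ℝ := ![-2 * (X 0 1).im, -2 * (X 0 1).re, 2 * (X 0 0).im]

theorem suCoord_suVec (x : Fin 3 → ℝ) : suCoord (suVec x) = x := by
  ext i; fin_cases i <;> simp [suCoord, suVec, E₁, E₂, E₃, I, QuadraticAlgebra.re_one,
    QuadraticAlgebra.im_one] <;> ring

/-- Pauli matrix. -/
def σ₃ : Mat2 := !![1, 0; 0, -1]

/-- `w` with `e^{w/2} = h / 4`, for `h > 0`. -/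
def diracLog (ψ₁ ψ₂ : ℝ × ℝ → ParaC) (p : ℝ × ℝ) : ℝ := 2 * Real.log (supportFn ψ₁ ψ₂ p / 4)

/-- `e^{w/2} = h / 4`. -/
theorem exp_diracLog {ψ₁ ψ₂ : ℝ × ℝ → ParaC} {p : ℝ × ℝ} (h : 0 < supportFn ψ₁ ψ₂ p) :
    Real.exp (diracLog ψ₁ ψ₂ p / 2) = supportFn ψ₁ ψ₂ p / 4 := by
  rw [diracLog, mul_div_cancel_left₀ _ two_ne_zero, Real.exp_log (by positivity)]

/-- The matrix `U^μ`, for `μ` on the para-complex circle, so that `μ⁻¹ = μ̄`. -/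
def laxU (ψ₁ ψ₂ : ℝ × ℝ → ParaC) (μ : ParaC) (p : ℝ × ℝ) : Mat2 :=
  !![(1 / 4 : ℝ) • dz (fun q => ofReal (diracLog ψ₁ ψ₂ q)) p,
      -(Real.exp (diracLog ψ₁ ψ₂ p / 2) • (star μ * I));
    Real.exp (-diracLog ψ₁ ψ₂ p / 2) • (star μ * abreschRosenberg 1 ψ₁ ψ₂ p * I),
      -((1 / 4 : ℝ) • dz (fun q => ofReal (diracLog ψ₁ ψ₂ q)) p)]

/-- The matrix `V^μ`. -/
def laxV (ψ₁ ψ₂ : ℝ × ℝ → ParaC) (μ : ParaC) (p : ℝ × ℝ) : Mat2 :=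
  !![-((1 / 4 : ℝ) • dzbar (fun q => ofReal (diracLog ψ₁ ψ₂ q)) p),
      -(Real.exp (-diracLog ψ₁ ψ₂ p / 2) • (μ * star (abreschRosenberg 1 ψ₁ ψ₂ p) * I));
    Real.exp (diracLog ψ₁ ψ₂ p / 2) • (μ * I),
      (1 / 4 : ℝ) • dzbar (fun q => ofReal (diracLog ψ₁ ψ₂ q)) p]

/-- `F` is an extended frame on `D` of the timelike minimal surface with generating spinors
`(ψ₁, ψ₂)` and positive support function: a smooth family, parametrized by the para-complex circle,
of `SU'(1,1)`-valued solutions of `F⁻¹ dF = U^μ dz + V^μ dz̄`, which at `μ = 1` is the frame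
`(ψ₂ ψ̄₂ - ψ₁ ψ̄₁)^{-1/2} (ψ̄₂, ψ̄₁; ψ₁, ψ₂)`. -/
structure IsExtendedFrame (D : Set (ℝ × ℝ)) (ψ₁ ψ₂ : ℝ × ℝ → ParaC)
    (F : ParaC → ℝ × ℝ → Mat2) : Prop where
  smooth : ∀ i j, SmoothOn (fun tp : ℝ × (ℝ × ℝ) => F (expI tp.1) tp.2 i j) (Set.univ ×ˢ D)
  mem_SU : ∀ μ ∈ circle, ∀ p ∈ D, F μ p ∈ SU11
  dz_eq : ∀ μ ∈ circle, ∀ p ∈ D,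
    (Matrix.of fun i j => dz (fun q => F μ q i j) p) = F μ p * laxU ψ₁ ψ₂ μ p
  dzbar_eq : ∀ μ ∈ circle, ∀ p ∈ D,
    (Matrix.of fun i j => dzbar (fun q => F μ q i j) p) = F μ p * laxV ψ₁ ψ₂ μ p
  at_one : ∀ p ∈ D, F 1 p =
    (1 / Real.sqrt (QuadraticAlgebra.norm (ψ₂ p) - QuadraticAlgebra.norm (ψ₁ p))) •
      !![star (ψ₂ p), star (ψ₁ p); ψ₁ p, ψ₂ p]

/-- `μ ∂_μ` of a matrix valued function on the para-complex circle. -/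
def muDerivMat (G : ParaC → Mat2) (μ : ParaC) : Mat2 :=
  Matrix.of fun i j => muDeriv (fun ν => G ν i j) μ

/-- `N_m = (i'/2) Ad(F) σ₃`. -/
def normalM (F : ParaC → ℝ × ℝ → Mat2) (μ : ParaC) (p : ℝ × ℝ) : Mat2 :=
  ((1 / 2 : ℝ) • I) • (F μ p * σ₃ * (F μ p)⁻¹)

/-- `m_± = -i' μ (∂_μ F) F⁻¹ ± N_m`, with the sign `σ = ±1`. -/
def symM (σ : ℝ) (F : ParaC → ℝ × ℝ → Mat2) (μ : ParaC) (p : ℝ × ℝ) : Mat2 :=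
  -(I • (muDerivMat (fun ν => F ν p) μ * (F μ p)⁻¹)) + σ • normalM F μ p

/-- Diagonal part of a matrix. -/
def diagPart (X : Mat2) : Mat2 := Matrix.diagonal fun i => X i i

/-- Off-diagonal part of a matrix. -/
def offDiagPart (X : Mat2) : Mat2 := X - diagPart X

/-- `f̂^μ_± = m_±^o - (i'/2) μ (∂_μ m_±)^d`. -/
def symHat (σ : ℝ) (F : ParaC → ℝ × ℝ → Mat2) (μ : ParaC) (p : ℝ × ℝ) : Mat2 :=
  offDiagPart (symM σ F μ p)
    - ((1 / 2 : ℝ) • I) • diagPart (muDerivMat (fun ν => symM σ F ν p) μ)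

/-- The Sym formula `f^μ_±`, as a map into `Nil_t³`. -/
def symSurface (σ : ℝ) (F : ParaC → ℝ × ℝ → Mat2) (μ : ParaC) (p : ℝ × ℝ) : Fin 3 → ℝ :=
  suCoord (symHat σ F μ p)

end Frames

end

noncomputable section

namespace ParaC

open scoped QuadraticAlgebra

/-! ## Calculus of para-complex valued functions -/

/-! Write `F = (α, β; β̄, ᾱ)`, `H = e^{w/2}` and `μ = e^{i't}`. Then `μ∂_μ = i' d/dt`, so with a
sign `σ = ±1` the Sym matrices are `m_σ = -F_t F⁻¹ + σ N_m`. In their `z`-derivative the diagonal of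
`U` drops out, since it is independent of `t` and commutes with `σ₃`. What remains is `(m_σ)_z = F
(0, x; y, 0) F⁻¹` with `x = (σ-1) μ⁻¹ H` and `y = (σ+1) μ⁻¹ B H⁻¹`. Each sign thus keeps just one
off-diagonal entry of `U`.

On passing to `f̂`, the terms with `F_t` in the third component cancel against the contact term of
the Heisenberg group, because `αᾱ - ββ̄ = 1`. The result (`leftDz_symSurface`) is `f⁻¹f_z = 2μ⁻¹H
Φ(β̄, ᾱ)` for `f_-` and `f⁻¹f_z = 2μ⁻¹BH⁻¹ Φ(ᾱ, β̄)` for `f_+`. The whole theorem is read off from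
these two formulas.

Surface theory: `Φ` is isotropic, so both maps are conformal, and the conformal factor contains `αᾱ
+ ββ̄ = n₃` and, for `f_+`, also `BB̄` (`isImmersedAt_iff`). The Lax equations for `α, β` are a
nonlinear Dirac equation, which makes the tension field vanish (`isTimelikeMinimalAt_of_dirac`). For
`f_+` this also needs `B_z̄ = 0`, which follows from the compatibility of the Lax equations
(`IsFrame.wirt_B`). The Gauss map statement is an orthogonality relation, again a form of `αᾱ - ββ̄
= 1`.

Duality: with `λ² = μ⁻¹`, the spinors `ψ₁ = λ√(2H) β̄`, `ψ₂ = λ̄√(2H) ᾱ` generate `f_-`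
(`IsFrameSpinors`). Their Abresch-Rosenberg coefficient is `μ⁻²B`, and swapping them with the factor
`s/H`, where `s² = εμ⁻²B`, gives spinors of `f_+`. The dual has the same coefficient `μ⁻²B`, and
dualizing twice gives `(-ψ₁, -ψ₂)`, so the relation is symmetric. At `μ = 1` these are the given
spinors, so `f_-` and `f` have the same Maurer-Cartan form. -/

/-- The splitting `x + i' y ↦ (x + y, x - y)` of the para-complex numbers. -/
def split : ParaC →ₐ[ℝ] ℝ × ℝ where
  toFun z := (z.re + z.im, z.re - z.im)
  map_one' := by ext <;> simp
  map_mul' z w := by ext <;> simp <;> ring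
  map_zero' := by ext <;> simp
  map_add' z w := by ext <;> simp <;> ring
  commutes' r := by ext <;> simp

theorem split_injective : Function.Injective split := by
  intro z w h
  have h1 : z.re + z.im = w.re + w.im := congrArg Prod.fst h
  have h2 : z.re - z.im = w.re - w.im := congrArg Prod.snd h
  ext <;> linarith

-- A submultiplicative norm is needed so that the product rules for derivatives and smoothness apply
-- to para-complex functions; the sup norm of `ℝ × ℝ` serves. It is unrelated to the indefinite
-- `QuadraticAlgebra.norm`.
scoped instance instNormedCommRing : NormedCommRing ParaC :=
  NormedCommRing.induced ParaC (ℝ × ℝ) split split_injective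

scoped instance instNormedAlgebra : NormedAlgebra ℝ ParaC :=
  NormedAlgebra.induced ℝ ParaC (ℝ × ℝ) split

/-- The real part as a continuous linear map. -/
def reL : ParaC →L[ℝ] ℝ :=
  LinearMap.toContinuousLinearMap (QuadraticAlgebra.reₗ (R := ℝ) (a := 1) (b := 0))

/-- The imaginary part as a continuous linear map. -/
def imL : ParaC →L[ℝ] ℝ :=
  LinearMap.toContinuousLinearMap (QuadraticAlgebra.imₗ (R := ℝ) (a := 1) (b := 0))

/-- The inclusion of the real numbers as a continuous linear map. -/
def ofRealL : ℝ →L[ℝ] ParaC :=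
  LinearMap.toContinuousLinearMap (Algebra.linearMap ℝ ParaC)

/-- Para-conjugation as a continuous linear map. -/
def starL : ParaC →L[ℝ] ParaC :=
  LinearMap.toContinuousLinearMap
    { toFun := star
      map_add' := star_add
      map_smul' := fun r z => by ext <;> simp }

@[simp] theorem reL_apply (z : ParaC) : reL z = z.re := rfl
@[simp] theorem imL_apply (z : ParaC) : imL z = z.im := rfl
@[simp] theorem ofRealL_apply (r : ℝ) : ofRealL r = ofReal r := rfl
@[simp] theorem starL_apply (z : ParaC) : starL z = star z := rfl

@[simp] theorem re_ofReal (r : ℝ) : (ofReal r).re = r := rfl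
@[simp] theorem im_ofReal (r : ℝ) : (ofReal r).im = 0 := rfl
@[simp] theorem re_I : I.re = 0 := rfl
@[simp] theorem im_I : I.im = 1 := rfl
@[simp] theorem star_I : star I = -I := by ext <;> simp
@[simp] theorem star_ofReal (r : ℝ) : star (ofReal r) = ofReal r := by ext <;> simp
theorem ofReal_mul (r s : ℝ) : ofReal (r * s) = ofReal r * ofReal s := by ext <;> simp
theorem ofReal_add (r s : ℝ) : ofReal (r + s) = ofReal r + ofReal s := by ext <;> simp
theorem ofReal_neg (r : ℝ) : ofReal (-r) = -ofReal r := by ext <;> simp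
theorem ofReal_sub (r s : ℝ) : ofReal (r - s) = ofReal r - ofReal s := by ext <;> simp
theorem ofReal_one : ofReal 1 = 1 := rfl
theorem smul_eq_ofReal_mul (r : ℝ) (z : ParaC) : r • z = ofReal r * z := by ext <;> simp

theorem eq_re_add_im (z : ParaC) : z = ofReal z.re + I * ofReal z.im := by ext <;> simp

section Smooth

variable {E : Type*} [NormedAddCommGroup E] [NormedSpace ℝ E]

theorem smoothOn_iff {u : E → ParaC} {s : Set E} : SmoothOn u s ↔ ContDiffOn ℝ ∞ u s := by
  constructor
  · rintro ⟨h1, h2⟩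
    have h : u = fun p => ofRealL (u p).re + I * ofRealL (u p).im := by
      funext p; exact eq_re_add_im _
    rw [h]
    exact (ofRealL.contDiff.comp_contDiffOn h1).add
      (contDiffOn_const.mul (ofRealL.contDiff.comp_contDiffOn h2))
  · intro h
    exact ⟨reL.contDiff.comp_contDiffOn h, imL.contDiff.comp_contDiffOn h⟩

end Smooth

/-- `u` is differentiable at `p` with `u_z = a` and `u_z̄ = b`. -/
def HasWirt (u : ℝ × ℝ → ParaC) (a b : ParaC) (p : ℝ × ℝ) : Prop :=
  -- Adding and subtracting the definitions of `∂_z` and `∂_z̄` gives `u_x = u_z + u_z̄` and `i' u_y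
  -- = u_z - u_z̄`; since `(i')² = 1`, `u_y = i'(u_z - u_z̄)`.
  ∃ L : ℝ × ℝ →L[ℝ] ParaC, HasFDerivAt u L p ∧ L (1, 0) = a + b ∧ L (0, 1) = I * (a - b)

theorem dirDeriv_eq {u : ℝ × ℝ → ParaC} {p : ℝ × ℝ} (h : DifferentiableAt ℝ u p) (v : ℝ × ℝ) :
    dirDeriv u v p = fderiv ℝ u p v := by
  have h1 : HasFDerivAt (fun q => (u q).re) (reL.comp (fderiv ℝ u p)) p :=
    reL.hasFDerivAt.comp p h.hasFDerivAt
  have h2 : HasFDerivAt (fun q => (u q).im) (imL.comp (fderiv ℝ u p)) p :=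
    imL.hasFDerivAt.comp p h.hasFDerivAt
  ext
  · simp [dirDeriv, h1.fderiv]
  · simp [dirDeriv, h2.fderiv]

variable {u v : ℝ × ℝ → ParaC} {a b c d : ParaC} {p : ℝ × ℝ}

theorem HasWirt.differentiableAt (h : HasWirt u a b p) : DifferentiableAt ℝ u p := by
  obtain ⟨L, hL, -⟩ := h
  exact hL.differentiableAt

theorem HasWirt.dz_eq (h : HasWirt u a b p) : dz u p = a := by
  rw [dz, dirDeriv_eq h.differentiableAt, dirDeriv_eq h.differentiableAt]
  obtain ⟨L, hL, h1, h2⟩ := h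
  rw [hL.fderiv, h1, h2, ← mul_assoc, I_mul_I]
  ext <;> simp <;> ring

theorem HasWirt.dzbar_eq (h : HasWirt u a b p) : dzbar u p = b := by
  rw [dzbar, dirDeriv_eq h.differentiableAt, dirDeriv_eq h.differentiableAt]
  obtain ⟨L, hL, h1, h2⟩ := h
  rw [hL.fderiv, h1, h2, ← mul_assoc, I_mul_I]
  ext <;> simp <;> ring

theorem hasWirt (h : DifferentiableAt ℝ u p) : HasWirt u (dz u p) (dzbar u p) p := by
  refine ⟨_, h.hasFDerivAt, ?_, ?_⟩ <;> rw [dz, dzbar, dirDeriv_eq h, dirDeriv_eq h] <;>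
    ext <;> simp <;> ring

theorem HasWirt.congr_deriv (h : HasWirt u a b p) (ha : a = c) (hb : b = d) : HasWirt u c d p := by
  subst ha hb; exact h

theorem HasWirt.congr (h : HasWirt u a b p) (huv : v =ᶠ[nhds p] u) : HasWirt v a b p := by
  obtain ⟨L, hL, h1⟩ := h
  exact ⟨L, hL.congr_of_eventuallyEq huv, h1⟩

theorem hasWirt_const (c : ParaC) (p : ℝ × ℝ) : HasWirt (fun _ => c) 0 0 p :=
  ⟨0, hasFDerivAt_const c p, by simp, by simp⟩

theorem HasWirt.add (hu : HasWirt u a b p) (hv : HasWirt v c d p) :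
    HasWirt (fun q => u q + v q) (a + c) (b + d) p := by
  obtain ⟨L, hL, h1, h2⟩ := hu
  obtain ⟨M, hM, h3, h4⟩ := hv
  refine ⟨_, hL.add hM, ?_, ?_⟩
  · simp only [add_apply, h1, h3]; ring
  · simp only [add_apply, h2, h4]; ring

theorem HasWirt.mul (hu : HasWirt u a b p) (hv : HasWirt v c d p) :
    HasWirt (fun q => u q * v q) (a * v p + u p * c) (b * v p + u p * d) p := by
  obtain ⟨L, hL, h1, h2⟩ := hu
  obtain ⟨M, hM, h3, h4⟩ := hv
  refine ⟨_, hL.mul hM, ?_, ?_⟩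
  · simp only [add_apply, smul_apply, smul_eq_mul, h1, h3]; ring
  · simp only [add_apply, smul_apply, smul_eq_mul, h2, h4]; ring

theorem HasWirt.const_mul (k : ParaC) (hu : HasWirt u a b p) :
    HasWirt (fun q => k * u q) (k * a) (k * b) p :=
  ((hasWirt_const k p).mul hu).congr_deriv (by ring) (by ring)

theorem HasWirt.neg (hu : HasWirt u a b p) : HasWirt (fun q => -u q) (-a) (-b) p :=
  ((hu.const_mul (-1)).congr_deriv (by ring) (by ring)).congr
    (Filter.Eventually.of_forall fun q => by ring)

theorem HasWirt.sub (hu : HasWirt u a b p) (hv : HasWirt v c d p) :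
    HasWirt (fun q => u q - v q) (a - c) (b - d) p :=
  ((hu.add hv.neg).congr_deriv (by ring) (by ring)).congr
    (Filter.Eventually.of_forall fun q => by ring)

theorem HasWirt.conj (hu : HasWirt u a b p) :
    HasWirt (fun q => star (u q)) (star b) (star a) p := by
  obtain ⟨L, hL, h1, h2⟩ := hu
  refine ⟨_, starL.hasFDerivAt.comp p hL, ?_, ?_⟩
  · simp [h1, add_comm]
  · simp only [ContinuousLinearMap.comp_apply, h2, starL_apply]
    ext <;> simp

/-- A real function is its own conjugate, and conjugation exchanges the two Wirtinger derivatives.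
-/
theorem hasWirt_ofReal {r : ℝ × ℝ → ℝ} (h : DifferentiableAt ℝ r p) :
    HasWirt (fun q => ofReal (r q)) (dz (fun q => ofReal (r q)) p)
      (star (dz (fun q => ofReal (r q)) p)) p := by
  have h1 : DifferentiableAt ℝ (fun q => ofReal (r q)) p := ofRealL.differentiableAt.comp p h
  have h2 := hasWirt h1
  have h3 : HasWirt (fun q => ofReal (r q)) _ _ p :=
    h2.conj.congr (Filter.Eventually.of_forall fun q => (star_ofReal _).symm)
  refine h2.congr_deriv rfl ?_
  exact h3.dz_eq ▸ (star_star (dzbar (fun q => ofReal (r q)) p)).symm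

/-- The chain rule for a real function of a real function. -/
theorem HasWirt.comp_ofReal {r : ℝ × ℝ → ℝ} {g : ℝ → ℝ} {g' : ℝ}
    (h : HasWirt (fun q => ofReal (r q)) a b p) (hg : HasDerivAt g g' (r p)) :
    HasWirt (fun q => ofReal (g (r q))) (ofReal g' * a) (ofReal g' * b) p := by
  obtain ⟨L, hL, h1, h2⟩ := h
  have hr : HasFDerivAt r (reL.comp L) p := reL.hasFDerivAt.comp p hL
  have hL' : ∀ x, (L x).im = 0 := fun x => by
    have : HasFDerivAt (fun q => (ofReal (r q)).im) (imL.comp L) p := imL.hasFDerivAt.comp p hL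
    have := this.unique (hasFDerivAt_const (0 : ℝ) p)
    exact DFunLike.congr_fun this x
  refine ⟨_, ofRealL.hasFDerivAt.comp p (hg.comp_hasFDerivAt p hr), ?_, ?_⟩
  · rw [← mul_add, ← h1]; ext <;> simp [hL']
  · rw [← mul_sub, mul_left_comm, ← h2]; ext <;> simp [hL']

/-- Smooth functions have smooth Wirtinger derivatives. -/
theorem contDiffOn_dz {D : Set (ℝ × ℝ)} (hD : IsOpen D) (hu : ContDiffOn ℝ ∞ u D) :
    ContDiffOn ℝ ∞ (dz u) D := by
  have h1 : ContDiffOn ℝ ∞ (fderiv ℝ u) D := hu.fderiv_of_isOpen hD (by simp)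
  have h2 : ∀ w : ℝ × ℝ, ContDiffOn ℝ ∞ (fun q => fderiv ℝ u q w) D := fun w =>
    h1.clm_apply contDiffOn_const
  refine (((h2 (1, 0)).add (contDiffOn_const (c := I) |>.mul (h2 (0, 1)))).const_smul
    (1 / 2 : ℝ)).congr ?_
  intro q hq
  have hd := (hu.contDiffAt (hD.mem_nhds hq)).differentiableAt (by simp)
  simp only [dz, dirDeriv_eq hd]

/-- Mixed Wirtinger derivatives commute. -/
theorem dzbar_dz_eq (hu : ContDiffAt ℝ ∞ u p) {a' b' : ℝ × ℝ → ParaC}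
    (h : ∀ᶠ q in nhds p, HasWirt u (a' q) (b' q) q)
    (ha : HasWirt a' a b p) (hb : HasWirt b' c d p) : b = c := by
  have h2 : ContDiffAt ℝ ∞ (fderiv ℝ u) p := hu.fderiv_right (by simp)
  have hd : HasFDerivAt (fderiv ℝ u) (fderiv ℝ (fderiv ℝ u) p) p :=
    (h2.differentiableAt (by simp)).hasFDerivAt
  have hw : ∀ w : ℝ × ℝ, HasFDerivAt (fun q => fderiv ℝ u q w)
      ((ContinuousLinearMap.apply ℝ ParaC w).comp (fderiv ℝ (fderiv ℝ u) p)) p := fun w =>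
    (ContinuousLinearMap.apply ℝ ParaC w).hasFDerivAt.comp p hd
  have hs : fderiv ℝ (fderiv ℝ u) p (1, 0) (0, 1) = fderiv ℝ (fderiv ℝ u) p (0, 1) (1, 0) :=
    (hu.isSymmSndFDerivAt (by
      rw [minSmoothness_of_isRCLikeNormedField]; exact WithTop.coe_le_coe.2 (le_top : (2 : ℕ∞) ≤ ⊤))).eq _ _
  have e1 : (fun q => a' q + b' q) =ᶠ[nhds p] fun q => fderiv ℝ u q (1, 0) := by
    filter_upwards [h] with q hq
    obtain ⟨L, hL, h1, -⟩ := hq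
    rw [hL.fderiv, h1]
  have e2 : (fun q => I * (a' q - b' q)) =ᶠ[nhds p] fun q => fderiv ℝ u q (0, 1) := by
    filter_upwards [h] with q hq
    obtain ⟨L, hL, -, h1⟩ := hq
    rw [hL.fderiv, h1]
  obtain ⟨L, hL, h3, h4⟩ := ha.add hb
  obtain ⟨M, hM, h5, h6⟩ := (ha.sub hb).const_mul I
  have k1 := hL.unique ((hw (1, 0)).congr_of_eventuallyEq e1)
  have k2 := hM.unique ((hw (0, 1)).congr_of_eventuallyEq e2)
  have k3 : L (0, 1) = M (1, 0) := by
    rw [k1, k2]; exact hs.symm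
  rw [h4, h5] at k3
  -- `k3` is the equality of `u_xy` and `u_yx`. Multiplying by `i'` removes the unit and leaves `2b
  -- = 2c`; the factor `2` is then cancelled by a real scalar, as the ring is not a field.
  have k4 : I * (I * (a + c - (b + d))) = I * (I * (a - c) + I * (b - d)) := by rw [k3]
  have e := I_mul_I
  have k5 : (2 : ParaC) * b = 2 * c := by linear_combination (-1) * k4 + (2 * c - 2 * b) * e
  have : ∀ x : ParaC, x = (1 / 2 : ℝ) • (2 * x) := fun x => by
    rw [two_mul]; ext <;> simp <;> ring
  rw [this b, this c, k5]

end ParaC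
end

noncomputable section

/-! ## Surfaces in terms of `f⁻¹ f_z` -/

section SurfaceLemmas

open ParaC NilT
open scoped QuadraticAlgebra

variable {f : ℝ × ℝ → Fin 3 → ℝ} {p : ℝ × ℝ} {χ a b : ParaC}

theorem leftDz_eq {c₀ c₁ c₂ : ParaC} (h0 : HasWirt (fun q => ofReal (f q 0)) c₀ (star c₀) p)
    (h1 : HasWirt (fun q => ofReal (f q 1)) c₁ (star c₁) p)
    (h2 : HasWirt (fun q => ofReal (f q 2)) c₂ (star c₂) p) :
    leftDz f p 0 = c₀ ∧ leftDz f p 1 = c₁ ∧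
      leftDz f p 2 = c₂ + (1 / 2 : ℝ) • (ofReal (f p 1) * c₀ - ofReal (f p 0) * c₁) := by
  have key : ∀ (k : Fin 3) (c : ParaC), HasWirt (fun q => ofReal (f q k)) c (star c) p →
      ∃ L : ℝ × ℝ →L[ℝ] ℝ, HasFDerivAt (fun q => f q k) L p ∧ L (1, 0) = 2 * c.re ∧
        L (0, 1) = 2 * c.im := by
    rintro k c ⟨L, hL, e1, e2⟩
    refine ⟨reL.comp L, reL.hasFDerivAt.comp p hL, ?_, ?_⟩
    · simp [e1]; ring
    · simp [e2]; ring
  obtain ⟨L0, hL0, e0, e0'⟩ := key 0 c₀ h0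
  obtain ⟨L1, hL1, e1, e1'⟩ := key 1 c₁ h1
  obtain ⟨L2, hL2, e2, e2'⟩ := key 2 c₂ h2
  have hf : HasFDerivAt f (ContinuousLinearMap.pi ![L0, L1, L2]) p := by
    rw [hasFDerivAt_pi']
    intro i
    fin_cases i
    · exact hL0
    · exact hL1
    · exact hL2
  refine ⟨?_, ?_, ?_⟩
  · ext <;> simp [leftDz, leftTranslate, hf.fderiv, e0, e0']
  · ext <;> simp [leftDz, leftTranslate, hf.fderiv, e1, e1']
  · ext <;> simp [leftDz, leftTranslate, contact, hf.fderiv, e0, e0', e1, e1', e2, e2'] <;> ring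

theorem leftTranslate_fderiv (v : ℝ × ℝ) (k : Fin 3) :
    leftTranslate (f p) (fderiv ℝ f p v) k =
      2 * (v.1 * (leftDz f p k).re + v.2 * (leftDz f p k).im) := by
  have hv : v = v.1 • ((1 : ℝ), (0 : ℝ)) + v.2 • ((0 : ℝ), (1 : ℝ)) := by ext <;> simp
  have h1 : fderiv ℝ f p v = v.1 • fderiv ℝ f p (1, 0) + v.2 • fderiv ℝ f p (0, 1) := by
    conv_lhs => rw [hv, map_add, map_smul, map_smul]
  rw [h1]
  fin_cases k <;> simp [leftDz, leftTranslate, contact] <;> ring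

theorem metric_eq_lieInner (x u v : Fin 3 → ℝ) :
    metric x u v = lieInner (leftTranslate x u) (leftTranslate x v) := by
  simp [metric, lieInner, leftTranslate]

theorem eq_zero_of_leftTranslate_eq_zero {x v : Fin 3 → ℝ} (h : ∀ k, leftTranslate x v k = 0) :
    v = 0 := by
  have h0 : v 0 = 0 := h 0
  have h1 : v 1 = 0 := h 1
  have h2 : v 2 + (1 / 2) * (x 1 * v 0 - x 0 * v 1) = 0 := h 2
  rw [h0, h1] at h2
  ext i
  fin_cases i
  · exact h0
  · exact h1
  · simpa using h2

/-- `Φ` is isotropic for `diag(-1, 1, 1)` because `(i')² = 1`, which is conformality with respect to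
`dz dz̄ = dx² - dy²`. The factor comes from the Hermitian square `2(aā + bb̄)²` of `Φ(a, b)`. -/
theorem firstForm_eq (hφ : ∀ k, leftDz f p k = χ * spinorVec a b k) :
    firstForm f p (1, 0) (1, 0) = 4 * QuadraticAlgebra.norm χ *
      (QuadraticAlgebra.norm a + QuadraticAlgebra.norm b) ^ 2 ∧
    firstForm f p (0, 1) (0, 1) = -(4 * QuadraticAlgebra.norm χ *
      (QuadraticAlgebra.norm a + QuadraticAlgebra.norm b) ^ 2) ∧
    firstForm f p (1, 0) (0, 1) = 0 := by
  refine ⟨?_, ?_, ?_⟩ <;>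
  · simp only [firstForm, metric_eq_lieInner, lieInner, leftTranslate_fderiv, hφ, spinorVec,
      QuadraticAlgebra.norm_def]
    simp [sq]
    ring

theorem detFirst_eq (hφ : ∀ k, leftDz f p k = χ * spinorVec a b k) :
    detFirst f p = -(4 * QuadraticAlgebra.norm χ *
      (QuadraticAlgebra.norm a + QuadraticAlgebra.norm b) ^ 2) ^ 2 := by
  obtain ⟨h1, h2, h3⟩ := firstForm_eq hφ
  rw [detFirst, h1, h2, h3]; ring

theorem isImmersedAt_of_detFirst_ne_zero (h : detFirst f p ≠ 0) : IsImmersedAt f p := by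
  refine (injective_iff_map_eq_zero (fderiv ℝ f p)).2 fun v hv => ?_
  have h0 : ∀ w, firstForm f p v w = 0 := fun w => by
    simp [firstForm, hv, metric, contact]
  have hexp : ∀ w, firstForm f p v w =
      v.1 * firstForm f p (1, 0) w + v.2 * firstForm f p (0, 1) w := fun w => by
    simp only [firstForm, metric_eq_lieInner, lieInner, leftTranslate_fderiv]
    ring
  have hsymm : firstForm f p (0, 1) (1, 0) = firstForm f p (1, 0) (0, 1) := by
    simp only [firstForm, metric, contact]; ring
  have e1 := h0 (1, 0)
  have e2 := h0 (0, 1)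
  rw [hexp] at e1 e2
  rw [hsymm] at e1
  have e3 : v.1 * detFirst f p = 0 := by
    rw [detFirst]
    linear_combination firstForm f p (0, 1) (0, 1) * e1 - firstForm f p (1, 0) (0, 1) * e2
  have e4 : v.2 * detFirst f p = 0 := by
    rw [detFirst]
    linear_combination firstForm f p (1, 0) (1, 0) * e2 - firstForm f p (1, 0) (0, 1) * e1
  ext
  · simpa [h] using e3
  · simpa [h] using e4

/-- A degenerate induced metric does not by itself exclude an immersion, so a kernel vector must be
exhibited. Under `split`, `Φ` becomes a pair of real null vectors `Φ₊, Φ₋`. They are parallel when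
`aā + bb̄ = 0`, while `χχ̄ = 0` annihilates one of the two null derivatives of `f`. -/
theorem isImmersedAt_iff (hφ : ∀ k, leftDz f p k = χ * spinorVec a b k)
    (hab : QuadraticAlgebra.norm b - QuadraticAlgebra.norm a ≠ 0) :
    IsImmersedAt f p ↔ QuadraticAlgebra.norm χ ≠ 0 ∧
      QuadraticAlgebra.norm a + QuadraticAlgebra.norm b ≠ 0 := by
  constructor
  · intro h
    by_contra hcon
    have hE : QuadraticAlgebra.norm χ * (QuadraticAlgebra.norm a + QuadraticAlgebra.norm b) = 0 := by
      by_contra h'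
      exact hcon (mul_ne_zero_iff.1 h')
    have hinj := (injective_iff_map_eq_zero (fderiv ℝ f p)).1 h
    have hker : ∀ v : ℝ × ℝ, (∀ k, v.1 * (leftDz f p k).re + v.2 * (leftDz f p k).im = 0) →
        v = 0 := fun v hv => hinj v <| eq_zero_of_leftTranslate_eq_zero (x := f p) fun k => by
      rw [leftTranslate_fderiv, hv k, mul_zero]
    obtain ⟨x, y⟩ := χ
    obtain ⟨a1, a2⟩ := a
    obtain ⟨b1, b2⟩ := b
    simp only [QuadraticAlgebra.norm_def] at hE hab
    have hE' : (x * x - y * y) * (a1 * a1 - a2 * a2 + (b1 * b1 - b2 * b2)) = 0 := by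
      linear_combination hE
    -- `Q` and `-P` are the first (timelike) components of `Φ₊` and `Φ₋`. Both are nonzero, since
    -- otherwise `aā = bb̄ = 0`, against `hab`.
    set P := (a1 - a2) ^ 2 + (b1 + b2) ^ 2 with hP
    set Q := (a1 + a2) ^ 2 + (b1 - b2) ^ 2 with hQ
    have hP0 : P ≠ 0 := fun h0 => by
      have e1 : a1 - a2 = 0 := by nlinarith [sq_nonneg (a1 - a2), sq_nonneg (b1 + b2)]
      have e2 : b1 + b2 = 0 := by nlinarith [sq_nonneg (a1 - a2), sq_nonneg (b1 + b2)]
      exact hab (by linear_combination (b1 - b2) * e2 - (a1 + a2) * e1)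
    have hQ0 : Q ≠ 0 := fun h0 => by
      have e1 : a1 + a2 = 0 := by nlinarith [sq_nonneg (a1 + a2), sq_nonneg (b1 - b2)]
      have e2 : b1 - b2 = 0 := by nlinarith [sq_nonneg (a1 + a2), sq_nonneg (b1 - b2)]
      exact hab (by linear_combination (b1 + b2) * e2 - (a1 - a2) * e1)
    -- This vector is mapped to `χχ̄ (P Φ₊ + Q Φ₋)`, up to the factor 2. The first component cancels
    -- by the choice of `P, Q`, and the other two are multiples of `hE'`. If the vector itself is
    -- zero then `χ = 0`, and `(1, 0)` lies in the kernel.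
    have hv := hker (P * (x - y) + Q * (x + y), P * (x - y) - Q * (x + y)) fun k => by
      rw [hφ k]
      fin_cases k <;> simp [spinorVec, sq, hP, hQ]
      · ring
      · linear_combination 2 * (b1 ^ 2 - b2 ^ 2 - a1 ^ 2 + a2 ^ 2) * hE'
      · linear_combination 4 * (a1 * b1 + a2 * b2) * hE'
    have hv1 := congrArg Prod.fst hv
    have hv2 := congrArg Prod.snd hv
    simp only [Prod.fst_zero, Prod.snd_zero] at hv1 hv2
    have e1 : P * (x - y) = 0 := by linarith
    have e2 : Q * (x + y) = 0 := by linarith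
    have e3 : x - y = 0 := by simpa [hP0] using e1
    have e4 : x + y = 0 := by simpa [hQ0] using e2
    have hx : x = 0 := by linarith
    have hy : y = 0 := by linarith
    have hv := hker (1, 0) fun k => by
      rw [hφ k, hx, hy]; simp
    have := congrArg Prod.fst hv
    simp at this
  · rintro ⟨h1, h2⟩
    apply isImmersedAt_of_detFirst_ne_zero
    rw [detFirst_eq hφ]
    simp [h1, h2]

end SurfaceLemmas
end

noncomputable section

/-! ### Mean curvature and normal Gauss map from `f⁻¹ f_z` -/

section SurfaceLemmas

open ParaC NilT
open scoped QuadraticAlgebra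

variable {f : ℝ × ℝ → Fin 3 → ℝ} {p : ℝ × ℝ}

theorem fderiv_metric (x u v w : Fin 3 → ℝ) : fderiv ℝ (fun y => metric y u v) x w =
    (1 / 2) * (w 1 * u 0 - w 0 * u 1) * contact x v +
      contact x u * ((1 / 2) * (w 1 * v 0 - w 0 * v 1)) := by
  have hc : ∀ u : Fin 3 → ℝ, HasFDerivAt (fun y => contact y u)
      ((1 / 2 : ℝ) • (u 0 • ContinuousLinearMap.proj (R := ℝ) (φ := fun _ : Fin 3 => ℝ) 1
        - u 1 • ContinuousLinearMap.proj (R := ℝ) (φ := fun _ : Fin 3 => ℝ) 0)) x := fun u => by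
    have h := ((1 / 2 : ℝ) • (u 0 • ContinuousLinearMap.proj (R := ℝ) (φ := fun _ : Fin 3 => ℝ) 1
        - u 1 • ContinuousLinearMap.proj (R := ℝ) (φ := fun _ : Fin 3 => ℝ) 0)).hasFDerivAt
          (x := x) |>.const_add (u 2)
    refine h.congr_of_eventuallyEq (Filter.Eventually.of_forall fun y => ?_)
    simp [contact]; ring
  have h := ((hc u).mul (hc v)).const_add (-(u 0 * v 0) + u 1 * v 1)
  have h' : HasFDerivAt (fun y => metric y u v) _ x := h
  rw [h'.fderiv]
  simp; ring

theorem christoffel_self (x v w : Fin 3 → ℝ) :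
    christoffel x v v w = contact x v * (v 1 * w 0 - v 0 * w 1) := by
  simp only [christoffel, fderiv_metric]; ring

/-- A conformal map whose tension field vanishes has zero mean curvature. -/
theorem meanCurvature_eq_zero {φ : Fin 3 → ℝ × ℝ → ParaC} {e : Fin 3 → ParaC}
    (hf : ContDiffAt ℝ ∞ f p) (hφ : ∀ᶠ q in nhds p, ∀ k, leftDz f q k = φ k q)
    (hW : ∀ k, ∃ d, HasWirt (φ k) d (e k) p)
    (h0 : (e 0).re = (φ 2 p * star (φ 1 p)).re) (h1 : (e 1).re = (φ 2 p * star (φ 0 p)).re)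
    (h2 : (e 2).re = 0)
    (hE : firstForm f p (0, 1) (0, 1) = -firstForm f p (1, 0) (1, 0))
    (hF : firstForm f p (1, 0) (0, 1) = 0) (n : Fin 3 → ℝ) : meanCurvature f n p = 0 := by
  have hV : ∀ w, HasFDerivAt (fun q => fderiv ℝ f q w)
      (fderiv ℝ (fun q => fderiv ℝ f q w) p) p := fun w => by
    have h2 : ContDiffAt ℝ ∞ (fderiv ℝ f) p := hf.fderiv_right (by simp)
    exact ((h2.differentiableAt (by simp)).clm_apply (differentiableAt_const w)).hasFDerivAt
  have hVk : ∀ w k, HasFDerivAt (fun q => fderiv ℝ f q w k)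
      ((ContinuousLinearMap.proj k).comp (fderiv ℝ (fun q => fderiv ℝ f q w) p)) p :=
    fun w k => (hasFDerivAt_pi'.1 (hV w)) k
  have hfk : ∀ k, HasFDerivAt (fun q => f q k)
      ((ContinuousLinearMap.proj k).comp (fderiv ℝ f p)) p :=
    fun k => (hasFDerivAt_pi'.1 (hf.differentiableAt (by simp)).hasFDerivAt) k
  have hC : ∀ w, HasFDerivAt (fun q => contact (f q) (fderiv ℝ f q w)) _ p := fun w =>
    (hVk w 2).add ((((hfk 1).mul (hVk w 0)).sub ((hfk 0).mul (hVk w 1))).const_mul (1 / 2 : ℝ))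
  have hp := hφ.self_of_nhds
  have hLT : ∀ v k, leftTranslate (f p) (fderiv ℝ f p v) k =
      2 * (v.1 * (φ k p).re + v.2 * (φ k p).im) := fun v k => by
    rw [leftTranslate_fderiv, hp k]
  have ex : ∀ k, (fun q => leftTranslate (f q) (fderiv ℝ f q (1, 0)) k) =ᶠ[nhds p]
      fun q => 2 * (φ k q).re := fun k => by
    filter_upwards [hφ] with q hq
    rw [leftTranslate_fderiv, hq k]; ring
  have ey : ∀ k, (fun q => leftTranslate (f q) (fderiv ℝ f q (0, 1)) k) =ᶠ[nhds p]
      fun q => 2 * (φ k q).im := fun k => by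
    filter_upwards [hφ] with q hq
    rw [leftTranslate_fderiv, hq k]; ring
  -- The real part of `(φ_k)_z̄` is `(∂_x Re φ_k - ∂_y Im φ_k) / 2`, and `2 Re φ_k`, `2 Im φ_k` are
  -- the components of `f⁻¹f_x`, `f⁻¹f_y`.
  have key : ∀ k (Lx Ly : ℝ × ℝ →L[ℝ] ℝ),
      HasFDerivAt (fun q => leftTranslate (f q) (fderiv ℝ f q (1, 0)) k) Lx p →
      HasFDerivAt (fun q => leftTranslate (f q) (fderiv ℝ f q (0, 1)) k) Ly p →
      Lx (1, 0) - Ly (0, 1) = 4 * (e k).re := by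
    intro k Lx Ly hx hy
    obtain ⟨d, L, hL, e1, e2⟩ := hW k
    have kx := hx.unique (((reL.hasFDerivAt.comp p hL).const_mul (2 : ℝ)).congr_of_eventuallyEq
      (ex k))
    have ky := hy.unique (((imL.hasFDerivAt.comp p hL).const_mul (2 : ℝ)).congr_of_eventuallyEq
      (ey k))
    rw [kx, ky]
    simp [e1, e2]; ring
  have k0 := key 0 _ _ (hVk (1, 0) 0) (hVk (0, 1) 0)
  have k1 := key 1 _ _ (hVk (1, 0) 1) (hVk (0, 1) 1)
  have k2 := key 2 _ _ (hC (1, 0)) (hC (0, 1))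
  have l10 := hLT (1, 0) 0
  have l11 := hLT (1, 0) 1
  have l12 := hLT (1, 0) 2
  have l20 := hLT (0, 1) 0
  have l21 := hLT (0, 1) 1
  have l22 := hLT (0, 1) 2
  simp [leftTranslate] at l10 l11 l12 l20 l21 l22 k0 k1 k2
  -- In a conformal Lorentzian parametrization the trace of the second form is a multiple of this
  -- difference, the pairing of the tension field with `n`. The products `φ₂ φ̄₁` and `φ₂ φ̄₀` in
  -- `h0`, `h1` balance the Christoffel terms.
  have hII : secondForm f n p (0, 1) (0, 1) - secondForm f n p (1, 0) (1, 0) = 0 := by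
    simp only [secondForm, christoffel_self, metric, l10, l11, l12, l20, l21, l22]
    simp only [h0, h1, h2] at k0 k1 k2
    simp at k0 k1 k2
    simp only [contact] at *
    linear_combination (n 0) * k0 - (n 1) * k1 -
      (n 2 + (1 / 2) * (f p 1 * n 0 - f p 0 * n 1)) * k2
  rw [meanCurvature, hE, hF, div_eq_zero_iff]
  left
  linear_combination firstForm f p (1, 0) (1, 0) * hII

/-- Equating the two stereographic projections forces `ν = (n₂, n₁, -1) / n₃` (indices from 1). This
has unit length because `n` has, and `hperp` says that `n₃ν` is orthogonal to `f⁻¹f_z`. The third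
entry of the witness undoes the contact correction, so that its left translate is `ν`. -/
theorem isNormalGaussMapAt_of_perp {n : Fin 3 → ℝ} (hn : lieInner n n = 1) (hn2 : n 2 ≠ 0)
    (hperp : -(ofReal (n 1) * leftDz f p 0) + ofReal (n 0) * leftDz f p 1 = leftDz f p 2) :
    IsNormalGaussMapAt f n p := by
  refine ⟨hn, ![n 1 / n 2, n 0 / n 2,
    -1 / n 2 - (1 / 2) * (f p 1 * (n 1 / n 2) - f p 0 * (n 0 / n 2))], ⟨?_, ?_⟩, ?_, ?_⟩
  · intro v
    have hre := congrArg QuadraticAlgebra.re hperp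
    have him := congrArg QuadraticAlgebra.im hperp
    simp at hre him
    rw [metric_eq_lieInner]
    simp only [lieInner, leftTranslate_fderiv]
    simp [leftTranslate, contact]
    field_simp
    linear_combination 2 * v.1 * hre + 2 * v.2 * him
  · simp only [lieInner] at hn
    simp [metric, contact]
    field_simp
    linear_combination -hn
  · intro h
    simp [leftTranslate, contact] at h
    have h1 : n 2 ≠ -1 := fun h' => h (by rw [h']; norm_num)
    have h2 : 1 + n 2 ≠ 0 := fun h' => h1 (by linarith)
    have h3 : n 2 + 1 ≠ 0 := fun h' => h1 (by linarith)
    refine ⟨h1, ?_⟩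
    have h4 : 1 - -1 / n 2 = (1 + n 2) / n 2 := by field_simp; ring
    ext
    · simp [stereoNil, stereoSu, leftTranslate, contact, h4]
      field_simp
    · simp [stereoNil, stereoSu, leftTranslate, contact, h4]
      field_simp
  · intro h
    simp [leftTranslate, contact] at h
    have h1 : n 2 = -1 := by field_simp at h; linarith
    refine ⟨h1, ?_, ?_⟩ <;> simp [leftTranslate, h1, div_neg]

end SurfaceLemmas
end

noncomputable section

namespace ParaC

open scoped QuadraticAlgebra

/-! ## Families of para-complex valued functions -/

/-- The derivative of a family of functions with respect to the parameter. -/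
def tDeriv (g : ℝ × (ℝ × ℝ) → ParaC) (x : ℝ × (ℝ × ℝ)) : ParaC := fderiv ℝ g x (1, 0)

section Families

variable {D : Set (ℝ × ℝ)} {g : ℝ × (ℝ × ℝ) → ParaC} {p : ℝ × ℝ} {t : ℝ}

theorem contDiffAt_family (hD : IsOpen D) (hg : ContDiffOn ℝ ∞ g (Set.univ ×ˢ D)) (hp : p ∈ D) :
    ContDiffAt ℝ ∞ g (t, p) :=
  hg.contDiffAt ((isOpen_univ.prod hD).mem_nhds ⟨Set.mem_univ _, hp⟩)

theorem contDiffOn_tDeriv (hD : IsOpen D) (hg : ContDiffOn ℝ ∞ g (Set.univ ×ˢ D)) :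
    ContDiffOn ℝ ∞ (tDeriv g) (Set.univ ×ˢ D) :=
  (hg.fderiv_of_isOpen (isOpen_univ.prod hD) (by simp)).clm_apply contDiffOn_const

theorem hasDerivAt_tDeriv (hD : IsOpen D) (hg : ContDiffOn ℝ ∞ g (Set.univ ×ˢ D)) (hp : p ∈ D) :
    HasDerivAt (fun s => g (s, p)) (tDeriv g (t, p)) t :=
  ((contDiffAt_family hD hg hp).differentiableAt (by simp)).hasFDerivAt.comp_hasDerivAt t
    ((hasDerivAt_id t).prodMk (hasDerivAt_const t p))

theorem contDiffOn_slice (hg : ContDiffOn ℝ ∞ g (Set.univ ×ˢ D)) (t : ℝ) :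
    ContDiffOn ℝ ∞ (fun q => g (t, q)) D :=
  hg.comp (contDiff_const.prodMk contDiff_id).contDiffOn fun _ hq => ⟨Set.mem_univ _, hq⟩

theorem _root_.ContDiffOn.paraConj {E : Type*} [NormedAddCommGroup E] [NormedSpace ℝ E]
    {u : E → ParaC} {s : Set E} (h : ContDiffOn ℝ ∞ u s) : ContDiffOn ℝ ∞ (fun x => star (u x)) s :=
  starL.contDiff.comp_contDiffOn h

theorem _root_.HasDerivAt.paraConj {u : ℝ → ParaC} {u' : ParaC} (h : HasDerivAt u u' t) :
    HasDerivAt (fun s => star (u s)) (star u') t :=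
  starL.hasFDerivAt.comp_hasDerivAt t h

/-- Parameter derivatives commute with Wirtinger derivatives. -/
theorem hasWirt_tDeriv (hD : IsOpen D) (hg : ContDiffOn ℝ ∞ g (Set.univ ×ˢ D)) (hp : p ∈ D)
    {a b : ℝ → ParaC} {a' b' : ParaC} (h : ∀ s, HasWirt (fun q => g (s, q)) (a s) (b s) p)
    (ha : HasDerivAt a a' t) (hb : HasDerivAt b b' t) :
    HasWirt (fun q => tDeriv g (t, q)) a' b' p := by
  have hc : ∀ s, ContDiffAt ℝ ∞ g (s, p) := fun s => contDiffAt_family hD hg hp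
  have hd : HasFDerivAt (fderiv ℝ g) (fderiv ℝ (fderiv ℝ g) (t, p)) (t, p) :=
    (((hc t).fderiv_right (m := ∞) (by simp)).differentiableAt (by simp)).hasFDerivAt
  have hs : ∀ v w, fderiv ℝ (fderiv ℝ g) (t, p) v w = fderiv ℝ (fderiv ℝ g) (t, p) w v :=
    fun v w => ((hc t).isSymmSndFDerivAt (by
      rw [minSmoothness_of_isRCLikeNormedField]
      exact WithTop.coe_le_coe.2 (le_top : (2 : ℕ∞) ≤ ⊤))).eq _ _
  have hin : HasFDerivAt (fun q : ℝ × ℝ => (t, q)) (ContinuousLinearMap.inr ℝ ℝ (ℝ × ℝ)) p :=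
    hasFDerivAt_prodMk_right t p
  have h1 : HasFDerivAt (fun q => tDeriv g (t, q))
      (((ContinuousLinearMap.apply ℝ ParaC ((1 : ℝ), (0 : ℝ × ℝ))).comp
        (fderiv ℝ (fderiv ℝ g) (t, p))).comp (ContinuousLinearMap.inr ℝ ℝ (ℝ × ℝ))) p :=
    HasFDerivAt.comp (g := fun x => fderiv ℝ g x (1, 0)) p
      ((ContinuousLinearMap.apply ℝ ParaC ((1 : ℝ), (0 : ℝ × ℝ))).hasFDerivAt.comp _ hd) hin
  -- The `t`-derivative of the spatial derivative in direction `w`; by symmetry of the second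
  -- derivative it is the spatial derivative of `tDeriv g`. The hypothesis `h` expresses the same
  -- spatial derivatives through `a s` and `b s`.
  have h2 : ∀ w : ℝ × ℝ, HasDerivAt (fun s => fderiv ℝ g (s, p) (0, w))
      (fderiv ℝ (fderiv ℝ g) (t, p) (1, 0) (0, w)) t := fun w =>
    (ContinuousLinearMap.apply ℝ ParaC ((0 : ℝ), w)).hasFDerivAt.comp_hasDerivAt t
      (HasFDerivAt.comp_hasDerivAt (l := fderiv ℝ g) (f := fun s : ℝ => (s, p)) t hd
        ((hasDerivAt_id t).prodMk (hasDerivAt_const t p)))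
  have h3 : ∀ s w, ∀ L : ℝ × ℝ →L[ℝ] ParaC, HasFDerivAt (fun q => g (s, q)) L p → fderiv ℝ g (s, p) (0, w) = L w := by
    intro s w L hL
    have k : HasFDerivAt (fun q : ℝ × ℝ => g (s, q))
        ((fderiv ℝ g (s, p)).comp (ContinuousLinearMap.inr ℝ ℝ (ℝ × ℝ))) p :=
      ((hc s).differentiableAt (by simp)).hasFDerivAt.comp p (hasFDerivAt_prodMk_right s p)
    rw [hL.unique k]; simp
  refine ⟨_, h1, ?_, ?_⟩
  · have e : (fun s => fderiv ℝ g (s, p) (0, (1, 0))) = fun s => a s + b s := by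
      funext s
      obtain ⟨L, hL, e1, -⟩ := h s
      rw [h3 s _ L hL, e1]
    have k := h2 (1, 0)
    rw [e] at k
    rw [← k.unique (ha.add hb), hs]
    simp
  · have e : (fun s => fderiv ℝ g (s, p) (0, (0, 1))) = fun s => I * (a s - b s) := by
      funext s
      obtain ⟨L, hL, -, e1⟩ := h s
      rw [h3 s _ L hL, e1]
    have k := h2 (0, 1)
    rw [e] at k
    rw [← k.unique ((ha.sub hb).const_mul I), hs]
    simp

end Families

/-! ## The para-complex circle -/

theorem expI_add (s t : ℝ) : expI (s + t) = expI s * expI t := by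
  ext <;> simp [expI, Real.cosh_add, Real.sinh_add]; ring

theorem expI_zero : expI 0 = 1 := by ext <;> simp [expI]

theorem expI_mul_star (t : ℝ) : expI t * star (expI t) = 1 := mul_star_of_mem_circle ⟨t, rfl⟩

theorem hasDerivAt_expI (t : ℝ) : HasDerivAt expI (I * expI t) t := by
  have h : expI = fun s => ofRealL (Real.cosh s) + I * ofRealL (Real.sinh s) := by
    funext s; ext <;> simp [expI]
  rw [h]
  have h1 := ofRealL.hasFDerivAt.comp_hasDerivAt t (Real.hasDerivAt_cosh t)
  have h2 := ofRealL.hasFDerivAt.comp_hasDerivAt t (Real.hasDerivAt_sinh t)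
  have h3 := h1.add (h2.const_mul I)
  refine h3.congr_deriv ?_
  ext <;> simp

theorem hasDerivAt_star_expI (t : ℝ) :
    HasDerivAt (fun s => star (expI s)) (-(I * star (expI t))) t := by
  refine (hasDerivAt_expI t).paraConj.congr_deriv ?_
  rw [star_mul, star_I]; ring

/-- Since `e^{i't} e^{i's} = e^{i'(t+s)}`, the operator `μ∂_μ` becomes `i' d/dt`; all later
computations use the real parameter `t`. -/
theorem muDeriv_eq {G : ParaC → ParaC} {g' : ParaC} {t : ℝ}
    (h : HasDerivAt (fun s => G (expI s)) g' t) : muDeriv G (expI t) = I * g' := by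
  have h1 : HasDerivAt (fun s => G (expI t * expI s)) g' 0 := by
    have h0 : HasDerivAt (fun s => t + s) 1 (0 : ℝ) := (hasDerivAt_id (0 : ℝ)).const_add t
    have h' : HasDerivAt (fun s => G (expI s)) g' (t + 0) := by rwa [add_zero]
    have := h'.scomp (0 : ℝ) h0
    rw [one_smul] at this
    refine this.congr_of_eventuallyEq (Filter.Eventually.of_forall fun s => ?_)
    simp [Function.comp, expI_add]
  have h2 := reL.hasFDerivAt.comp_hasDerivAt 0 h1
  have h3 := imL.hasFDerivAt.comp_hasDerivAt 0 h1
  have e2 : deriv (fun s => (G (expI t * expI s)).re) 0 = g'.re := h2.deriv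
  have e3 : deriv (fun s => (G (expI t * expI s)).im) 0 = g'.im := h3.deriv
  rw [muDeriv, e2, e3]

/-! ## Frames of minimal surfaces -/

/-- The family `F = (α, β; β̄, ᾱ)`, with parameter `μ = e^{i' t}`, solves
`F⁻¹ dF = U^μ dz + V^μ dz̄`, where `H = e^{w/2}` and `κ = w_z / 4`. -/
structure IsFrame (D : Set (ℝ × ℝ)) (H : ℝ × ℝ → ℝ) (κ B : ℝ × ℝ → ParaC)
    (α β : ℝ × (ℝ × ℝ) → ParaC) : Prop where
  smooth_fst : ContDiffOn ℝ ∞ α (Set.univ ×ˢ D)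
  smooth_snd : ContDiffOn ℝ ∞ β (Set.univ ×ˢ D)
  smooth_H : ContDiffOn ℝ ∞ H D
  smooth_κ : ContDiffOn ℝ ∞ κ D
  smooth_B : ContDiffOn ℝ ∞ B D
  pos : ∀ p ∈ D, 0 < H p
  det : ∀ t, ∀ p ∈ D, α (t, p) * star (α (t, p)) - β (t, p) * star (β (t, p)) = 1
  wirt_H : ∀ p ∈ D, HasWirt (fun q => ofReal (H q)) (2 * ofReal (H p) * κ p)
    (2 * ofReal (H p) * star (κ p)) p
  wirt_fst : ∀ t, ∀ p ∈ D, HasWirt (fun q => α (t, q))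
    (α (t, p) * κ p + β (t, p) * (star (expI t) * B p * ofReal (H p)⁻¹ * I))
    (-(α (t, p) * star (κ p)) + β (t, p) * (expI t * ofReal (H p) * I)) p
  wirt_snd : ∀ t, ∀ p ∈ D, HasWirt (fun q => β (t, q))
    (-(α (t, p) * (star (expI t) * ofReal (H p) * I)) - β (t, p) * κ p)
    (-(α (t, p) * (expI t * star (B p) * ofReal (H p)⁻¹ * I)) + β (t, p) * star (κ p)) p

section Frame

variable {D : Set (ℝ × ℝ)} {ψ₁ ψ₂ : ℝ × ℝ → ParaC} {F : ParaC → ℝ × ℝ → Mat2}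

theorem contDiffOn_supportFn (h1 : SmoothOn ψ₁ D) (h2 : SmoothOn ψ₂ D) :
    ContDiffOn ℝ ∞ (supportFn ψ₁ ψ₂) D := by
  have h : supportFn ψ₁ ψ₂ = fun p => 2 * ((ψ₂ p).re * (ψ₂ p).re - (ψ₂ p).im * (ψ₂ p).im -
      ((ψ₁ p).re * (ψ₁ p).re - (ψ₁ p).im * (ψ₁ p).im)) := by
    funext p; simp [supportFn, QuadraticAlgebra.norm_def]
  rw [h]
  exact contDiffOn_const.mul (((h2.1.mul h2.1).sub (h2.2.mul h2.2)).sub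
    ((h1.1.mul h1.1).sub (h1.2.mul h1.2)))

theorem contDiffOn_diracLog (h1 : SmoothOn ψ₁ D) (h2 : SmoothOn ψ₂ D)
    (hpos : ∀ p ∈ D, 0 < supportFn ψ₁ ψ₂ p) : ContDiffOn ℝ ∞ (diracLog ψ₁ ψ₂) D :=
  contDiffOn_const.mul (((contDiffOn_supportFn h1 h2).div_const 4).log fun p hp => by
    have := hpos p hp
    positivity)

theorem contDiffOn_abreschRosenberg (hD : IsOpen D) (h1 : SmoothOn ψ₁ D) (h2 : SmoothOn ψ₂ D)
    (δ : ParaC) : ContDiffOn ℝ ∞ (abreschRosenberg δ ψ₁ ψ₂) D := by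
  rw [smoothOn_iff] at h1 h2
  exact contDiffOn_const.mul (contDiffOn_const.mul ((h1.mul (contDiffOn_dz hD h2.paraConj)).sub
    (h2.paraConj.mul (contDiffOn_dz hD h1))))

/-- The entry `α` of a frame `(α, β; β̄, ᾱ)`, as a function of `t` with `μ = e^{i' t}`. -/
def frameFst (F : ParaC → ℝ × ℝ → Mat2) (x : ℝ × (ℝ × ℝ)) : ParaC := F (expI x.1) x.2 0 0

/-- The entry `β` of a frame `(α, β; β̄, ᾱ)`, as a function of `t` with `μ = e^{i' t}`. -/
def frameSnd (F : ParaC → ℝ × ℝ → Mat2) (x : ℝ × (ℝ × ℝ)) : ParaC := F (expI x.1) x.2 0 1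

theorem frame_eq (hF : IsExtendedFrame D ψ₁ ψ₂ F) {μ : ParaC} (hμ : μ ∈ circle) {p : ℝ × ℝ}
    (hp : p ∈ D) : F μ p = !![F μ p 0 0, F μ p 0 1; star (F μ p 0 1), star (F μ p 0 0)] ∧
      F μ p 0 0 * star (F μ p 0 0) - F μ p 0 1 * star (F μ p 0 1) = 1 := by
  obtain ⟨α, β, h1, h2⟩ := hF.mem_SU μ hμ p hp
  constructor
  · simp [h1]
  · simpa [h1] using h2

/-- An element of `SU'(1,1)` is determined by its first row, so two entries of each Lax equation
suffice. As `w` is real, `w_z̄` is the conjugate of `w_z`, and `H = e^{w/2}` gives `H_z = 2Hκ`. -/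
theorem isFrame_of_isExtendedFrame (hD : IsOpen D) (h1 : SmoothOn ψ₁ D) (h2 : SmoothOn ψ₂ D)
    (hpos : ∀ p ∈ D, 0 < supportFn ψ₁ ψ₂ p) (hF : IsExtendedFrame D ψ₁ ψ₂ F) :
    IsFrame D (fun p => supportFn ψ₁ ψ₂ p / 4)
      (fun p => (1 / 4 : ℝ) • dz (fun q => ofReal (diracLog ψ₁ ψ₂ q)) p)
      (abreschRosenberg 1 ψ₁ ψ₂) (frameFst F) (frameSnd F) := by
  have hw := contDiffOn_diracLog h1 h2 hpos
  have hd : ∀ p ∈ D, DifferentiableAt ℝ (diracLog ψ₁ ψ₂) p := fun p hp =>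
    (hw.contDiffAt (hD.mem_nhds hp)).differentiableAt (by simp)
  have hdF : ∀ t, ∀ p ∈ D, ∀ i j, DifferentiableAt ℝ (fun q => F (expI t) q i j) p :=
    fun t p hp i j => ((contDiffOn_slice (smoothOn_iff.1 (hF.smooth i j)) t).contDiffAt
      (hD.mem_nhds hp)).differentiableAt (by simp)
  have hexp : ∀ p ∈ D, Real.exp (-diracLog ψ₁ ψ₂ p / 2) = (supportFn ψ₁ ψ₂ p / 4)⁻¹ :=
    fun p hp => by rw [neg_div, Real.exp_neg, exp_diracLog (hpos p hp)]
  have hbar : ∀ p ∈ D, dzbar (fun q => ofReal (diracLog ψ₁ ψ₂ q)) p =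
      star (dz (fun q => ofReal (diracLog ψ₁ ψ₂ q)) p) := fun p hp =>
    (hasWirt_ofReal (hd p hp)).dzbar_eq
  have hsmul : ∀ (r : ℝ) (z : ParaC), star (r • z) = r • star z := fun r z => by ext <;> simp
  refine ⟨smoothOn_iff.1 (hF.smooth 0 0), smoothOn_iff.1 (hF.smooth 0 1),
    (contDiffOn_supportFn h1 h2).div_const 4,
    (contDiffOn_dz hD (ofRealL.contDiff.comp_contDiffOn hw)).const_smul _,
    contDiffOn_abreschRosenberg hD h1 h2 1, fun p hp => by have := hpos p hp; positivity,
    fun t p hp => (frame_eq hF ⟨t, rfl⟩ hp).2, ?_, ?_, ?_⟩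
  · intro p hp
    have hg : HasDerivAt (fun x : ℝ => Real.exp (x / 2))
        (Real.exp (diracLog ψ₁ ψ₂ p / 2) * (1 / 2)) (diracLog ψ₁ ψ₂ p) :=
      ((hasDerivAt_id _).div_const 2).exp
    have h := (hasWirt_ofReal (hd p hp)).comp_ofReal hg
    refine (h.congr ?_).congr_deriv ?_ ?_
    · filter_upwards [hD.mem_nhds hp] with q hq
      rw [exp_diracLog (hpos q hq)]
    · rw [exp_diracLog (hpos p hp), two_mul]
      ext <;> simp <;> ring
    · rw [exp_diracLog (hpos p hp), two_mul]
      ext <;> simp <;> ring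
  · intro t p hp
    have e1 := congrFun (congrFun (hF.dz_eq (expI t) ⟨t, rfl⟩ p hp) 0) 0
    have e2 := congrFun (congrFun (hF.dzbar_eq (expI t) ⟨t, rfl⟩ p hp) 0) 0
    simp only [Matrix.of_apply, Matrix.mul_apply, Fin.sum_univ_two, laxU, laxV, Matrix.cons_val',
      Matrix.cons_val_zero, Matrix.cons_val_one, Matrix.cons_val_fin_one] at e1 e2
    refine (hasWirt (hdF t p hp 0 0)).congr_deriv ?_ ?_
    · simp only [frameFst, frameSnd]
      rw [e1, hexp p hp, smul_eq_ofReal_mul _ (star _ * _ * _)]; ring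
    · simp only [frameFst, frameSnd]
      rw [e2, exp_diracLog (hpos p hp), hbar p hp, hsmul, smul_eq_ofReal_mul _ (expI t * I)]; ring
  · intro t p hp
    have e1 := congrFun (congrFun (hF.dz_eq (expI t) ⟨t, rfl⟩ p hp) 0) 1
    have e2 := congrFun (congrFun (hF.dzbar_eq (expI t) ⟨t, rfl⟩ p hp) 0) 1
    simp only [Matrix.of_apply, Matrix.mul_apply, Fin.sum_univ_two, laxU, laxV, Matrix.cons_val',
      Matrix.cons_val_zero, Matrix.cons_val_one, Matrix.cons_val_fin_one] at e1 e2
    refine (hasWirt (hdF t p hp 0 1)).congr_deriv ?_ ?_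
    · simp only [frameFst, frameSnd]
      rw [e1, exp_diracLog (hpos p hp), smul_eq_ofReal_mul _ (star _ * _)]; ring
    · simp only [frameFst, frameSnd]
      rw [e2, hexp p hp, hbar p hp, hsmul, smul_eq_ofReal_mul _ (expI t * _ * _)]; ring

end Frame

end ParaC
end

noncomputable section

namespace ParaC

open scoped QuadraticAlgebra

/-! ## The Sym formula -/

/-- The upper left entry of `m_±`. -/
def symDiag (σ : ℝ) (α β : ℝ × (ℝ × ℝ) → ParaC) (x : ℝ × (ℝ × ℝ)) : ParaC :=
  -(tDeriv α x * star (α x) - tDeriv β x * star (β x)) +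
    ofReal (σ / 2) * I * (α x * star (α x) + β x * star (β x))

/-- The upper right entry of `m_±`. -/
def symOff (σ : ℝ) (α β : ℝ × (ℝ × ℝ) → ParaC) (x : ℝ × (ℝ × ℝ)) : ParaC :=
  -(tDeriv β x * α x - tDeriv α x * β x) - ofReal σ * I * (α x * β x)

section Frame

variable {D : Set (ℝ × ℝ)} {H : ℝ × ℝ → ℝ} {κ B : ℝ × ℝ → ParaC} {α β : ℝ × (ℝ × ℝ) → ParaC}
  {p : ℝ × ℝ}

/-- The last summand of each derivative comes from `d/dt e^{±i't} = ±i' e^{±i't}`; this `i'` cancels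
the one in the Lax matrix. -/
theorem IsFrame.wirt_tDeriv_fst (h : IsFrame D H κ B α β) (hD : IsOpen D) (hp : p ∈ D) (t : ℝ) :
    HasWirt (fun q => tDeriv α (t, q))
      (tDeriv α (t, p) * κ p + tDeriv β (t, p) * (star (expI t) * B p * ofReal (H p)⁻¹ * I)
        - β (t, p) * (star (expI t) * B p * ofReal (H p)⁻¹))
      (-(tDeriv α (t, p) * star (κ p)) + tDeriv β (t, p) * (expI t * ofReal (H p) * I)
        + β (t, p) * (expI t * ofReal (H p))) p := by
  have e := I_mul_I
  have ha := hasDerivAt_tDeriv (t := t) hD h.smooth_fst hp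
  have hb := hasDerivAt_tDeriv (t := t) hD h.smooth_snd hp
  refine (hasWirt_tDeriv (t := t) hD h.smooth_fst hp (fun s => h.wirt_fst s p hp)
    ((ha.mul_const _).add (hb.mul ((((hasDerivAt_star_expI t).mul_const _).mul_const _).mul_const _)))
    ((ha.mul_const _).neg.add
      (hb.mul (((hasDerivAt_expI t).mul_const _).mul_const _)))).congr_deriv ?_ ?_
  · linear_combination (-(β (t, p) * star (expI t) * B p * ofReal (H p)⁻¹)) * e
  · linear_combination (β (t, p) * expI t * ofReal (H p)) * e

theorem IsFrame.wirt_tDeriv_snd (h : IsFrame D H κ B α β) (hD : IsOpen D) (hp : p ∈ D) (t : ℝ) :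
    HasWirt (fun q => tDeriv β (t, q))
      (-(tDeriv α (t, p) * (star (expI t) * ofReal (H p) * I)) - tDeriv β (t, p) * κ p
        + α (t, p) * (star (expI t) * ofReal (H p)))
      (-(tDeriv α (t, p) * (expI t * star (B p) * ofReal (H p)⁻¹ * I))
        + tDeriv β (t, p) * star (κ p) - α (t, p) * (expI t * star (B p) * ofReal (H p)⁻¹)) p := by
  have e := I_mul_I
  have ha := hasDerivAt_tDeriv (t := t) hD h.smooth_fst hp
  have hb := hasDerivAt_tDeriv (t := t) hD h.smooth_snd hp
  refine (hasWirt_tDeriv (t := t) hD h.smooth_snd hp (fun s => h.wirt_snd s p hp)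
    ((ha.mul (((hasDerivAt_star_expI t).mul_const _).mul_const _)).neg.sub (hb.mul_const _))
    ((ha.mul ((((hasDerivAt_expI t).mul_const _).mul_const _).mul_const _)).neg.add
      (hb.mul_const _))).congr_deriv ?_ ?_
  · linear_combination (α (t, p) * star (expI t) * ofReal (H p)) * e
  · linear_combination (-(α (t, p) * expI t * star (B p) * ofReal (H p)⁻¹)) * e

/-- An entry of `(m_σ)_z = F (-U_t + σ(i'/2)[U, σ₃]) F⁻¹`. The middle matrix is off-diagonal with
entries `x` and `y`: the two contributions agree up to the sign `σ`, so they add or cancel. The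
diagonal entry is treated in `IsFrame.wirt_symDiag`. -/
theorem IsFrame.wirt_symOff (h : IsFrame D H κ B α β) (hD : IsOpen D) (hp : p ∈ D) (t σ : ℝ)
    {x y : ParaC} (hx : x = ofReal (σ - 1) * star (expI t) * ofReal (H p))
    (hy : y = ofReal (σ + 1) * star (expI t) * B p * ofReal (H p)⁻¹) :
    HasWirt (fun q => symOff σ α β (t, q)) (x * α (t, p) ^ 2 - y * β (t, p) ^ 2)
      (star (y * star (α (t, p)) ^ 2 - x * star (β (t, p)) ^ 2)) p := by
  have ha := h.wirt_fst t p hp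
  have hb := h.wirt_snd t p hp
  have ha' := h.wirt_tDeriv_fst hD hp t
  have hb' := h.wirt_tDeriv_snd hD hp t
  have e := I_mul_I
  refine ((((hb'.mul ha).sub (ha'.mul hb)).neg).sub
    ((ha.mul hb).const_mul (ofReal σ * I))).congr_deriv ?_ ?_
  · rw [hx, hy, ofReal_sub, ofReal_add, ofReal_one]
    linear_combination ofReal σ * (α (t, p) ^ 2 * (star (expI t) * ofReal (H p)) -
      β (t, p) ^ 2 * (star (expI t) * B p * ofReal (H p)⁻¹)) * e
  · rw [hx, hy, ofReal_sub, ofReal_add, ofReal_one]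
    simp only [star_sub, star_mul, star_pow, star_star, star_add, star_ofReal, star_one]
    linear_combination ofReal σ * (α (t, p) ^ 2 * (expI t * star (B p) * ofReal (H p)⁻¹) -
      β (t, p) ^ 2 * (expI t * ofReal (H p))) * e

theorem IsFrame.wirt_symDiag (h : IsFrame D H κ B α β) (hD : IsOpen D) (hp : p ∈ D) (t σ : ℝ)
    {x y : ParaC} (hx : x = ofReal (σ - 1) * star (expI t) * ofReal (H p))
    (hy : y = ofReal (σ + 1) * star (expI t) * B p * ofReal (H p)⁻¹) :
    HasWirt (fun q => symDiag σ α β (t, q))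
      (y * β (t, p) * star (α (t, p)) - x * α (t, p) * star (β (t, p)))
      (-star (y * β (t, p) * star (α (t, p)) - x * α (t, p) * star (β (t, p)))) p := by
  have ha := h.wirt_fst t p hp
  have hb := h.wirt_snd t p hp
  have ha' := h.wirt_tDeriv_fst hD hp t
  have hb' := h.wirt_tDeriv_snd hD hp t
  have e := I_mul_I
  have e2 : ofReal σ = 2 * ofReal (σ / 2) := by rw [two_mul]; ext <;> simp
  refine (((ha'.mul ha.conj).sub (hb'.mul hb.conj)).neg.add
    (((ha.mul ha.conj).add (hb.mul hb.conj)).const_mul (ofReal (σ / 2) * I))).congr_deriv ?_ ?_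
  · rw [hx, hy, ofReal_sub, ofReal_add, ofReal_one, e2]
    simp only [star_neg, star_mul, star_star, star_add, star_ofReal, star_I]
    linear_combination 2 * ofReal (σ / 2) * (β (t, p) * star (α (t, p)) *
      (star (expI t) * B p * ofReal (H p)⁻¹) - α (t, p) * star (β (t, p)) *
      (star (expI t) * ofReal (H p))) * e
  · rw [hx, hy, ofReal_sub, ofReal_add, ofReal_one, e2]
    simp only [star_sub, star_neg, star_mul, star_star, star_add, star_ofReal, star_I, star_one,
      star_ofNat]
    linear_combination 2 * ofReal (σ / 2) * (star (α (t, p)) * β (t, p) *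
      (expI t * ofReal (H p)) - star (β (t, p)) * α (t, p) *
      (expI t * star (B p) * ofReal (H p)⁻¹)) * e

theorem IsFrame.contDiffOn_symDiag (h : IsFrame D H κ B α β) (hD : IsOpen D) (σ : ℝ) :
    ContDiffOn ℝ ∞ (symDiag σ α β) (Set.univ ×ˢ D) :=
  (((contDiffOn_tDeriv hD h.smooth_fst).mul h.smooth_fst.paraConj).sub
    ((contDiffOn_tDeriv hD h.smooth_snd).mul h.smooth_snd.paraConj)).neg.add
    (contDiffOn_const.mul ((h.smooth_fst.mul h.smooth_fst.paraConj).add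
      (h.smooth_snd.mul h.smooth_snd.paraConj)))

theorem IsFrame.contDiffOn_symOff (h : IsFrame D H κ B α β) (hD : IsOpen D) (σ : ℝ) :
    ContDiffOn ℝ ∞ (symOff σ α β) (Set.univ ×ˢ D) :=
  (((contDiffOn_tDeriv hD h.smooth_snd).mul h.smooth_fst).sub
    ((contDiffOn_tDeriv hD h.smooth_fst).mul h.smooth_snd)).neg.sub
    (contDiffOn_const.mul (h.smooth_fst.mul h.smooth_snd))

/-- The derivative of `α ᾱ - β β̄ = 1` with respect to the parameter. -/
theorem IsFrame.tDeriv_det (h : IsFrame D H κ B α β) (hD : IsOpen D) (hp : p ∈ D) (t : ℝ) :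
    tDeriv α (t, p) * star (α (t, p)) + α (t, p) * star (tDeriv α (t, p)) -
      (tDeriv β (t, p) * star (β (t, p)) + β (t, p) * star (tDeriv β (t, p))) = 0 := by
  have ha := hasDerivAt_tDeriv (t := t) hD h.smooth_fst hp
  have hb := hasDerivAt_tDeriv (t := t) hD h.smooth_snd hp
  have k : HasDerivAt (fun s => α (s, p) * star (α (s, p)) - β (s, p) * star (β (s, p))) _ t :=
    (ha.mul ha.paraConj).sub (hb.mul hb.paraConj)
  have e : (fun s => α (s, p) * star (α (s, p)) - β (s, p) * star (β (s, p))) = fun _ => 1 := by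
    funext s; exact h.det s p hp
  rw [e] at k
  exact k.unique (hasDerivAt_const t (1 : ParaC))

theorem IsFrame.star_symDiag (h : IsFrame D H κ B α β) (hD : IsOpen D) (hp : p ∈ D) (t σ : ℝ) :
    star (symDiag σ α β (t, p)) = -symDiag σ α β (t, p) := by
  have := h.tDeriv_det hD hp t
  simp only [symDiag, star_sub, star_neg, star_mul, star_star, star_add, star_ofReal, star_I]
  linear_combination -this

theorem IsFrame.star_tDeriv_symDiag (h : IsFrame D H κ B α β) (hD : IsOpen D) (hp : p ∈ D)
    (t σ : ℝ) :
    star (tDeriv (symDiag σ α β) (t, p)) = -tDeriv (symDiag σ α β) (t, p) := by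
  have k := hasDerivAt_tDeriv (t := t) hD (h.contDiffOn_symDiag hD σ) hp
  have k1 := k.paraConj
  have e : (fun s => star (symDiag σ α β (s, p))) = fun s => -symDiag σ α β (s, p) := by
    funext s; exact h.star_symDiag hD hp s σ
  rw [e] at k1
  exact k1.unique k.neg

/-- `z` is the `t`-derivative of `yβᾱ - xαβ̄`; the terms with `i'` appear because `x` and `y` are
proportional to `μ⁻¹`. -/
theorem IsFrame.wirt_tDeriv_symDiag (h : IsFrame D H κ B α β) (hD : IsOpen D) (hp : p ∈ D)
    (t σ : ℝ) {x y z : ParaC} (hx : x = ofReal (σ - 1) * star (expI t) * ofReal (H p))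
    (hy : y = ofReal (σ + 1) * star (expI t) * B p * ofReal (H p)⁻¹)
    (hz : z = y * (tDeriv β (t, p) * star (α (t, p)) + β (t, p) * star (tDeriv α (t, p)))
      - I * y * β (t, p) * star (α (t, p))
      - x * (tDeriv α (t, p) * star (β (t, p)) + α (t, p) * star (tDeriv β (t, p)))
      + I * x * α (t, p) * star (β (t, p))) :
    HasWirt (fun q => tDeriv (symDiag σ α β) (t, q)) z (-star z) p := by
  have ha := hasDerivAt_tDeriv (t := t) hD h.smooth_fst hp
  have hb := hasDerivAt_tDeriv (t := t) hD h.smooth_snd hp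
  have hk : HasDerivAt (fun s =>
      ofReal (σ + 1) * star (expI s) * B p * ofReal (H p)⁻¹ * β (s, p) * star (α (s, p)) -
      ofReal (σ - 1) * star (expI s) * ofReal (H p) * α (s, p) * star (β (s, p))) z t := by
    refine (((((((hasDerivAt_star_expI t).const_mul _).mul_const _).mul_const _).mul hb).mul
      ha.paraConj).sub (((((hasDerivAt_star_expI t).const_mul _).mul_const _).mul ha).mul
      hb.paraConj)).congr_deriv ?_
    rw [hz, hx, hy]
    simp only [Pi.mul_apply]
    ring
  exact hasWirt_tDeriv hD (h.contDiffOn_symDiag hD σ) hp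
    (fun s => h.wirt_symDiag hD hp s σ rfl rfl) hk hk.paraConj.neg

end Frame

section Sym

variable {D : Set (ℝ × ℝ)} {ψ₁ ψ₂ : ℝ × ℝ → ParaC} {F : ParaC → ℝ × ℝ → Mat2} {p : ℝ × ℝ}

theorem frame_inv {A : Mat2} {α β : ParaC} (hA : A = !![α, β; star β, star α])
    (hdet : α * star α - β * star β = 1) : A⁻¹ = !![star α, -β; -star β, α] := by
  apply Matrix.inv_eq_right_inv
  have e1 : α * star α + β * -star β = 1 := by linear_combination hdet
  have e2 : α * -β + β * α = 0 := by ring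
  have e3 : star β * star α + star α * -star β = 0 := by ring
  have e4 : star β * -β + star α * α = 1 := by linear_combination hdet
  rw [hA, Matrix.mul_fin_two, Matrix.one_fin_two, e1, e2, e3, e4]

theorem smul_mat (c a b d e : ParaC) :
    c • (!![a, b; d, e] : Mat2) = !![c * a, c * b; c * d, c * e] := by
  refine Matrix.ext fun i j => ?_
  fin_cases i <;> fin_cases j <;> rfl

theorem real_smul_mat (r : ℝ) (a b d e : ParaC) : r • (!![a, b; d, e] : Mat2) =
    !![ofReal r * a, ofReal r * b; ofReal r * d, ofReal r * e] := by
  refine Matrix.ext fun i j => ?_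
  fin_cases i <;> fin_cases j <;> exact smul_eq_ofReal_mul _ _

theorem add_mat (a b d e a' b' d' e' : ParaC) :
    (!![a, b; d, e] : Mat2) + !![a', b'; d', e'] = !![a + a', b + b'; d + d', e + e'] := by
  refine Matrix.ext fun i j => ?_
  fin_cases i <;> fin_cases j <;> rfl

theorem neg_mat (a b d e : ParaC) : -(!![a, b; d, e] : Mat2) = !![-a, -b; -d, -e] := by
  refine Matrix.ext fun i j => ?_
  fin_cases i <;> fin_cases j <;> rfl

theorem mat_congr {a b d e a' b' d' e' : ParaC} (h1 : a = a') (h2 : b = b') (h3 : d = d')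
    (h4 : e = e') : (!![a, b; d, e] : Mat2) = !![a', b'; d', e'] := by
  rw [h1, h2, h3, h4]

theorem frame_eq' (hF : IsExtendedFrame D ψ₁ ψ₂ F) (hp : p ∈ D) (t : ℝ) :
    F (expI t) p = !![frameFst F (t, p), frameSnd F (t, p);
      star (frameSnd F (t, p)), star (frameFst F (t, p))] ∧
    (F (expI t) p)⁻¹ = !![star (frameFst F (t, p)), -frameSnd F (t, p);
      -star (frameSnd F (t, p)), frameFst F (t, p)] := by
  obtain ⟨h1, h2⟩ := frame_eq hF ⟨t, rfl⟩ hp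
  exact ⟨h1, frame_inv h1 h2⟩

theorem normalM_eq (hF : IsExtendedFrame D ψ₁ ψ₂ F) (hp : p ∈ D) (t : ℝ) :
    normalM F (expI t) p =
      !![ofReal (1 / 2) * I * (frameFst F (t, p) * star (frameFst F (t, p)) +
          frameSnd F (t, p) * star (frameSnd F (t, p))),
        -(I * (frameFst F (t, p) * frameSnd F (t, p)));
        I * (star (frameFst F (t, p)) * star (frameSnd F (t, p))),
        -(ofReal (1 / 2) * I * (frameFst F (t, p) * star (frameFst F (t, p)) +
          frameSnd F (t, p) * star (frameSnd F (t, p))))] := by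
  obtain ⟨h1, h2⟩ := frame_eq' hF hp t
  have e : (2 : ParaC) * ofReal (1 / 2) = 1 := by rw [two_mul]; ext <;> norm_num
  rw [normalM, h2, h1, σ₃, Matrix.mul_fin_two, Matrix.mul_fin_two, smul_mat, smul_eq_ofReal_mul]
  refine mat_congr ?_ ?_ ?_ ?_
  · ring
  · linear_combination (-(I * frameFst F (t, p) * frameSnd F (t, p))) * e
  · linear_combination (I * star (frameFst F (t, p)) * star (frameSnd F (t, p))) * e
  · ring

/-- Replacing `μ∂_μ` by `i' d/dt` cancels the factor `i'`, so `m_± = -F_t F⁻¹ ± N_m`. The lower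
right entry uses the derivative of `det F = 1`. -/
theorem symM_eq (hD : IsOpen D) {H : ℝ × ℝ → ℝ} {κ B : ℝ × ℝ → ParaC}
    (h : IsFrame D H κ B (frameFst F) (frameSnd F)) (hF : IsExtendedFrame D ψ₁ ψ₂ F) (hp : p ∈ D)
    (t σ : ℝ) : symM σ F (expI t) p =
      !![symDiag σ (frameFst F) (frameSnd F) (t, p), symOff σ (frameFst F) (frameSnd F) (t, p);
        star (symOff σ (frameFst F) (frameSnd F) (t, p)),
        -symDiag σ (frameFst F) (frameSnd F) (t, p)] := by
  have ha := hasDerivAt_tDeriv (t := t) hD h.smooth_fst hp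
  have hb := hasDerivAt_tDeriv (t := t) hD h.smooth_snd hp
  have hs : ∀ s, F (expI s) p = _ := fun s => (frame_eq' hF hp s).1
  have hm : muDerivMat (fun ν => F ν p) (expI t) =
      !![I * tDeriv (frameFst F) (t, p), I * tDeriv (frameSnd F) (t, p);
        I * star (tDeriv (frameSnd F) (t, p)), I * star (tDeriv (frameFst F) (t, p))] := by
    refine Matrix.ext fun i j => ?_
    rw [muDerivMat, Matrix.of_apply]
    fin_cases i <;> fin_cases j
    · exact muDeriv_eq ha
    · exact muDeriv_eq hb
    · refine muDeriv_eq (G := fun ν => F ν p 1 0) (hb.paraConj.congr_of_eventuallyEq ?_)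
      exact Filter.Eventually.of_forall fun s => by simp [hs]
    · refine muDeriv_eq (G := fun ν => F ν p 1 1) (ha.paraConj.congr_of_eventuallyEq ?_)
      exact Filter.Eventually.of_forall fun s => by simp [hs]
  have e : (2 : ParaC) * ofReal (1 / 2) = 1 := by rw [two_mul]; ext <;> norm_num
  have e2 : ofReal (σ / 2) = ofReal σ * ofReal (1 / 2) := by rw [← ofReal_mul]; congr 1; ring
  have eI := I_mul_I
  have hd := h.tDeriv_det hD hp t
  rw [symM, hm, (frame_eq' hF hp t).2, normalM_eq hF hp t, Matrix.mul_fin_two, smul_mat, neg_mat,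
    real_smul_mat, add_mat]
  simp only [symDiag, symOff, star_sub, star_neg, star_mul, star_ofReal, star_I]
  rw [e2]
  refine mat_congr ?_ ?_ ?_ ?_
  · linear_combination (tDeriv (frameSnd F) (t, p) * star (frameSnd F (t, p)) -
      tDeriv (frameFst F) (t, p) * star (frameFst F (t, p))) * eI
  · linear_combination (tDeriv (frameFst F) (t, p) * frameSnd F (t, p) -
      tDeriv (frameSnd F) (t, p) * frameFst F (t, p)) * eI
  · linear_combination (star (tDeriv (frameFst F) (t, p)) * star (frameSnd F (t, p)) -
      star (tDeriv (frameSnd F) (t, p)) * star (frameFst F (t, p))) * eI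
  · linear_combination (star (tDeriv (frameSnd F) (t, p)) * frameSnd F (t, p) -
      star (tDeriv (frameFst F) (t, p)) * frameFst F (t, p)) * eI - hd

/-- On the diagonal, `-(i'/2) μ∂_μ` is `-(1/2) d/dt`. -/
theorem symHat_eq (hD : IsOpen D) {H : ℝ × ℝ → ℝ} {κ B : ℝ × ℝ → ParaC}
    (h : IsFrame D H κ B (frameFst F) (frameSnd F)) (hF : IsExtendedFrame D ψ₁ ψ₂ F) (hp : p ∈ D)
    (t σ : ℝ) : symHat σ F (expI t) p =
      !![-(ofReal (1 / 2) * tDeriv (symDiag σ (frameFst F) (frameSnd F)) (t, p)),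
        symOff σ (frameFst F) (frameSnd F) (t, p);
        star (symOff σ (frameFst F) (frameSnd F) (t, p)),
        ofReal (1 / 2) * tDeriv (symDiag σ (frameFst F) (frameSnd F)) (t, p)] := by
  have hk := hasDerivAt_tDeriv (t := t) hD (h.contDiffOn_symDiag hD σ) hp
  have hs : ∀ s, symM σ F (expI s) p = _ := fun s => symM_eq hD h hF hp s σ
  have h00 : muDeriv (fun ν => symM σ F ν p 0 0) (expI t) =
      I * tDeriv (symDiag σ (frameFst F) (frameSnd F)) (t, p) :=
    muDeriv_eq (hk.congr_of_eventuallyEq (Filter.Eventually.of_forall fun s => by simp [hs]))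
  have h11 : muDeriv (fun ν => symM σ F ν p 1 1) (expI t) =
      I * -tDeriv (symDiag σ (frameFst F) (frameSnd F)) (t, p) :=
    muDeriv_eq (hk.neg.congr_of_eventuallyEq (Filter.Eventually.of_forall fun s => by simp [hs]))
  have eI := I_mul_I
  rw [symHat, offDiagPart, hs t]
  refine Matrix.ext fun i j => ?_
  fin_cases i <;> fin_cases j
  · simp [diagPart, muDerivMat, h00, smul_eq_ofReal_mul]
    linear_combination (ofReal 2⁻¹ * tDeriv (symDiag σ (frameFst F) (frameSnd F)) (t, p)) * eI
  · simp [diagPart]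
  · simp [diagPart]
  · simp [diagPart, muDerivMat, h11, smul_eq_ofReal_mul]
    linear_combination (ofReal 2⁻¹ * tDeriv (symDiag σ (frameFst F) (frameSnd F)) (t, p)) * eI

theorem suVec_suCoord {a b : ParaC} (ha : star a = -a) :
    suVec (suCoord !![a, b; star b, -a]) = !![a, b; star b, -a] := by
  have hre : a.re = 0 := by
    have := congrArg QuadraticAlgebra.re ha
    simp at this
    linarith
  refine Matrix.ext fun i j => ?_
  fin_cases i <;> fin_cases j <;> ext <;> simp [suVec, suCoord, E₁, E₂, E₃, hre] <;>
    ring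

end Sym

end ParaC
end

noncomputable section

namespace ParaC

open scoped QuadraticAlgebra

/-! ## The Maurer-Cartan form of the Sym formula -/

/-- This identity is why the Sym formula fits the Heisenberg group: the derivatives `α', β'` occur
both in the derivative of the third coordinate and in the contact correction by the first two, and
cancel by `hdet` and its derivative `hd`. The relations `hx`, `hy` treat both signs at once, as `x`
carries `σ - 1`, `y` carries `σ + 1` and `σ² = 1`. -/
theorem third_component_eq {α β a b α' β' a' b' x y σ : ParaC} (hdet : α * a - β * b = 1)
    (hd : α' * a + α * a' - (β' * b + β * b') = 0) (hx : σ * x = -x) (hy : σ * y = y) :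
    -(I * (y * (β' * a + β * a') - I * y * β * a - x * (α' * b + α * b') + I * x * α * b)) +
      I * ((-(b' * a - a' * b) + σ * I * (a * b)) * (x * α ^ 2 - y * β ^ 2) -
        (-(β' * α - α' * β) - σ * I * (α * β)) * (y * a ^ 2 - x * b ^ 2)) =
      2 * (y * β * a - x * α * b) := by
  have e := I_mul_I
  linear_combination I * x * (α * b * hd - (α * b' + α' * b) * hdet)
    + I * y * ((β' * a + β * a') * hdet - β * a * hd)
    + I * I * σ * (x * α * b + y * β * a) * hdet
    + (y * β * a - x * α * b + σ * (x * α * b + y * β * a)) * e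
    + α * b * hx + β * a * hy

section Sym

variable {D : Set (ℝ × ℝ)} {ψ₁ ψ₂ : ℝ × ℝ → ParaC} {F : ParaC → ℝ × ℝ → Mat2} {p : ℝ × ℝ}
  {H : ℝ × ℝ → ℝ} {κ B : ℝ × ℝ → ParaC}

theorem ofReal_symSurface (hD : IsOpen D) (h : IsFrame D H κ B (frameFst F) (frameSnd F))
    (hF : IsExtendedFrame D ψ₁ ψ₂ F) (hp : p ∈ D) (t σ : ℝ) :
    ofReal (symSurface σ F (expI t) p 0) =
      I * (star (symOff σ (frameFst F) (frameSnd F) (t, p)) -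
        symOff σ (frameFst F) (frameSnd F) (t, p)) ∧
    ofReal (symSurface σ F (expI t) p 1) =
      -(symOff σ (frameFst F) (frameSnd F) (t, p) +
        star (symOff σ (frameFst F) (frameSnd F) (t, p))) ∧
    ofReal (symSurface σ F (expI t) p 2) =
      -(I * tDeriv (symDiag σ (frameFst F) (frameSnd F)) (t, p)) := by
  have hre : (tDeriv (symDiag σ (frameFst F) (frameSnd F)) (t, p)).re = 0 := by
    have := congrArg QuadraticAlgebra.re (h.star_tDeriv_symDiag hD hp t σ)
    simp at this
    linarith
  rw [symSurface, symHat_eq hD h hF hp t σ]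
  refine ⟨?_, ?_, ?_⟩
  · ext <;> simp [suCoord]; ring
  · ext <;> simp [suCoord]; ring
  · ext <;> simp [suCoord, hre]

/-- The first two components are combinations of the derivatives of the off-diagonal entry of `m_σ`
and its conjugate; the third is `third_component_eq`. For `σ = ±1` one of the two summands vanishes.
-/
theorem leftDz_symSurface (hD : IsOpen D) (h : IsFrame D H κ B (frameFst F) (frameSnd F))
    (hF : IsExtendedFrame D ψ₁ ψ₂ F) (hp : p ∈ D) (t : ℝ) {σ : ℝ} (hσ : σ ^ 2 = 1) (k : Fin 3) :
    leftDz (symSurface σ F (expI t)) p k =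
      ofReal (1 - σ) * star (expI t) * ofReal (H p) *
          spinorVec (star (frameSnd F (t, p))) (star (frameFst F (t, p))) k +
        ofReal (1 + σ) * star (expI t) * B p * ofReal (H p)⁻¹ *
          spinorVec (star (frameFst F (t, p))) (star (frameSnd F (t, p))) k := by
  obtain ⟨x, hx⟩ : ∃ x, x = ofReal (σ - 1) * star (expI t) * ofReal (H p) := ⟨_, rfl⟩
  obtain ⟨y, hy⟩ : ∃ y, y = ofReal (σ + 1) * star (expI t) * B p * ofReal (H p)⁻¹ := ⟨_, rfl⟩
  have hx' : ofReal (1 - σ) * star (expI t) * ofReal (H p) = -x := by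
    rw [hx, ← neg_sub, ofReal_neg]; ring
  rw [hx', add_comm 1 σ, ← hy]
  have hM := h.wirt_symOff hD hp t σ hx hy
  have hT := h.wirt_tDeriv_symDiag hD hp t σ hx hy rfl
  have hev : ∀ᶠ q in nhds p, q ∈ D := hD.mem_nhds hp
  have h0 : HasWirt (fun q => ofReal (symSurface σ F (expI t) q 0)) _ _ p :=
    ((hM.conj.sub hM).const_mul I).congr
      (hev.mono fun q hq => (ofReal_symSurface hD h hF hq t σ).1)
  have h1 : HasWirt (fun q => ofReal (symSurface σ F (expI t) q 1)) _ _ p :=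
    (hM.add hM.conj).neg.congr (hev.mono fun q hq => (ofReal_symSurface hD h hF hq t σ).2.1)
  have h2 : HasWirt (fun q => ofReal (symSurface σ F (expI t) q 2)) _ _ p :=
    (hT.const_mul I).neg.congr (hev.mono fun q hq => (ofReal_symSurface hD h hF hq t σ).2.2)
  obtain ⟨k0, k1, k2⟩ := leftDz_eq (h0.congr_deriv rfl (by
      simp only [star_mul, star_sub, star_star, star_I]; ring))
    (h1.congr_deriv rfl (by simp only [star_add, star_neg, star_star]; ring))
    (h2.congr_deriv rfl (by simp only [star_mul, star_neg, star_I]; ring))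
  obtain ⟨f0, f1, -⟩ := ofReal_symSurface hD h hF hp t σ
  fin_cases k
  · refine k0.trans ?_
    simp only [spinorVec, star_star, Fin.zero_eta, Matrix.cons_val_zero]
    ring
  · refine k1.trans ?_
    simp only [spinorVec, star_star, Fin.mk_one, Matrix.cons_val_one, Matrix.cons_val_zero]
    ring
  · refine k2.trans ?_
    have hσx : ofReal σ * x = -x := by
      rw [hx, ← mul_assoc, ← mul_assoc, ← ofReal_mul,
        show σ * (σ - 1) = -(σ - 1) by linear_combination hσ, ofReal_neg]
      ring
    have hσy : ofReal σ * y = y := by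
      rw [hy, ← mul_assoc, ← mul_assoc, ← mul_assoc, ← ofReal_mul,
        show σ * (σ + 1) = σ + 1 by linear_combination hσ]
    have e := third_component_eq (h.det t p hp) (h.tDeriv_det hD hp t) hσx hσy
    have e2 : (2 : ParaC) * ofReal (1 / 2) = 1 := by rw [two_mul]; ext <;> norm_num
    rw [f0, f1, smul_eq_ofReal_mul]
    have hM1 : star (symOff σ (frameFst F) (frameSnd F) (t, p)) =
        -(star (tDeriv (frameSnd F) (t, p)) * star (frameFst F (t, p)) -
          star (tDeriv (frameFst F) (t, p)) * star (frameSnd F (t, p))) +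
          ofReal σ * I * (star (frameFst F (t, p)) * star (frameSnd F (t, p))) := by
      simp only [symOff, star_sub, star_neg, star_mul, star_ofReal, star_I]; ring
    rw [hM1, symOff]
    simp only [spinorVec, star_star]
    simp only [Fin.reduceFinMk, Matrix.cons_val]
    generalize frameFst F (t, p) = α at *
    generalize frameSnd F (t, p) = β at *
    generalize tDeriv (frameFst F) (t, p) = α' at *
    generalize tDeriv (frameSnd F) (t, p) = β' at *
    generalize star α = a at *
    generalize star β = b at *
    generalize star α' = a' at *
    generalize star β' = b' at *
    generalize ofReal (1 / 2) = r at *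
    linear_combination e + I * ((-(b' * a - a' * b) + ofReal σ * I * (a * b)) *
      (x * α ^ 2 - y * β ^ 2) - (-(β' * α - α' * β) - ofReal σ * I * (α * β)) *
      (y * a ^ 2 - x * b ^ 2)) * e2

theorem contDiffOn_symSurface (hD : IsOpen D) (h : IsFrame D H κ B (frameFst F) (frameSnd F))
    (hF : IsExtendedFrame D ψ₁ ψ₂ F) (t σ : ℝ) : ContDiffOn ℝ ∞ (symSurface σ F (expI t)) D := by
  have hM := contDiffOn_slice (h.contDiffOn_symOff hD σ) t
  have hT := contDiffOn_slice (contDiffOn_tDeriv hD (h.contDiffOn_symDiag hD σ)) t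
  have key : ∀ (k : Fin 3) (u : ℝ × ℝ → ParaC), ContDiffOn ℝ ∞ u D →
      (∀ q ∈ D, ofReal (symSurface σ F (expI t) q k) = u q) →
      ContDiffOn ℝ ∞ (fun q => symSurface σ F (expI t) q k) D := fun k u hu he =>
    (reL.contDiff.comp_contDiffOn hu).congr fun q hq => by
      simp [← he q hq]
  rw [contDiffOn_pi]
  intro k
  fin_cases k
  · exact key 0 _ (contDiffOn_const.mul (hM.paraConj.sub hM))
      fun q hq => (ofReal_symSurface hD h hF hq t σ).1
  · exact key 1 _ (hM.add hM.paraConj).neg fun q hq => (ofReal_symSurface hD h hF hq t σ).2.1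
  · exact key 2 _ (contDiffOn_const.mul hT).neg
      fun q hq => (ofReal_symSurface hD h hF hq t σ).2.2

theorem suVec_symSurface (hD : IsOpen D) (h : IsFrame D H κ B (frameFst F) (frameSnd F))
    (hF : IsExtendedFrame D ψ₁ ψ₂ F) (hp : p ∈ D) (t σ : ℝ) :
    suVec (symSurface σ F (expI t) p) = symHat σ F (expI t) p := by
  have hT := h.star_tDeriv_symDiag hD hp t σ
  have := suVec_suCoord (a := -(ofReal (1 / 2) *
      tDeriv (symDiag σ (frameFst F) (frameSnd F)) (t, p)))
    (b := symOff σ (frameFst F) (frameSnd F) (t, p)) (by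
      rw [star_neg, star_mul, hT, star_ofReal]; ring)
  rw [neg_neg] at this
  rw [symSurface, symHat_eq hD h hF hp t σ, this]

theorem suVec_normalM (hF : IsExtendedFrame D ψ₁ ψ₂ F) (hp : p ∈ D) (t : ℝ) :
    suVec (suCoord (normalM F (expI t) p)) = normalM F (expI t) p := by
  have := suVec_suCoord (a := ofReal (1 / 2) * I * (frameFst F (t, p) *
      star (frameFst F (t, p)) + frameSnd F (t, p) * star (frameSnd F (t, p))))
    (b := -(I * (frameFst F (t, p) * frameSnd F (t, p)))) (by
      simp only [star_mul, star_add, star_star, star_I, star_ofReal]; ring)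
  have e : star (-(I * (frameFst F (t, p) * frameSnd F (t, p)))) =
      I * (star (frameFst F (t, p)) * star (frameSnd F (t, p))) := by
    simp only [star_mul, star_neg, star_I]; ring
  rw [e] at this
  rw [normalM_eq hF hp t, this]

end Sym

end ParaC
end

noncomputable section

/-! ### Minimality from the nonlinear Dirac equation; the half-turn -/

section Dirac

open ParaC NilT
open scoped QuadraticAlgebra

variable {f : ℝ × ℝ → Fin 3 → ℝ} {p : ℝ × ℝ}

theorem re_eq_of_add_star {z w : ParaC} (h : z + star z = w + star w) : z.re = w.re := by
  have := congrArg QuadraticAlgebra.re h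
  simp at this
  linarith

/-- Solutions of the nonlinear Dirac equation give timelike minimal surfaces. -/
theorem isTimelikeMinimalAt_of_dirac {c u v : ℝ × ℝ → ParaC} {c' u' v' l m : ParaC} {r : ℝ}
    (hf : ContDiffAt ℝ ∞ f p)
    (hφ : ∀ᶠ q in nhds p, ∀ k, leftDz f q k = c q * spinorVec (v q) (star (u q)) k)
    (hc : HasWirt c c' (2 * l * c p) p) (hu : HasWirt u u' (-(l * u p) + m * star (v p)) p)
    (hv : HasWirt v v' (-(l * v p) + m * star (u p)) p) (hcm : c p * m = I * ofReal r)
    (hr : c p * star (c p) * (u p * star (u p) - v p * star (v p)) = 2 * ofReal r)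
    (huv : QuadraticAlgebra.norm (star (u p)) - QuadraticAlgebra.norm (v p) ≠ 0)
    (himm : IsImmersedAt f p) : IsTimelikeMinimalAt f p := by
  have hp := hφ.self_of_nhds
  have hφ' : ∀ᶠ q in nhds p, ∀ k, leftDz f q k =
      (![fun q => c q * (I * (u q * u q + v q * v q)), fun q => c q * (u q * u q - v q * v q),
        fun q => c q * (2 * (v q * u q))] : Fin 3 → ℝ × ℝ → ParaC) k q := by
    filter_upwards [hφ] with q hq k
    rw [hq k]
    fin_cases k
    · simp [spinorVec, sq]
    · simp [spinorVec, sq]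
    · simp [spinorVec, mul_assoc]
  obtain ⟨h1, h2⟩ := (isImmersedAt_iff hp huv).1 himm
  obtain ⟨k1, k2, k3⟩ := firstForm_eq hp
  have eI := I_mul_I
  refine ⟨hf, himm, ?_, fun n _ => ?_⟩
  · rw [detFirst_eq hp]
    have : 4 * QuadraticAlgebra.norm (c p) * (QuadraticAlgebra.norm (v p) +
        QuadraticAlgebra.norm (star (u p))) ^ 2 ≠ 0 :=
      mul_ne_zero (mul_ne_zero four_ne_zero h1) (pow_ne_zero 2 h2)
    have := sq_pos_of_ne_zero this
    linarith
  -- In the `z̄`-derivatives of `cu²`, `cv²`, `cuv` the `l`-terms cancel, as `c` has weight `2l` and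
  -- `u, v` have weight `-l`. What is left contains only `cm = i'r`.
  · refine meanCurvature_eq_zero (e := ![2 * ofReal r *
        (u p * star (v p) + v p * star (u p)), 2 * (I * ofReal r) * (u p * star (v p) -
        v p * star (u p)), 2 * (I * ofReal r) * (u p * star (u p) + v p * star (v p))])
      hf hφ' (fun k => ?_) ?_ ?_ ?_ (by rw [k2, k1]) k3 n
    · fin_cases k
      · refine ⟨_, (hc.mul (((hu.mul hu).add (hv.mul hv)).const_mul I)).congr_deriv rfl ?_⟩
        simp only [Fin.zero_eta, Matrix.cons_val_zero]
        linear_combination 2 * I * (u p * star (v p) + v p * star (u p)) * hcm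
          + 2 * ofReal r * (u p * star (v p) + v p * star (u p)) * eI
      · refine ⟨_, (hc.mul ((hu.mul hu).sub (hv.mul hv))).congr_deriv rfl ?_⟩
        simp only [Fin.mk_one, Matrix.cons_val_one, Matrix.cons_val_zero]
        linear_combination 2 * (u p * star (v p) - v p * star (u p)) * hcm
      · refine ⟨_, (hc.mul ((hv.mul hu).const_mul 2)).congr_deriv rfl ?_⟩
        simp only [Fin.reduceFinMk, Matrix.cons_val]
        linear_combination 2 * (u p * star (u p) + v p * star (v p)) * hcm
    -- Adding conjugates to `φ₂ φ̄₁` produces the factor `cc̄(uū - vv̄)`, which `hr` replaces by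
    -- `2r`; the next component is similar. In the last one a real quantity times `i'` has no real
    -- part.
    · apply re_eq_of_add_star
      simp only [Matrix.cons_val, star_mul, star_add, star_sub, star_star, star_ofReal,
        star_ofNat]
      linear_combination (-2) * (u p * star (v p) + v p * star (u p)) * hr
    · apply re_eq_of_add_star
      simp only [Matrix.cons_val, star_mul, star_add, star_sub, star_star, star_ofReal,
        star_ofNat, star_I, star_neg]
      linear_combination (-2) * I * (u p * star (v p) - v p * star (u p)) * hr
    · apply re_eq_of_add_star (w := 0)
      simp only [Matrix.cons_val, star_mul, star_add, star_star, star_ofReal,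
        star_ofNat, star_I, star_zero]
      ring

theorem leftDz_halfTurn (hf : DifferentiableAt ℝ f p) :
    leftDz (fun q => halfTurn (f q)) p = ![-leftDz f p 0, -leftDz f p 1, leftDz f p 2] := by
  have hfk : ∀ k, HasFDerivAt (fun q => f q k)
      ((ContinuousLinearMap.proj k).comp (fderiv ℝ f p)) p :=
    fun k => (hasFDerivAt_pi'.1 hf.hasFDerivAt) k
  have h : HasFDerivAt (fun q => halfTurn (f q)) (ContinuousLinearMap.pi
      ![-((ContinuousLinearMap.proj 0).comp (fderiv ℝ f p)),
        -((ContinuousLinearMap.proj 1).comp (fderiv ℝ f p)),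
        (ContinuousLinearMap.proj 2).comp (fderiv ℝ f p)]) p := by
    rw [hasFDerivAt_pi']
    intro k
    fin_cases k
    · exact (hfk 0).neg
    · exact (hfk 1).neg
    · exact hfk 2
  funext k
  fin_cases k <;> ext <;> simp only [leftDz, leftTranslate, contact, h.fderiv] <;>
    simp [halfTurn] <;> ring

end Dirac

namespace ParaC

open scoped QuadraticAlgebra

/-! ### Holomorphy of the Abresch-Rosenberg differential -/

section Frame

variable {D : Set (ℝ × ℝ)} {H : ℝ × ℝ → ℝ} {κ B : ℝ × ℝ → ParaC} {α β : ℝ × (ℝ × ℝ) → ParaC}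
  {p : ℝ × ℝ}

theorem IsFrame.H_mul_inv (h : IsFrame D H κ B α β) (hp : p ∈ D) :
    ofReal (H p) * ofReal (H p)⁻¹ = 1 := by
  rw [← ofReal_mul, mul_inv_cancel₀ (h.pos p hp).ne', ofReal_one]

theorem IsFrame.wirt_inv (h : IsFrame D H κ B α β) (hp : p ∈ D) :
    HasWirt (fun q => ofReal (H q)⁻¹) (-(2 * ofReal (H p)⁻¹ * κ p))
      (-(2 * ofReal (H p)⁻¹ * star (κ p))) p := by
  have e := h.H_mul_inv hp
  have e' : ofReal (-(H p ^ 2)⁻¹) = -(ofReal (H p)⁻¹ * ofReal (H p)⁻¹) := by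
    rw [ofReal_neg, ← ofReal_mul]; congr 2; rw [sq, mul_inv]
  refine ((h.wirt_H p hp).comp_ofReal (hasDerivAt_inv (h.pos p hp).ne')).congr_deriv ?_ ?_
  · rw [e']; linear_combination (-2) * ofReal (H p)⁻¹ * κ p * e
  · rw [e']; linear_combination (-2) * ofReal (H p)⁻¹ * star (κ p) * e

/-- The Abresch-Rosenberg differential of a minimal surface is holomorphic. -/
theorem IsFrame.wirt_B (h : IsFrame D H κ B α β) (hD : IsOpen D) (hp : p ∈ D) :
    HasWirt B (dz B p) 0 p := by
  have hev : ∀ᶠ q in nhds p, q ∈ D := hD.mem_nhds hp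
  have hB := hasWirt ((h.smooth_B.contDiffAt (hD.mem_nhds hp)).differentiableAt (by simp))
  have hκ := hasWirt ((h.smooth_κ.contDiffAt (hD.mem_nhds hp)).differentiableAt (by simp))
  have hH := h.wirt_H p hp
  have hR := h.wirt_inv hp
  have ha := h.wirt_fst 0 p hp
  have hb := h.wirt_snd 0 p hp
  have e := I_mul_I
  have eH := h.H_mul_inv hp
  have hHs : ContDiffAt ℝ ∞ (fun q => ofReal (H q)) p :=
    ofRealL.contDiff.contDiffAt.comp p (h.smooth_H.contDiffAt (hD.mem_nhds hp))
  -- Commuting derivatives of the real function `H` show that `κ_z̄`, a multiple of `w_{zz̄}`, is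
  -- real.
  have hsym := dzbar_dz_eq hHs (hev.mono fun q hq => h.wirt_H q hq)
    ((hH.const_mul 2).mul hκ) ((hH.const_mul 2).mul hκ.conj)
  have hκr : dzbar κ p = star (dzbar κ p) := by
    have : (2 : ParaC) * dzbar κ p = 2 * star (dzbar κ p) := by
      linear_combination ofReal (H p)⁻¹ * hsym - 2 * (dzbar κ p - star (dzbar κ p)) * eH
    have h2 : ∀ x : ParaC, x = (1 / 2 : ℝ) • (2 * x) := fun x => by
      rw [two_mul]; ext <;> simp <;> ring
    calc dzbar κ p = (1 / 2 : ℝ) • (2 * dzbar κ p) := h2 _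
      _ = star (dzbar κ p) := by rw [this, ← h2]
  have hμ := expI_mul_star 0
  have c1 := dzbar_dz_eq (contDiffAt_family (t := 0) hD h.smooth_fst hp |>.comp p
      (contDiff_const.prodMk contDiff_id).contDiffAt) (hev.mono fun q hq => h.wirt_fst 0 q hq)
    ((ha.mul hκ).add (hb.mul ((((hB.const_mul (star (expI 0))).mul hR)).mul (hasWirt_const I p))))
    ((ha.mul hκ.conj).neg.add (hb.mul ((hH.const_mul (expI 0)).mul (hasWirt_const I p))))
  have c2 := dzbar_dz_eq (contDiffAt_family (t := 0) hD h.smooth_snd hp |>.comp p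
      (contDiff_const.prodMk contDiff_id).contDiffAt) (hev.mono fun q hq => h.wirt_snd 0 q hq)
    ((ha.mul ((hH.const_mul (star (expI 0))).mul (hasWirt_const I p))).neg.sub (hb.mul hκ))
    ((ha.mul (((hB.conj.const_mul (expI 0)).mul hR).mul (hasWirt_const I p))).neg.add
      (hb.mul hκ.conj))
  have hdet := h.det 0 p hp
  have c2' := congrArg star c2
  simp only [star_add, star_sub, star_mul, star_neg, star_star, star_I, star_ofReal, star_zero,
    star_ofNat] at c1 c2'
  rw [← hκr] at c1 c2'
  refine hB.congr_deriv rfl ?_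
  generalize hα : α (0, p) = a at *
  generalize hβ : β (0, p) = b at *
  generalize star a = a' at *
  generalize star b = b' at *
  generalize expI 0 = μ at *
  generalize star μ = μ' at *
  generalize ofReal (H p) = E at *
  generalize ofReal (H p)⁻¹ = R at *
  generalize dzbar κ p = k at *
  generalize dz κ p = k₁ at *
  generalize star (κ p) = κ' at *
  generalize κ p = κ₀ at *
  generalize star (B p) = B' at *
  generalize B p = B₀ at *
  generalize dzbar B p = Bz at *
  -- `c1` and `c2'` are the compatibility conditions for the first column of `F`. Pairing them with
  -- the second row `(-β̄, α)` of `F⁻¹` isolates the lower left entry of the zero curvature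
  -- equation, where only `B_z̄` survives. Its coefficient is a unit.
  have hQ : μ' * I * Bz * R = 0 := by
    linear_combination (-a) * c2' - b' * c1 - (μ' * I * Bz * R) * hdet
  linear_combination μ * I * E * hQ - Bz * I * I * E * R * hμ - Bz * E * R * e - Bz * eH

end Frame

end ParaC
end

noncomputable section

namespace ParaC

open scoped QuadraticAlgebra
open NilT

/-! ## The surfaces of the Sym formula -/

section Sym

variable {D : Set (ℝ × ℝ)} {ψ₁ ψ₂ : ℝ × ℝ → ParaC} {F : ParaC → ℝ × ℝ → Mat2} {p : ℝ × ℝ}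
  {H : ℝ × ℝ → ℝ} {κ B : ℝ × ℝ → ParaC}

theorem ofReal_two : ofReal 2 = 2 := by ext <;> simp

theorem ofReal_injective : Function.Injective ofReal := fun _ _ h =>
  congrArg QuadraticAlgebra.re h

theorem norm_eq_iff {z : ParaC} {r : ℝ} : QuadraticAlgebra.norm z = r ↔ z * star z = ofReal r := by
  rw [mul_star_eq_norm]; exact ofReal_injective.eq_iff.symm

theorem leftDz_symSurface_neg (hD : IsOpen D) (h : IsFrame D H κ B (frameFst F) (frameSnd F))
    (hF : IsExtendedFrame D ψ₁ ψ₂ F) (hp : p ∈ D) (t : ℝ) (k : Fin 3) :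
    leftDz (symSurface (-1) F (expI t)) p k = 2 * star (expI t) * ofReal (H p) *
      spinorVec (star (frameSnd F (t, p))) (star (frameFst F (t, p))) k := by
  rw [leftDz_symSurface hD h hF hp t (by norm_num)]
  have e0 : ofReal (1 + -1) = 0 := by ext <;> simp
  have e2 : ofReal (1 - -1) = 2 := by rw [sub_neg_eq_add, one_add_one_eq_two, ofReal_two]
  rw [e0, e2]; ring

theorem leftDz_symSurface_pos (hD : IsOpen D) (h : IsFrame D H κ B (frameFst F) (frameSnd F))
    (hF : IsExtendedFrame D ψ₁ ψ₂ F) (hp : p ∈ D) (t : ℝ) (k : Fin 3) :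
    leftDz (symSurface 1 F (expI t)) p k = 2 * star (expI t) * B p * ofReal (H p)⁻¹ *
      spinorVec (star (frameFst F (t, p))) (star (frameSnd F (t, p))) k := by
  rw [leftDz_symSurface hD h hF hp t (by norm_num)]
  have e0 : ofReal (1 - 1) = 0 := by ext <;> simp
  have e2 : ofReal (1 + 1) = 2 := by rw [one_add_one_eq_two, ofReal_two]
  rw [e0, e2]; ring

theorem norm_frame (h : IsFrame D H κ B (frameFst F) (frameSnd F)) (hp : p ∈ D) (t : ℝ) :
    QuadraticAlgebra.norm (frameFst F (t, p)) - QuadraticAlgebra.norm (frameSnd F (t, p)) = 1 := by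
  have := h.det t p hp
  rw [mul_star_eq_norm, mul_star_eq_norm, ← ofReal_sub, ← ofReal_one] at this
  exact ofReal_injective this

theorem suCoord_normalM (hF : IsExtendedFrame D ψ₁ ψ₂ F) (hp : p ∈ D) (t : ℝ) :
    ofReal (suCoord (normalM F (expI t) p) 0) = frameFst F (t, p) * frameSnd F (t, p) +
      star (frameFst F (t, p)) * star (frameSnd F (t, p)) ∧
    ofReal (suCoord (normalM F (expI t) p) 1) = I * (frameFst F (t, p) * frameSnd F (t, p) -
      star (frameFst F (t, p)) * star (frameSnd F (t, p))) ∧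
    suCoord (normalM F (expI t) p) 2 = QuadraticAlgebra.norm (frameSnd F (t, p)) +
      QuadraticAlgebra.norm (frameFst F (t, p)) := by
  rw [normalM_eq hF hp t]
  refine ⟨?_, ?_, ?_⟩
  · ext <;> simp [suCoord] <;> ring
  · ext
    · simp [suCoord]; ring
    · simp [suCoord]
  · simp [suCoord, QuadraticAlgebra.norm_def]; ring

theorem lieInner_normalM (h : IsFrame D H κ B (frameFst F) (frameSnd F))
    (hF : IsExtendedFrame D ψ₁ ψ₂ F) (hp : p ∈ D) (t : ℝ) :
    lieInner (suCoord (normalM F (expI t) p)) (suCoord (normalM F (expI t) p)) = 1 := by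
  obtain ⟨h0, h1, h2⟩ := suCoord_normalM hF hp t
  have h2' := congrArg ofReal h2
  rw [ofReal_add, ← mul_star_eq_norm, ← mul_star_eq_norm] at h2'
  have hd := h.det t p hp
  have e := I_mul_I
  apply ofReal_injective
  simp only [lieInner, ofReal_add, ofReal_neg, ofReal_mul, h0, h1, h2', ofReal_one]
  linear_combination (frameFst F (t, p) * star (frameFst F (t, p)) - frameSnd F (t, p) *
    star (frameSnd F (t, p)) + 1) * hd + (frameFst F (t, p) * frameSnd F (t, p) -
      star (frameFst F (t, p)) * star (frameSnd F (t, p))) ^ 2 * e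

theorem norm_expI (t : ℝ) : QuadraticAlgebra.norm (expI t) = 1 := by
  rw [norm_eq_iff, expI_mul_star, ofReal_one]

theorem norm_two : QuadraticAlgebra.norm (2 : ParaC) = 4 := by
  rw [← ofReal_two, QuadraticAlgebra.norm_def]; norm_num

theorem norm_ofReal (r : ℝ) : QuadraticAlgebra.norm (ofReal r) = r * r := by
  simp [QuadraticAlgebra.norm_def]

/-- The third coordinate of `N_m` is `αᾱ + ββ̄`, the spinor factor in `isImmersedAt_iff`; `αᾱ - ββ̄
= 1` provides the nonvanishing difference required there. -/
theorem isImmersedAt_symSurface_neg (hD : IsOpen D)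
    (h : IsFrame D H κ B (frameFst F) (frameSnd F)) (hF : IsExtendedFrame D ψ₁ ψ₂ F) (hp : p ∈ D)
    (t : ℝ) : IsImmersedAt (symSurface (-1) F (expI t)) p ↔
      suCoord (normalM F (expI t) p) 2 ≠ 0 := by
  have hn := norm_frame h hp t
  rw [isImmersedAt_iff (leftDz_symSurface_neg hD h hF hp t)
    (by simp only [QuadraticAlgebra.norm_star]; rw [hn]; norm_num), (suCoord_normalM hF hp t).2.2]
  simp only [QuadraticAlgebra.norm_star, map_mul, norm_expI, norm_two, norm_ofReal]
  have := (h.pos p hp).ne'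
  simp [this]

theorem isImmersedAt_symSurface_pos (hD : IsOpen D)
    (h : IsFrame D H κ B (frameFst F) (frameSnd F)) (hF : IsExtendedFrame D ψ₁ ψ₂ F) (hp : p ∈ D)
    (t : ℝ) : IsImmersedAt (symSurface 1 F (expI t)) p ↔
      suCoord (normalM F (expI t) p) 2 ≠ 0 ∧ QuadraticAlgebra.norm (B p) ≠ 0 := by
  have hn := norm_frame h hp t
  rw [isImmersedAt_iff (leftDz_symSurface_pos hD h hF hp t)
    (by simp only [QuadraticAlgebra.norm_star]; intro h0; linarith), (suCoord_normalM hF hp t).2.2]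
  simp only [QuadraticAlgebra.norm_star, map_mul, norm_expI, norm_two, norm_ofReal]
  have := (h.pos p hp).ne'
  rw [and_comm, add_comm (QuadraticAlgebra.norm (frameFst F (t, p)))]
  simp [this]

theorem isTimelikeMinimalAt_symSurface_neg (hD : IsOpen D)
    (h : IsFrame D H κ B (frameFst F) (frameSnd F)) (hF : IsExtendedFrame D ψ₁ ψ₂ F) (hp : p ∈ D)
    (t : ℝ) (himm : IsImmersedAt (symSurface (-1) F (expI t)) p) :
    IsTimelikeMinimalAt (symSurface (-1) F (expI t)) p := by
  have ha := h.wirt_fst t p hp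
  have hb := h.wirt_snd t p hp
  have hμ := expI_mul_star t
  have hd := h.det t p hp
  refine isTimelikeMinimalAt_of_dirac (c := fun q => 2 * star (expI t) * ofReal (H q))
    (u := fun q => frameFst F (t, q)) (v := fun q => star (frameSnd F (t, q)))
    (l := star (κ p)) (m := expI t * ofReal (H p) * I) (r := 2 * H p ^ 2)
    ((contDiffOn_symSurface hD h hF t (-1)).contDiffAt (hD.mem_nhds hp)) ?_
    (((h.wirt_H p hp).const_mul _).congr_deriv rfl ?_) (ha.congr_deriv rfl ?_)
    (hb.conj.congr_deriv rfl ?_) ?_ ?_ ?_ himm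
  · filter_upwards [hD.mem_nhds hp] with q hq k
    exact leftDz_symSurface_neg hD h hF hq t k
  · ring
  · rw [star_star]; ring
  · simp only [star_sub, star_neg, star_mul, star_star, star_I, star_ofReal]; ring
  · rw [ofReal_mul, ofReal_two, sq, ofReal_mul]
    linear_combination 2 * ofReal (H p) ^ 2 * I * hμ
  · simp only [star_mul, star_star, star_ofReal, star_ofNat]
    rw [ofReal_mul, ofReal_two, sq, ofReal_mul]
    linear_combination 4 * ofReal (H p) ^ 2 * (frameFst F (t, p) * star (frameFst F (t, p)) -
      frameSnd F (t, p) * star (frameSnd F (t, p))) * hμ + 4 * ofReal (H p) ^ 2 * hd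
  · simp only [QuadraticAlgebra.norm_star]
    rw [norm_frame h hp t]; norm_num

/-- Compared with `f_-`, the functions `α` and `β` exchange roles and `κ̄` changes sign. The weight
condition on `c = 2μ⁻¹BH⁻¹` is where the holomorphy of `B` is needed. -/
theorem isTimelikeMinimalAt_symSurface_pos (hD : IsOpen D)
    (h : IsFrame D H κ B (frameFst F) (frameSnd F)) (hF : IsExtendedFrame D ψ₁ ψ₂ F) (hp : p ∈ D)
    (t : ℝ) (himm : IsImmersedAt (symSurface 1 F (expI t)) p) :
    IsTimelikeMinimalAt (symSurface 1 F (expI t)) p := by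
  have ha := h.wirt_fst t p hp
  have hb := h.wirt_snd t p hp
  have hμ := expI_mul_star t
  have hd := h.det t p hp
  have hB := mul_star_eq_norm (B p)
  refine isTimelikeMinimalAt_of_dirac (c := fun q => 2 * star (expI t) * B q * ofReal (H q)⁻¹)
    (u := fun q => frameSnd F (t, q)) (v := fun q => star (frameFst F (t, q)))
    (l := -star (κ p)) (m := -(expI t * star (B p) * ofReal (H p)⁻¹ * I))
    (r := -(2 * (QuadraticAlgebra.norm (B p) * ((H p)⁻¹ * (H p)⁻¹))))
    ((contDiffOn_symSurface hD h hF t 1).contDiffAt (hD.mem_nhds hp)) ?_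
    ((((h.wirt_B hD hp).const_mul _).mul (h.wirt_inv hp)).congr_deriv rfl ?_)
    (hb.congr_deriv rfl ?_) (ha.conj.congr_deriv rfl ?_) ?_ ?_ ?_ himm
  · filter_upwards [hD.mem_nhds hp] with q hq k
    exact leftDz_symSurface_pos hD h hF hq t k
  · ring
  · rw [star_star]; ring
  · simp only [star_add, star_mul, star_star, star_I, star_ofReal]; ring
  · rw [ofReal_neg, ofReal_mul, ofReal_two, ofReal_mul, ofReal_mul, ← hB]
    linear_combination (-2) * B p * star (B p) * ofReal (H p)⁻¹ ^ 2 * I * hμ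
  · simp only [star_mul, star_star, star_ofReal, star_ofNat]
    rw [ofReal_neg, ofReal_mul, ofReal_two, ofReal_mul, ofReal_mul, ← hB]
    linear_combination 4 * B p * star (B p) * ofReal (H p)⁻¹ ^ 2 * (frameSnd F (t, p) *
      star (frameSnd F (t, p)) - frameFst F (t, p) * star (frameFst F (t, p))) * hμ
      - 4 * B p * star (B p) * ofReal (H p)⁻¹ ^ 2 * hd
  · simp only [QuadraticAlgebra.norm_star]
    have := norm_frame h hp t
    intro h0; linarith

theorem isNormalGaussMapAt_symSurface_neg (hD : IsOpen D)
    (h : IsFrame D H κ B (frameFst F) (frameSnd F)) (hF : IsExtendedFrame D ψ₁ ψ₂ F) (hp : p ∈ D)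
    (t : ℝ) (hn : suCoord (normalM F (expI t) p) 2 ≠ 0) :
    IsNormalGaussMapAt (symSurface (-1) F (expI t)) (suCoord (normalM F (expI t) p)) p := by
  have hd := h.det t p hp
  have e := I_mul_I
  obtain ⟨h0, h1, -⟩ := suCoord_normalM hF hp t
  refine isNormalGaussMapAt_of_perp (lieInner_normalM h hF hp t) hn ?_
  simp only [leftDz_symSurface_neg hD h hF hp t, h0, h1, spinorVec, star_star, Matrix.cons_val]
  generalize 2 * star (expI t) * ofReal (H p) = χ
  linear_combination χ * (2 * frameFst F (t, p) * star (frameSnd F (t, p))) * hd -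
    χ * ((frameFst F (t, p) * frameSnd F (t, p) - star (frameFst F (t, p)) *
      star (frameSnd F (t, p))) * (frameFst F (t, p) ^ 2 + star (frameSnd F (t, p)) ^ 2)) * e

/-- The first two coordinates of `N_m` are symmetric in `α, β`, but exchanging them turns `αᾱ - ββ̄`
into `-1`. Orthogonality thus holds up to a sign in the third component, which the half-turn
repairs. -/
theorem isNormalGaussMapAt_symSurface_pos (hD : IsOpen D)
    (h : IsFrame D H κ B (frameFst F) (frameSnd F)) (hF : IsExtendedFrame D ψ₁ ψ₂ F) (hp : p ∈ D)
    (t : ℝ) (hn : suCoord (normalM F (expI t) p) 2 ≠ 0) :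
    IsNormalGaussMapAt (fun q => halfTurn (symSurface 1 F (expI t) q))
      (suCoord (normalM F (expI t) p)) p := by
  have hd := h.det t p hp
  have e := I_mul_I
  obtain ⟨h0, h1, -⟩ := suCoord_normalM hF hp t
  refine isNormalGaussMapAt_of_perp (lieInner_normalM h hF hp t) hn ?_
  rw [leftDz_halfTurn (((contDiffOn_symSurface hD h hF t 1).contDiffAt
    (hD.mem_nhds hp)).differentiableAt (by simp))]
  simp only [leftDz_symSurface_pos hD h hF hp t, h0, h1, spinorVec, star_star, Matrix.cons_val]
  generalize 2 * star (expI t) * B p * ofReal (H p)⁻¹ = χ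
  linear_combination χ * (2 * frameSnd F (t, p) * star (frameFst F (t, p))) * hd +
    χ * ((frameFst F (t, p) * frameSnd F (t, p) - star (frameFst F (t, p)) *
      star (frameSnd F (t, p))) * (frameSnd F (t, p) ^ 2 + star (frameFst F (t, p)) ^ 2)) * e

end Sym

end ParaC
end

noncomputable section

/-! ### Uniqueness up to left translation -/

section Translation

open ParaC NilT

/-- Maps with the same Maurer-Cartan form differ by a left translation. -/
theorem exists_leftTranslation {f g : ℝ × ℝ → Fin 3 → ℝ} {D : Set (ℝ × ℝ)} (hD : IsOpen D)
    (hDc : IsPreconnected D) (hf : ∀ p ∈ D, DifferentiableAt ℝ f p)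
    (hg : ∀ p ∈ D, DifferentiableAt ℝ g p) (h : ∀ p ∈ D, ∀ k, leftDz g p k = leftDz f p k) :
    ∃ a : Fin 3 → ℝ, ∀ p ∈ D, g p = mul a (f p) := by
  have hk : ∀ (u : ℝ × ℝ → Fin 3 → ℝ) (p : ℝ × ℝ), DifferentiableAt ℝ u p → ∀ k,
      HasFDerivAt (fun q => u q k) ((ContinuousLinearMap.proj k).comp (fderiv ℝ u p)) p :=
    fun u p hu k => (hasFDerivAt_pi'.1 hu.hasFDerivAt) k
  have hLT : ∀ p ∈ D, ∀ v k, leftTranslate (g p) (fderiv ℝ g p v) k =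
      leftTranslate (f p) (fderiv ℝ f p v) k := fun p hp v k => by
    rw [leftTranslate_fderiv, leftTranslate_fderiv, h p hp k]
  have h0 : ∀ p ∈ D, ∀ v, fderiv ℝ g p v 0 = fderiv ℝ f p v 0 := fun p hp v => hLT p hp v 0
  have h1 : ∀ p ∈ D, ∀ v, fderiv ℝ g p v 1 = fderiv ℝ f p v 1 := fun p hp v => hLT p hp v 1
  have h2 : ∀ p ∈ D, ∀ v, contact (g p) (fderiv ℝ g p v) = contact (f p) (fderiv ℝ f p v) :=
    fun p hp v => hLT p hp v 2
  have key : ∀ u : ℝ × ℝ → ℝ, (∀ p ∈ D, HasFDerivAt u (0 : ℝ × ℝ →L[ℝ] ℝ) p) →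
      ∃ c, ∀ p ∈ D, u p = c :=
    fun u hu => hD.exists_is_const_of_fderiv_eq_zero hDc
      (fun p hp => (hu p hp).differentiableAt.differentiableWithinAt) fun p hp => (hu p hp).fderiv
  obtain ⟨c₀, hc₀⟩ := key (fun q => g q 0 - f q 0) fun p hp => by
    refine ((hk g p (hg p hp) 0).sub (hk f p (hf p hp) 0)).congr_fderiv ?_
    ext <;> simp [h0 p hp]
  obtain ⟨c₁, hc₁⟩ := key (fun q => g q 1 - f q 1) fun p hp => by
    refine ((hk g p (hg p hp) 1).sub (hk f p (hf p hp) 1)).congr_fderiv ?_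
    ext <;> simp [h1 p hp]
  -- The third component of the unknown translation `g f⁻¹`, with the constants `c₀, c₁` already
  -- inserted into the group law.
  obtain ⟨c₂, hc₂⟩ := key (fun q => g q 2 - f q 2 + (1 / 2 : ℝ) * (c₁ * f q 0 - c₀ * f q 1))
    fun p hp => by
      refine (((hk g p (hg p hp) 2).sub (hk f p (hf p hp) 2)).add
        ((((hk f p (hf p hp) 0).const_mul c₁).sub
          ((hk f p (hf p hp) 1).const_mul c₀)).const_mul (1 / 2 : ℝ))).congr_fderiv ?_
      refine ContinuousLinearMap.ext fun v => ?_
      have e := h2 p hp v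
      simp only [contact, h0 p hp, h1 p hp] at e
      have e0 := hc₀ p hp
      have e1 := hc₁ p hp
      simp
      linear_combination e - (1 / 2) * fderiv ℝ f p v 0 * e1 + (1 / 2) * fderiv ℝ f p v 1 * e0
  refine ⟨![c₀, c₁, c₂], fun p hp => ?_⟩
  have e0 := hc₀ p hp
  have e1 := hc₁ p hp
  have e2 := hc₂ p hp
  ext k
  fin_cases k
  · simp [mul]; linarith
  · simp [mul]; linarith
  · simp [mul]; linarith

end Translation

namespace ParaC

open scoped QuadraticAlgebra

/-! ### Square roots up to a unit -/

section Roots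

theorem exists_sign {u : ℝ × ℝ → ℝ} {Ω : Set (ℝ × ℝ)} (hΩ : IsPreconnected Ω)
    (hu : ContinuousOn u Ω) (h0 : ∀ p ∈ Ω, u p ≠ 0) :
    ∃ e : ℝ, (e = 1 ∨ e = -1) ∧ ∀ p ∈ Ω, 0 < e * u p := by
  by_cases h : ∃ p ∈ Ω, u p < 0
  · obtain ⟨p, hp, hlt⟩ := h
    refine ⟨-1, Or.inr rfl, fun q hq => ?_⟩
    by_contra hcon
    obtain ⟨r, hr, hr0⟩ := hΩ.intermediate_value hp hq hu ⟨hlt.le, (by linarith : 0 ≤ u q)⟩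
    exact h0 r hr hr0
  · push Not at h
    exact ⟨1, Or.inl rfl, fun q hq => by
      rw [one_mul]; exact lt_of_le_of_ne (h q hq) (h0 q hq).symm⟩

theorem fourUnits_mul_self {ε : ParaC} (h : ε ∈ fourUnits) : ε * ε = 1 := by
  have e := I_mul_I
  rcases h with rfl | rfl | rfl | rfl
  · ring
  · ring
  · exact e
  · linear_combination e

theorem one_mem_fourUnits : (1 : ParaC) ∈ fourUnits := Or.inl rfl

/-- A function without zeros of its norm has a smooth square root up to one of the four units. -/
theorem exists_root {B : ℝ × ℝ → ParaC} {Ω : Set (ℝ × ℝ)} (hΩ : IsPreconnected Ω)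
    (hB : ContDiffOn ℝ ∞ B Ω) (h0 : ∀ p ∈ Ω, QuadraticAlgebra.norm (B p) ≠ 0) :
    ∃ ε ∈ fourUnits, ∃ s : ℝ × ℝ → ParaC, ContDiffOn ℝ ∞ s Ω ∧ ∀ p ∈ Ω, s p ^ 2 = ε * B p := by
  have hre : ContDiffOn ℝ ∞ (fun p => (B p).re) Ω := reL.contDiff.comp_contDiffOn hB
  have him : ContDiffOn ℝ ∞ (fun p => (B p).im) Ω := imL.contDiff.comp_contDiffOn hB
  have hne : ∀ p ∈ Ω, (B p).re + (B p).im ≠ 0 ∧ (B p).re - (B p).im ≠ 0 := fun p hp => by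
    have := h0 p hp
    rw [QuadraticAlgebra.norm_def] at this
    constructor
    · intro h; apply this; linear_combination ((B p).re - (B p).im) * h
    · intro h; apply this; linear_combination ((B p).re + (B p).im) * h
  obtain ⟨e, he, hpos⟩ := exists_sign hΩ (hre.add him).continuousOn fun p hp => (hne p hp).1
  obtain ⟨e', he', hpos'⟩ := exists_sign hΩ (hre.sub him).continuousOn fun p hp => (hne p hp).2
  have hs : ContDiffOn ℝ ∞ (fun p => Real.sqrt (e * ((B p).re + (B p).im))) Ω :=
    (contDiffOn_const.mul (hre.add him)).sqrt fun p hp => (hpos p hp).ne'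
  have hs' : ContDiffOn ℝ ∞ (fun p => Real.sqrt (e' * ((B p).re - (B p).im))) Ω :=
    (contDiffOn_const.mul (hre.sub him)).sqrt fun p hp => (hpos' p hp).ne'
  -- Under `split` the components `re ± im` of `B` are nonzero, because their product is `BB̄`, and
  -- have constant signs `e`, `e'`. Here `ε` has components `(e, e')`, so the four units realize the
  -- four sign patterns, and `s` consists of the roots of `|re ± im|`.
  refine ⟨⟨(e + e') / 2, (e - e') / 2⟩, ?_, fun p =>
    ⟨(Real.sqrt (e * ((B p).re + (B p).im)) + Real.sqrt (e' * ((B p).re - (B p).im))) / 2,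
      (Real.sqrt (e * ((B p).re + (B p).im)) - Real.sqrt (e' * ((B p).re - (B p).im))) / 2⟩,
    smoothOn_iff.1 ⟨(hs.add hs').div_const 2, (hs.sub hs').div_const 2⟩, fun p hp => ?_⟩
  · rcases he with rfl | rfl <;> rcases he' with rfl | rfl
    · exact Or.inl (by ext <;> norm_num)
    · exact Or.inr (Or.inr (Or.inl (by ext <;> norm_num)))
    · exact Or.inr (Or.inr (Or.inr (by ext <;> norm_num)))
    · exact Or.inr (Or.inl (by ext <;> norm_num))
  · have k := Real.mul_self_sqrt (hpos p hp).le
    have k' := Real.mul_self_sqrt (hpos' p hp).le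
    rw [sq]
    ext
    · simp; linear_combination (1 / 2) * k + (1 / 2) * k'
    · simp; linear_combination (1 / 2) * k - (1 / 2) * k'

end Roots

end ParaC
end

noncomputable section

namespace ParaC

open scoped QuadraticAlgebra

/-! ## Duality -/

/-- The Abresch-Rosenberg coefficient in terms of the Wirtinger derivatives of spinors of the form
`(T u, T̄ v̄)`. -/
theorem abreschRosenberg_eq {δ : ParaC} {χ₁ χ₂ T u v : ℝ × ℝ → ParaC}
    {T' T'' u' u'' v' v'' : ParaC} {p : ℝ × ℝ} (hT : HasWirt T T' T'' p)
    (hu : HasWirt u u' u'' p) (hv : HasWirt v v' v'' p)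
    (h1 : χ₁ =ᶠ[nhds p] fun q => T q * u q)
    (h2 : (fun q => star (χ₂ q)) =ᶠ[nhds p] fun q => T q * v q) :
    abreschRosenberg δ χ₁ χ₂ p =
      δ * (-(ofReal (1 / 2) * I) * (T p ^ 2 * (u p * v' - v p * u'))) := by
  have e1 := ((hT.mul hu).congr h1).dz_eq
  have e2 := ((hT.mul hv).congr h2).dz_eq
  have k2 : star (χ₂ p) = T p * v p := h2.self_of_nhds
  -- The coefficient is a Wronskian of `χ₁` and `χ̄₂`, so the derivative of the common factor `T`
  -- drops out.
  rw [abreschRosenberg, e1, e2, h1.self_of_nhds, k2, smul_eq_ofReal_mul]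
  ring

theorem norm_of_mem_fourUnits {ε : ParaC} (h : ε ∈ fourUnits) : QuadraticAlgebra.norm ε ≠ 0 := by
  intro h0
  have := congrArg QuadraticAlgebra.norm (fourUnits_mul_self h)
  rw [map_mul, h0] at this
  simp at this

section Sym

variable {D Ω : Set (ℝ × ℝ)} {ψ₁ ψ₂ : ℝ × ℝ → ParaC} {F : ParaC → ℝ × ℝ → Mat2} {p : ℝ × ℝ}
  {H : ℝ × ℝ → ℝ} {κ B : ℝ × ℝ → ParaC} {P₁ P₂ s : ℝ × ℝ → ParaC} {l ε : ParaC} {t : ℝ}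

/-- `(P₁, P₂) = (λ √(2H) β̄, λ̄ √(2H) ᾱ)` with `λ² = μ⁻¹`. -/
structure IsFrameSpinors (D : Set (ℝ × ℝ)) (H : ℝ × ℝ → ℝ) (F : ParaC → ℝ × ℝ → Mat2) (t : ℝ)
    (l : ParaC) (P₁ P₂ : ℝ × ℝ → ParaC) : Prop where
  sq_eq : l ^ 2 = star (expI t)
  mul_star : l * star l = 1
  fst_eq : ∀ p ∈ D, P₁ p = l * (ofReal (Real.sqrt (2 * H p)) * star (frameSnd F (t, p)))
  snd_eq : ∀ p ∈ D, P₂ p = star l * (ofReal (Real.sqrt (2 * H p)) * star (frameFst F (t, p)))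

theorem IsFrame.sqrt_sq (h : IsFrame D H κ B (frameFst F) (frameSnd F)) (hp : p ∈ D) :
    ofReal (Real.sqrt (2 * H p)) ^ 2 = 2 * ofReal (H p) := by
  have := h.pos p hp
  rw [sq, ← ofReal_mul, Real.mul_self_sqrt (by positivity), ofReal_mul, ofReal_two]

theorem IsFrame.wirt_sqrt (h : IsFrame D H κ B (frameFst F) (frameSnd F)) (hp : p ∈ D) :
    HasWirt (fun q => ofReal (Real.sqrt (2 * H q))) (ofReal (Real.sqrt (2 * H p)) * κ p)
      (ofReal (Real.sqrt (2 * H p)) * star (κ p)) p := by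
  have hpos := h.pos p hp
  have hg : HasDerivAt (fun x : ℝ => Real.sqrt (2 * x)) (2 * 1 / (2 * Real.sqrt (2 * H p))) (H p) :=
    ((hasDerivAt_id (H p)).const_mul 2).sqrt (by simp only [id]; positivity)
  have hs : 0 < Real.sqrt (2 * H p) := Real.sqrt_pos.2 (by positivity)
  have e : ofReal (2 * 1 / (2 * Real.sqrt (2 * H p))) * (2 * ofReal (H p)) =
      ofReal (Real.sqrt (2 * H p)) := by
    rw [← ofReal_two, ← ofReal_mul, ← ofReal_mul]
    congr 1
    field_simp
    rw [Real.sq_sqrt (by positivity)]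
  refine ((h.wirt_H p hp).comp_ofReal hg).congr_deriv ?_ ?_
  · linear_combination κ p * e
  · linear_combination star (κ p) * e

/-- The factor `√(2H)` gauges `κ` away from the `z̄`-derivative. In the `z`-derivative it leaves a
multiple of the spinor itself, which disappears from the Wronskian. -/
theorem IsFrameSpinors.wirt_fst (hP : IsFrameSpinors D H F t l P₁ P₂) (hD : IsOpen D)
    (h : IsFrame D H κ B (frameFst F) (frameSnd F)) (hp : p ∈ D) :
    HasWirt P₁ (2 * κ p * P₁ p + star (expI t) * B p * ofReal (H p)⁻¹ * I *
        (l * (ofReal (Real.sqrt (2 * H p)) * star (frameFst F (t, p)))))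
      (expI t * ofReal (H p) * I *
        (l * (ofReal (Real.sqrt (2 * H p)) * star (frameFst F (t, p))))) p := by
  refine ((((h.wirt_sqrt hp).mul (h.wirt_snd t p hp).conj).const_mul l).congr ?_).congr_deriv ?_ ?_
  · filter_upwards [hD.mem_nhds hp] with q hq using hP.fst_eq q hq
  · rw [hP.fst_eq p hp]
    simp only [star_add, star_neg, star_mul, star_star, star_I, star_ofReal]; ring
  · simp only [star_sub, star_neg, star_mul, star_star, star_I, star_ofReal]; ring

theorem IsFrameSpinors.wirt_star_snd (hP : IsFrameSpinors D H F t l P₁ P₂) (hD : IsOpen D)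
    (h : IsFrame D H κ B (frameFst F) (frameSnd F)) (hp : p ∈ D) :
    HasWirt (fun q => star (P₂ q)) (2 * κ p * star (P₂ p) +
        star (expI t) * B p * ofReal (H p)⁻¹ * I *
        (l * (ofReal (Real.sqrt (2 * H p)) * frameSnd F (t, p))))
      (expI t * ofReal (H p) * I *
        (l * (ofReal (Real.sqrt (2 * H p)) * frameSnd F (t, p)))) p := by
  have e : ∀ q ∈ D, star (P₂ q) = l * (ofReal (Real.sqrt (2 * H q)) * frameFst F (t, q)) :=
    fun q hq => by
      rw [hP.snd_eq q hq]; simp only [star_mul, star_star, star_ofReal]; ring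
  refine ((((h.wirt_sqrt hp).mul (h.wirt_fst t p hp)).const_mul l).congr ?_).congr_deriv ?_ ?_
  · filter_upwards [hD.mem_nhds hp] with q hq using e q hq
  · rw [e p hp]; ring
  · ring

theorem IsFrameSpinors.smooth (hP : IsFrameSpinors D H F t l P₁ P₂)
    (h : IsFrame D H κ B (frameFst F) (frameSnd F)) :
    ContDiffOn ℝ ∞ P₁ D ∧ ContDiffOn ℝ ∞ P₂ D := by
  have hk : ContDiffOn ℝ ∞ (fun q => ofReal (Real.sqrt (2 * H q))) D :=
    ofRealL.contDiff.comp_contDiffOn ((contDiffOn_const.mul h.smooth_H).sqrt fun p hp => by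
      have := h.pos p hp
      positivity)
  constructor
  · exact (contDiffOn_const.mul (hk.mul (contDiffOn_slice h.smooth_snd t).paraConj)).congr
      fun q hq => hP.fst_eq q hq
  · exact (contDiffOn_const.mul (hk.mul (contDiffOn_slice h.smooth_fst t).paraConj)).congr
      fun q hq => hP.snd_eq q hq

theorem ofReal_supportFn (χ₁ χ₂ : ℝ × ℝ → ParaC) (p : ℝ × ℝ) :
    ofReal (supportFn χ₁ χ₂ p) = 2 * (χ₂ p * star (χ₂ p) - χ₁ p * star (χ₁ p)) := by
  rw [supportFn, ofReal_mul, ofReal_sub, ofReal_two, ← mul_star_eq_norm, ← mul_star_eq_norm]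

theorem IsFrameSpinors.supportFn_eq (hP : IsFrameSpinors D H F t l P₁ P₂)
    (h : IsFrame D H κ B (frameFst F) (frameSnd F)) (hp : p ∈ D) :
    supportFn P₁ P₂ p = 4 * H p := by
  apply ofReal_injective
  have hd := h.det t p hp
  have hl := hP.mul_star
  have hk := h.sqrt_sq hp
  rw [ofReal_supportFn, hP.fst_eq p hp, hP.snd_eq p hp, ofReal_mul,
    show ofReal 4 = 4 by ext <;> simp]
  simp only [star_mul, star_star, star_ofReal]
  generalize ofReal (Real.sqrt (2 * H p)) = k at *
  linear_combination 2 * k ^ 2 * (frameFst F (t, p) * star (frameFst F (t, p)) -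
    frameSnd F (t, p) * star (frameSnd F (t, p))) * hl + 2 * k ^ 2 * hd + 2 * hk

theorem half_mul_two : ofReal (1 / 2) * 2 = 1 := by
  rw [← ofReal_two, ← ofReal_mul]; norm_num [ofReal_one]

/-- In the Wronskian the `2κ` terms cancel and `αᾱ - ββ̄ = 1` leaves `λ²·2H = 2μ⁻¹H` times
`μ⁻¹BH⁻¹`; the factor `-i'/2` and the `i'` of the Lax matrix combine with this to `μ⁻²B`. -/
theorem IsFrameSpinors.abreschRosenberg_eq (hP : IsFrameSpinors D H F t l P₁ P₂) (hD : IsOpen D)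
    (h : IsFrame D H κ B (frameFst F) (frameSnd F)) (hp : p ∈ D) :
    abreschRosenberg 1 P₁ P₂ p = star (expI t) ^ 2 * B p := by
  have hd := h.det t p hp
  have hk := h.sqrt_sq hp
  have hl := hP.sq_eq
  have e := I_mul_I
  have eH := h.H_mul_inv hp
  have e2 := half_mul_two
  rw [ParaC.abreschRosenberg_eq (hasWirt_const 1 p) (hP.wirt_fst hD h hp)
    (hP.wirt_star_snd hD h hp) (Filter.Eventually.of_forall fun q => (one_mul _).symm)
    (Filter.Eventually.of_forall fun q => (one_mul _).symm)]
  rw [hP.fst_eq p hp, hP.snd_eq p hp]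
  simp only [star_mul, star_star, star_ofReal]
  generalize ofReal (Real.sqrt (2 * H p)) = k at *
  generalize frameFst F (t, p) = a at *
  generalize frameSnd F (t, p) = b at *
  generalize star a = a' at *
  generalize star b = b' at *
  generalize ofReal (H p) = E at *
  generalize ofReal (H p)⁻¹ = R at *
  generalize star (expI t) = μ' at *
  generalize ofReal (1 / 2) = r at *
  generalize B p = B₀ at *
  have e3 : l ^ 2 * k ^ 2 = μ' * (2 * E) := by rw [hl, hk]
  linear_combination r * (I * I) * μ' * B₀ * R * (l ^ 2 * k ^ 2) * hd
    + r * (I * I) * μ' * B₀ * R * e3 + r * 2 * μ' ^ 2 * B₀ * R * E * e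
    + μ' ^ 2 * B₀ * R * E * e2 + μ' ^ 2 * B₀ * eH

theorem IsFrameSpinors.generating (hP : IsFrameSpinors D H F t l P₁ P₂) (hD : IsOpen D)
    (h : IsFrame D H κ B (frameFst F) (frameSnd F)) (hF : IsExtendedFrame D ψ₁ ψ₂ F)
    (hΩ : Ω ⊆ D) : IsGeneratingSpinors 1 P₁ P₂ (symSurface (-1) F (expI t)) Ω := by
  obtain ⟨h1, h2⟩ := hP.smooth h
  refine ⟨one_mem_fourUnits, smoothOn_iff.2 (h1.mono hΩ), smoothOn_iff.2 (h2.mono hΩ),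
    fun p hp k => ?_⟩
  have hk := h.sqrt_sq (hΩ hp)
  have hl := hP.sq_eq
  rw [leftDz_symSurface_neg hD h hF (hΩ hp) t k, hP.fst_eq p (hΩ hp), hP.snd_eq p (hΩ hp)]
  have e3 : l ^ 2 * ofReal (Real.sqrt (2 * H p)) ^ 2 = star (expI t) * (2 * ofReal (H p)) := by
    rw [hl, hk]
  fin_cases k
  · simp only [spinorVec, star_mul, star_star, star_ofReal, Fin.zero_eta, Matrix.cons_val_zero]
    linear_combination (-I) * (frameFst F (t, p) ^ 2 + star (frameSnd F (t, p)) ^ 2) * e3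
  · simp only [spinorVec, star_mul, star_star, star_ofReal, Fin.mk_one, Matrix.cons_val_one,
      Matrix.cons_val_zero]
    linear_combination (-1) * (frameFst F (t, p) ^ 2 - star (frameSnd F (t, p)) ^ 2) * e3
  · simp only [spinorVec, star_mul, star_star, star_ofReal, Fin.reduceFinMk, Matrix.cons_val]
    linear_combination (-2) * (frameFst F (t, p) * star (frameSnd F (t, p))) * e3

theorem IsFrameSpinors.dual_eq (hP : IsFrameSpinors D H F t l P₁ P₂)
    (h : IsFrame D H κ B (frameFst F) (frameSnd F)) (hp : p ∈ D) :
    dualSpinor₁ s P₁ P₂ p = ofReal (H p)⁻¹ * s p * P₂ p ∧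
      star (dualSpinor₂ s P₁ P₂ p) = ofReal (H p)⁻¹ * s p * star (P₁ p) := by
  have e : (4 / supportFn P₁ P₂ p) = (H p)⁻¹ := by
    rw [hP.supportFn_eq h hp, div_mul_eq_div_div, div_self four_ne_zero, one_div]
  constructor
  · rw [dualSpinor₁, e, smul_eq_ofReal_mul, mul_assoc]
  · rw [dualSpinor₂, e, smul_eq_ofReal_mul]
    simp only [star_mul, star_star, star_ofReal]; ring

/-- The dual spinors are generating spinors of `f_+`. -/
theorem IsFrameSpinors.generating_dual (hP : IsFrameSpinors D H F t l P₁ P₂) (hD : IsOpen D)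
    (h : IsFrame D H κ B (frameFst F) (frameSnd F)) (hF : IsExtendedFrame D ψ₁ ψ₂ F)
    (hΩ : Ω ⊆ D) (hs : IsRootOn ε 1 s P₁ P₂ Ω) :
    IsGeneratingSpinors ε (dualSpinor₁ s P₁ P₂) (dualSpinor₂ s P₁ P₂)
      (symSurface 1 F (expI t)) Ω := by
  obtain ⟨h1, h2⟩ := hP.smooth h
  obtain ⟨hε, hs1, hs2⟩ := hs
  rw [smoothOn_iff] at hs1
  have hR : ContDiffOn ℝ ∞ (fun q => ofReal (H q)⁻¹) D :=
    ofRealL.contDiff.comp_contDiffOn (h.smooth_H.inv fun p hp => (h.pos p hp).ne')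
  have hRs := (hR.mono hΩ).mul hs1
  refine ⟨hε, smoothOn_iff.2 ?_, smoothOn_iff.2 ?_, fun p hp k => ?_⟩
  · exact (hRs.mul (h2.mono hΩ)).congr fun q hq => (hP.dual_eq h (hΩ hq)).1
  · refine (hRs.mul (h1.mono hΩ).paraConj).paraConj.congr fun q hq => ?_
    rw [← star_star (dualSpinor₂ s P₁ P₂ q), (hP.dual_eq h (hΩ hq)).2]
  · obtain ⟨d1, d2⟩ := hP.dual_eq (s := s) h (hΩ hp)
    have hk := h.sqrt_sq (hΩ hp)
    have hl := hP.sq_eq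
    have hll := hP.mul_star
    have hμ := expI_mul_star t
    have eH := h.H_mul_inv (hΩ hp)
    have hsq := hs2 p hp
    rw [hP.abreschRosenberg_eq hD h (hΩ hp)] at hsq
    have hεε := fourUnits_mul_self hε
    rw [leftDz_symSurface_pos hD h hF (hΩ hp) t k]
    have e3 : star l ^ 2 * ofReal (Real.sqrt (2 * H p)) ^ 2 = expI t * (2 * ofReal (H p)) := by
      have := congrArg star hl
      rw [star_pow, star_star] at this
      rw [this, hk]
    -- The dual spinors contribute `(s/H)² λ̄²·2H` with `s² = εμ⁻²B` and `λ̄² = μ`. The unit `ε` in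
    -- front cancels the `ε` in `s²`, which is why the dual carries this unit.
    have e4 : ε * (ofReal (H p)⁻¹ ^ 2 * s p ^ 2) *
        (star l ^ 2 * ofReal (Real.sqrt (2 * H p)) ^ 2) =
        2 * star (expI t) * B p * ofReal (H p)⁻¹ := by
      rw [hsq, e3]
      linear_combination 2 * ofReal (H p)⁻¹ ^ 2 * star (expI t) ^ 2 * B p * expI t * ofReal (H p) *
        hεε + 2 * ofReal (H p)⁻¹ ^ 2 * star (expI t) * B p * ofReal (H p) * hμ +
        2 * ofReal (H p)⁻¹ * star (expI t) * B p * eH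
    rw [← e4]
    have d1' : dualSpinor₁ s P₁ P₂ p = (ofReal (H p)⁻¹ * s p *
      (star l * ofReal (Real.sqrt (2 * H p)))) * star (frameFst F (t, p)) := by
      rw [d1, hP.snd_eq p (hΩ hp)]; ring
    have d2' : star (dualSpinor₂ s P₁ P₂ p) = (ofReal (H p)⁻¹ * s p *
      (star l * ofReal (Real.sqrt (2 * H p)))) * frameSnd F (t, p) := by
      rw [d2, hP.fst_eq p (hΩ hp)]
      simp only [star_mul, star_star, star_ofReal]; ring
    fin_cases k
    · simp only [spinorVec, d1', d2', star_star, Fin.zero_eta, Matrix.cons_val_zero]; ring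
    · simp only [spinorVec, d1', d2', star_star, Fin.mk_one, Matrix.cons_val_one,
        Matrix.cons_val_zero]; ring
    · simp only [spinorVec, d1', d2', star_star, Fin.reduceFinMk, Matrix.cons_val]; ring

theorem IsFrameSpinors.isDualSurface (hP : IsFrameSpinors D H F t l P₁ P₂) (hD : IsOpen D)
    (h : IsFrame D H κ B (frameFst F) (frameSnd F)) (hF : IsExtendedFrame D ψ₁ ψ₂ F)
    (hΩ : Ω ⊆ D) (hs : IsRootOn ε 1 s P₁ P₂ Ω) {f : ℝ × ℝ → Fin 3 → ℝ}
    (hf : IsGeneratingSpinors 1 P₁ P₂ f Ω) :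
    IsDualSurface f (symSurface 1 F (expI t)) Ω := by
  refine ⟨ε, 1, s, P₁, P₂, hf, fun p hp => ?_, hs, ?_⟩
  · rw [hP.supportFn_eq h (hΩ hp)]
    have := h.pos p (hΩ hp)
    positivity
  · rw [mul_one]; exact hP.generating_dual hD h hF hΩ hs

/-- Dualization swaps the two spinors, so the difference of their norms changes sign; the result is
nonzero exactly where `ss̄` is. -/
theorem IsFrameSpinors.supportFn_dual (hP : IsFrameSpinors D H F t l P₁ P₂)
    (h : IsFrame D H κ B (frameFst F) (frameSnd F)) (hp : p ∈ D) :
    supportFn (dualSpinor₁ s P₁ P₂) (dualSpinor₂ s P₁ P₂) p =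
      -(4 * ((H p)⁻¹ * QuadraticAlgebra.norm (s p))) := by
  obtain ⟨d1, d2⟩ := hP.dual_eq (s := s) h hp
  have hs := hP.supportFn_eq h hp
  have n1 : QuadraticAlgebra.norm (dualSpinor₂ s P₁ P₂ p) =
      (H p)⁻¹ * (H p)⁻¹ * QuadraticAlgebra.norm (s p) * QuadraticAlgebra.norm (P₁ p) := by
    rw [← QuadraticAlgebra.norm_star, d2, map_mul, map_mul, norm_ofReal,
      QuadraticAlgebra.norm_star]
  have n2 : QuadraticAlgebra.norm (dualSpinor₁ s P₁ P₂ p) =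
      (H p)⁻¹ * (H p)⁻¹ * QuadraticAlgebra.norm (s p) * QuadraticAlgebra.norm (P₂ p) := by
    rw [d1, map_mul, map_mul, norm_ofReal]
  have e : (H p)⁻¹ * H p = 1 := inv_mul_cancel₀ (h.pos p hp).ne'
  rw [supportFn] at hs ⊢
  rw [n1, n2]
  linear_combination (-(H p)⁻¹ * (H p)⁻¹ * QuadraticAlgebra.norm (s p)) * hs -
    4 * (H p)⁻¹ * QuadraticAlgebra.norm (s p) * e

/-- The Wronskian now involves the `z`-derivatives of `P₂` and `P̄₁`, which are the Dirac
derivatives with coefficient `H` and not `B`. The factor `B` comes from `T² = s²/H²`, and `ε² = 1`.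
Hence the same `ε` and `s` can be used to dualize again. -/
theorem IsFrameSpinors.abreschRosenberg_dual (hP : IsFrameSpinors D H F t l P₁ P₂) (hD : IsOpen D)
    (h : IsFrame D H κ B (frameFst F) (frameSnd F)) (hΩ : Ω ⊆ D) (hΩo : IsOpen Ω)
    (hs : IsRootOn ε 1 s P₁ P₂ Ω) (hp : p ∈ Ω) :
    abreschRosenberg ε (dualSpinor₁ s P₁ P₂) (dualSpinor₂ s P₁ P₂) p =
      star (expI t) ^ 2 * B p := by
  have hev : ∀ᶠ q in nhds p, q ∈ D := hD.mem_nhds (hΩ hp)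
  obtain ⟨hε, hs1, hs2⟩ := hs
  rw [smoothOn_iff] at hs1
  have hT := (h.wirt_inv (hΩ hp)).mul
    (hasWirt ((hs1.contDiffAt (hΩo.mem_nhds hp)).differentiableAt (by simp)))
  have hu : HasWirt P₂ _ _ p := ((hP.wirt_star_snd hD h (hΩ hp)).conj).congr
    (Filter.Eventually.of_forall fun q => (star_star _).symm)
  have hv := (hP.wirt_fst hD h (hΩ hp)).conj
  rw [ParaC.abreschRosenberg_eq hT hu hv
    (hev.mono fun q hq => (hP.dual_eq h hq).1) (hev.mono fun q hq => (hP.dual_eq h hq).2)]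
  have hk := h.sqrt_sq (hΩ hp)
  have hl := congrArg star hP.sq_eq
  rw [star_pow, star_star] at hl
  have hμ := expI_mul_star t
  have eH := h.H_mul_inv (hΩ hp)
  have hsq := hs2 p hp
  rw [hP.abreschRosenberg_eq hD h (hΩ hp)] at hsq
  have hεε := fourUnits_mul_self hε
  have hd := h.det t p (hΩ hp)
  have e := I_mul_I
  have e2 := half_mul_two
  rw [hP.fst_eq p (hΩ hp), hP.snd_eq p (hΩ hp), mul_pow, hsq]
  simp only [star_mul, star_star, star_ofReal, star_I]
  generalize ofReal (Real.sqrt (2 * H p)) = k at *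
  generalize frameFst F (t, p) = a at *
  generalize frameSnd F (t, p) = b at *
  generalize star a = a' at *
  generalize star b = b' at *
  generalize ofReal (H p) = E at *
  generalize ofReal (H p)⁻¹ = R at *
  generalize star (expI t) = μ' at *
  generalize expI t = μ at *
  generalize star l = l' at *
  generalize ofReal (1 / 2) = r at *
  generalize B p = B₀ at *
  have e3 : l' ^ 2 * k ^ 2 = μ * (2 * E) := by rw [hl, hk]
  linear_combination ε * r * (I * I) * (R ^ 2 * (ε * (μ' ^ 2 * B₀))) * μ' * E *
      (l' ^ 2 * k ^ 2) * hd
    + ε * r * (I * I) * (R ^ 2 * (ε * (μ' ^ 2 * B₀))) * μ' * E * e3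
    + ε * r * (R ^ 2 * (ε * (μ' ^ 2 * B₀))) * μ' * E * (μ * (2 * E)) * e
    + r * (R ^ 2 * (μ' ^ 2 * B₀)) * μ' * E * (μ * (2 * E)) * hεε
    + r * (R ^ 2 * (μ' ^ 2 * B₀)) * E * (2 * E) * hμ
    + R ^ 2 * (μ' ^ 2 * B₀) * E * E * e2
    + (R * E + 1) * (μ' ^ 2 * B₀) * eH

/-- The double dual is `(-P₁, -P₂)` because the support function has changed sign; `Φ` is quadratic
and does not see this, and the unit is `ε·ε = 1`. -/
theorem IsFrameSpinors.isDualSurface_symm (hP : IsFrameSpinors D H F t l P₁ P₂) (hD : IsOpen D)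
    (h : IsFrame D H κ B (frameFst F) (frameSnd F)) (hF : IsExtendedFrame D ψ₁ ψ₂ F)
    (hΩ : Ω ⊆ D) (hΩo : IsOpen Ω) (hs : IsRootOn ε 1 s P₁ P₂ Ω)
    (hB : ∀ p ∈ Ω, QuadraticAlgebra.norm (B p) ≠ 0) :
    IsDualSurface (symSurface 1 F (expI t)) (symSurface (-1) F (expI t)) Ω := by
  have hgen := hP.generating hD h hF hΩ
  obtain ⟨hε, hs1, hs2⟩ := id hs
  have hns : ∀ p ∈ Ω, QuadraticAlgebra.norm (s p) ≠ 0 := fun p hp h0 => by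
    have := congrArg QuadraticAlgebra.norm (hs2 p hp)
    rw [hP.abreschRosenberg_eq hD h (hΩ hp), map_pow, h0, map_mul, map_mul, map_pow,
      QuadraticAlgebra.norm_star, norm_expI] at this
    have h1 := norm_of_mem_fourUnits hε
    have h2 := hB p hp
    simp [h1, h2] at this
  have key : ∀ p ∈ Ω, dualSpinor₁ s (dualSpinor₁ s P₁ P₂) (dualSpinor₂ s P₁ P₂) p = -P₁ p ∧
      dualSpinor₂ s (dualSpinor₁ s P₁ P₂) (dualSpinor₂ s P₁ P₂) p = -P₂ p := fun p hp => by
    obtain ⟨d1, d2⟩ := hP.dual_eq (s := s) h (hΩ hp)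
    have d2' : dualSpinor₂ s P₁ P₂ p = ofReal (H p)⁻¹ * star (s p) * P₁ p := by
      rw [← star_star (dualSpinor₂ s P₁ P₂ p), d2]
      simp only [star_mul, star_star, star_ofReal]; ring
    have hH := (h.pos p (hΩ hp)).ne'
    have e : ofReal (4 / -(4 * ((H p)⁻¹ * QuadraticAlgebra.norm (s p)))) * ofReal (H p)⁻¹ *
        (s p * star (s p)) = -1 := by
      rw [mul_star_eq_norm, ← ofReal_mul, ← ofReal_mul, ← ofReal_one, ← ofReal_neg]
      congr 1
      have := hns p hp
      field_simp
    constructor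
    · rw [dualSpinor₁, hP.supportFn_dual h (hΩ hp), d2', smul_eq_ofReal_mul]
      linear_combination P₁ p * e
    · rw [dualSpinor₂, hP.supportFn_dual h (hΩ hp), d1, smul_eq_ofReal_mul]
      linear_combination P₂ p * e
  refine ⟨ε, ε, s, dualSpinor₁ s P₁ P₂, dualSpinor₂ s P₁ P₂, hP.generating_dual hD h hF hΩ hs,
    fun p hp => ?_, ⟨hε, hs1, fun p hp => ?_⟩, ?_⟩
  · rw [hP.supportFn_dual h (hΩ hp)]
    have := hns p hp
    have := (h.pos p (hΩ hp)).ne'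
    simp [*]
  · rw [hs2 p hp, hP.abreschRosenberg_eq hD h (hΩ hp), hP.abreschRosenberg_dual hD h hΩ hΩo hs hp]
  · rw [fourUnits_mul_self hε]
    obtain ⟨g1, g2, g3, g4⟩ := hgen
    rw [smoothOn_iff] at g2 g3
    refine ⟨g1, smoothOn_iff.2 (g2.neg.congr fun p hp => (key p hp).1),
      smoothOn_iff.2 (g3.neg.congr fun p hp => (key p hp).2), fun p hp k => ?_⟩
    rw [g4 p hp k, (key p hp).1, (key p hp).2]
    fin_cases k <;> simp [spinorVec]

end Sym

end ParaC
end

noncomputable section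

namespace ParaC

/-! ### Frame spinors for each `μ` and at `μ = 1`; conclusion -/

section Sym

variable {D Ω : Set (ℝ × ℝ)} {ψ₁ ψ₂ : ℝ × ℝ → ParaC} {F : ParaC → ℝ × ℝ → Mat2}
  {H : ℝ × ℝ → ℝ} {κ B : ℝ × ℝ → ParaC}

/-- The circle is parametrized by `t ∈ ℝ`, so `μ⁻¹` has the square root `e^{-i't/2}`. -/
theorem isFrameSpinors_half (t : ℝ) : IsFrameSpinors D H F t (star (expI (t / 2)))
    (fun p => star (expI (t / 2)) *
      (ofReal (Real.sqrt (2 * H p)) * star (frameSnd F (t, p))))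
    (fun p => expI (t / 2) * (ofReal (Real.sqrt (2 * H p)) * star (frameFst F (t, p)))) where
  sq_eq := by rw [← star_pow, sq, ← expI_add, add_halves]
  mul_star := by rw [star_star, mul_comm, expI_mul_star]
  fst_eq _ _ := rfl
  snd_eq _ _ := by rw [star_star]

/-- The normalization of `F` at `μ = 1` divides by `√(ψ₂ψ̄₂ - ψ₁ψ̄₁) = √(2H)`, so with `λ = 1` the
given spinors are recovered. -/
theorem isFrameSpinors_one (hpos : ∀ p ∈ D, 0 < supportFn ψ₁ ψ₂ p)
    (hF : IsExtendedFrame D ψ₁ ψ₂ F) :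
    IsFrameSpinors D (fun p => supportFn ψ₁ ψ₂ p / 4) F 0 1 ψ₁ ψ₂ := by
  have key : ∀ p ∈ D, ∀ z : ParaC, z = ofReal (Real.sqrt (2 * (supportFn ψ₁ ψ₂ p / 4))) *
      (ofReal (1 / Real.sqrt (QuadraticAlgebra.norm (ψ₂ p) - QuadraticAlgebra.norm (ψ₁ p))) * z) :=
    fun p hp z => by
      have h := hpos p hp
      have e : 2 * (supportFn ψ₁ ψ₂ p / 4) =
          QuadraticAlgebra.norm (ψ₂ p) - QuadraticAlgebra.norm (ψ₁ p) := by
        rw [supportFn]; ring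
      have hs : Real.sqrt (2 * (supportFn ψ₁ ψ₂ p / 4)) ≠ 0 :=
        (Real.sqrt_pos.2 (by positivity)).ne'
      rw [← e, ← mul_assoc, ← ofReal_mul, mul_one_div, div_self hs, ofReal_one, one_mul]
  refine ⟨?_, ?_, fun p hp => ?_, fun p hp => ?_⟩
  · rw [expI_zero, star_one, one_pow]
  · rw [star_one, one_mul]
  · have e : frameSnd F (0, p) = _ := congrFun (congrFun ((expI_zero ▸ hF.at_one p hp :
      F (expI 0) p = _)) 0) 1
    rw [one_mul, e]
    simpa [smul_eq_ofReal_mul] using key p hp (ψ₁ p)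
  · have e : frameFst F (0, p) = _ := congrFun (congrFun ((expI_zero ▸ hF.at_one p hp :
      F (expI 0) p = _)) 0) 0
    rw [star_one, one_mul, e]
    simpa [smul_eq_ofReal_mul] using key p hp (ψ₂ p)

/-- Along the family the coefficient is `μ⁻²B`, so one root of `εB`, multiplied by `μ⁻¹`, serves for
all `μ` with the same `ε`. -/
theorem isRootOn_family {P₁ P₂ s : ℝ × ℝ → ParaC} {l ε : ParaC} {t : ℝ}
    (hP : IsFrameSpinors D H F t l P₁ P₂) (hD : IsOpen D)
    (h : IsFrame D H κ B (frameFst F) (frameSnd F)) (hΩ : Ω ⊆ D) (hε : ε ∈ fourUnits)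
    (hs : ContDiffOn ℝ ∞ s Ω) (hsq : ∀ p ∈ Ω, s p ^ 2 = ε * B p) :
    IsRootOn ε 1 (fun p => star (expI t) * s p) P₁ P₂ Ω := by
  refine ⟨hε, smoothOn_iff.2 (contDiffOn_const.mul hs), fun p hp => ?_⟩
  rw [hP.abreschRosenberg_eq hD h (hΩ hp), mul_pow, hsq p hp]
  ring

theorem isDualSurface_family (hD : IsOpen D) (h : IsFrame D H κ B (frameFst F) (frameSnd F))
    (hF : IsExtendedFrame D ψ₁ ψ₂ F) (hΩ : Ω ⊆ D) (hΩo : IsOpen Ω) (hΩc : IsPreconnected Ω)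
    (hB : ∀ p ∈ Ω, QuadraticAlgebra.norm (B p) ≠ 0) (t : ℝ) :
    IsDualSurface (symSurface (-1) F (expI t)) (symSurface 1 F (expI t)) Ω ∧
      IsDualSurface (symSurface 1 F (expI t)) (symSurface (-1) F (expI t)) Ω := by
  obtain ⟨ε, hε, s, hs, hsq⟩ := exists_root hΩc (h.smooth_B.mono hΩ) hB
  have hP := isFrameSpinors_half (D := D) (H := H) (F := F) t
  have hroot := isRootOn_family hP hD h hΩ hε hs hsq
  exact ⟨hP.isDualSurface hD h hF hΩ hroot (hP.generating hD h hF hΩ),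
    hP.isDualSurface_symm hD h hF hΩ hΩo hroot hB⟩

theorem isDualSurface_one (hD : IsOpen D) {f : ℝ × ℝ → Fin 3 → ℝ}
    (hψ : IsGeneratingSpinors 1 ψ₁ ψ₂ f D) (hpos : ∀ p ∈ D, 0 < supportFn ψ₁ ψ₂ p)
    (hF : IsExtendedFrame D ψ₁ ψ₂ F) (hΩ : Ω ⊆ D) (hΩc : IsPreconnected Ω)
    (hB : ∀ p ∈ Ω, QuadraticAlgebra.norm (abreschRosenberg 1 ψ₁ ψ₂ p) ≠ 0) :
    IsDualSurface f (symSurface 1 F 1) Ω := by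
  obtain ⟨h1, h2, h3, h4⟩ := hψ
  have h := isFrame_of_isExtendedFrame hD h2 h3 hpos hF
  obtain ⟨ε, hε, s, hs, hsq⟩ := exists_root hΩc (h.smooth_B.mono hΩ) hB
  rw [← expI_zero]
  refine (isFrameSpinors_one hpos hF).isDualSurface hD h hF hΩ
    ⟨hε, smoothOn_iff.2 hs, hsq⟩ ⟨h1, ?_, ?_, fun p hp => h4 p (hΩ hp)⟩
  · exact smoothOn_iff.2 ((smoothOn_iff.1 h2).mono hΩ)
  · exact smoothOn_iff.2 ((smoothOn_iff.1 h3).mono hΩ)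

theorem generatingSpinors_dual_one (hD : IsOpen D) {f : ℝ × ℝ → Fin 3 → ℝ}
    (hψ : IsGeneratingSpinors 1 ψ₁ ψ₂ f D) (hpos : ∀ p ∈ D, 0 < supportFn ψ₁ ψ₂ p)
    (hF : IsExtendedFrame D ψ₁ ψ₂ F) (hΩ : Ω ⊆ D) {ε : ParaC} {s : ℝ × ℝ → ParaC}
    (hs : IsRootOn ε 1 s ψ₁ ψ₂ Ω) :
    IsGeneratingSpinors ε (dualSpinor₁ s ψ₁ ψ₂) (dualSpinor₂ s ψ₁ ψ₂) (symSurface 1 F 1) Ω := by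
  obtain ⟨-, h2, h3, -⟩ := hψ
  rw [← expI_zero]
  exact (isFrameSpinors_one hpos hF).generating_dual hD
    (isFrame_of_isExtendedFrame hD h2 h3 hpos hF) hF hΩ hs

theorem exists_symSurface_eq_mul (hD : IsOpen D) (hDc : IsPreconnected D)
    {f : ℝ × ℝ → Fin 3 → ℝ} (hf : ∀ p ∈ D, DifferentiableAt ℝ f p)
    (hψ : IsGeneratingSpinors 1 ψ₁ ψ₂ f D) (hpos : ∀ p ∈ D, 0 < supportFn ψ₁ ψ₂ p)
    (hF : IsExtendedFrame D ψ₁ ψ₂ F) :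
    ∃ a : Fin 3 → ℝ, ∀ p ∈ D, symSurface (-1) F 1 p = NilT.mul a (f p) := by
  obtain ⟨-, h2, h3, h4⟩ := hψ
  have h := isFrame_of_isExtendedFrame hD h2 h3 hpos hF
  rw [← expI_zero]
  obtain ⟨-, -, -, g4⟩ := (isFrameSpinors_one hpos hF).generating hD h hF subset_rfl
  exact exists_leftTranslation hD hDc hf
    (fun p hp => ((contDiffOn_symSurface hD h hF 0 (-1)).contDiffAt
      (hD.mem_nhds hp)).differentiableAt (by simp))
    fun p hp k => (g4 p hp k).trans (h4 p hp k).symm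

end Sym

end ParaC

end

theorem mainTheorem5
    (D : Set (ℝ × ℝ)) (hD : IsOpen D) (hDc : IsPreconnected D)
    (f : ℝ × ℝ → Fin 3 → ℝ) (hf : ∀ p ∈ D, IsTimelikeMinimalAt f p)
    (ψ₁ ψ₂ : ℝ × ℝ → ParaC) (hψ : IsGeneratingSpinors 1 ψ₁ ψ₂ f D)
    (hpos : ∀ p ∈ D, 0 < supportFn ψ₁ ψ₂ p)
    (hB : ∃ p ∈ D, abreschRosenberg 1 ψ₁ ψ₂ p ≠ 0)
    (F : ParaC → ℝ × ℝ → Mat2) (hF : IsExtendedFrame D ψ₁ ψ₂ F) :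
    -- For each `μ` the maps are well defined, smooth, and timelike minimal where immersive.
    (∀ μ ∈ ParaC.circle,
      (∀ p ∈ D,
        suVec (suCoord (normalM F μ p)) = normalM F μ p ∧
        suVec (symSurface (-1) F μ p) = symHat (-1) F μ p ∧
        suVec (symSurface 1 F μ p) = symHat 1 F μ p) ∧
      ContDiffOn ℝ ∞ (symSurface (-1) F μ) D ∧
      ContDiffOn ℝ ∞ (symSurface 1 F μ) D ∧
      (∀ p ∈ D,
        (IsImmersedAt (symSurface (-1) F μ) p ↔ suCoord (normalM F μ p) 2 ≠ 0) ∧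
        (IsImmersedAt (symSurface 1 F μ) p ↔ suCoord (normalM F μ p) 2 ≠ 0 ∧
          QuadraticAlgebra.norm (abreschRosenberg 1 ψ₁ ψ₂ p) ≠ 0) ∧
        (IsImmersedAt (symSurface (-1) F μ) p →
          IsTimelikeMinimalAt (symSurface (-1) F μ) p ∧
          IsNormalGaussMapAt (symSurface (-1) F μ) (suCoord (normalM F μ p)) p) ∧
        (IsImmersedAt (symSurface 1 F μ) p →
          IsTimelikeMinimalAt (symSurface 1 F μ) p ∧
          IsNormalGaussMapAt (fun q => NilT.halfTurn (symSurface 1 F μ q))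
            (suCoord (normalM F μ p)) p))) ∧
    -- At `μ = 1` the map `f_-` is `f` up to a left translation,
    (∃ a : Fin 3 → ℝ, ∀ p ∈ D, symSurface (-1) F 1 p = NilT.mul a (f p)) ∧
    -- and `f_+` has the dual spinors of `f`, for each choice of the root.
    (∀ Ω ⊆ D, IsOpen Ω → ∀ (ε : ParaC) (s : ℝ × ℝ → ParaC), IsRootOn ε 1 s ψ₁ ψ₂ Ω →
      IsGeneratingSpinors ε (dualSpinor₁ s ψ₁ ψ₂) (dualSpinor₂ s ψ₁ ψ₂) (symSurface 1 F 1) Ω) ∧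
    -- The root exists on connected sets without zeros of `B B̄`; duality for every `μ`.
    (∀ Ω ⊆ D, IsOpen Ω → IsPreconnected Ω →
      (∀ p ∈ Ω, QuadraticAlgebra.norm (abreschRosenberg 1 ψ₁ ψ₂ p) ≠ 0) →
      IsDualSurface f (symSurface 1 F 1) Ω ∧
      ∀ μ ∈ ParaC.circle,
        IsDualSurface (symSurface (-1) F μ) (symSurface 1 F μ) Ω ∧
        IsDualSurface (symSurface 1 F μ) (symSurface (-1) F μ) Ω) := by
  have h := ParaC.isFrame_of_isExtendedFrame hD hψ.2.1 hψ.2.2.1 hpos hF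
  refine ⟨?_, ParaC.exists_symSurface_eq_mul hD hDc
      (fun p hp => (hf p hp).1.differentiableAt (by simp)) hψ hpos hF,
    fun Ω hΩ _ ε s hs => ParaC.generatingSpinors_dual_one hD hψ hpos hF hΩ hs,
    fun Ω hΩ hΩo hΩc hB => ⟨ParaC.isDualSurface_one hD hψ hpos hF hΩ hΩc hB, ?_⟩⟩
  · rintro _ ⟨t, rfl⟩
    refine ⟨fun p hp => ⟨ParaC.suVec_normalM hF hp t, ParaC.suVec_symSurface hD h hF hp t _,
      ParaC.suVec_symSurface hD h hF hp t _⟩, ParaC.contDiffOn_symSurface hD h hF t _,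
      ParaC.contDiffOn_symSurface hD h hF t _, fun p hp => ?_⟩
    have h1 := ParaC.isImmersedAt_symSurface_neg hD h hF hp t
    have h2 := ParaC.isImmersedAt_symSurface_pos hD h hF hp t
    exact ⟨h1, h2,
      fun himm => ⟨ParaC.isTimelikeMinimalAt_symSurface_neg hD h hF hp t himm,
        ParaC.isNormalGaussMapAt_symSurface_neg hD h hF hp t (h1.1 himm)⟩,
      fun himm => ⟨ParaC.isTimelikeMinimalAt_symSurface_pos hD h hF hp t himm,
        ParaC.isNormalGaussMapAt_symSurface_pos hD h hF hp t (h2.1 himm).1⟩⟩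
  · rintro _ ⟨t, rfl⟩
    exact ParaC.isDualSurface_family hD h hF hΩ hΩo hΩc hB t
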